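/- **Setting.** There are $n$ balls $1,\dots,n$ with fixed colors. A color is the *majority* of a list of $N$ (distinct) balls if more than $\lfloor N/2\rfloor$ of them have it. The only access to the colors is the comparison $\mathsf{cmp}(x,y)$, which is true if $x,y$ have equal colors and false otherwise; the cost of an algorithm is the number of comparisons it performs. A randomized algorithm may in addition draw uniformly random permutations, independently of each other and of the colors. **The algorithm.** Each of the following procedures gets a list $M$ of $N$ balls and returns either "no majority" or a ball of the majority color of $M$ with the multiplicity of that color in $M$. *$\textsc{majority}(M)$.* If $N=0$, return "no majority"; if $N=1$, return the ball with multiplicity $1$. Otherwise let $\varepsilon=N^{-1/10}$ and draw a uniformly random sample $M'$ of $\lceil N^{1/3}\rceil$ balls of $M$ without replacement. Determine the color classes of $M'$ by comparing each new ball with the representatives of the classes found so far until one matches. Let $v_1,\dots,v_k$ be the representatives and $q_1\ge\dots\ge q_k$ the corresponding class sizes divided by $|M'|$ ($q_2=0$ if $k=1$). If $q_1,q_2\in[\frac12-4\varepsilon,\frac12+4\varepsilon]$, return $\textsc{balanced}(M)$; else, if $q_1\ge 0.45$ and $q_1^2\ge q_2^2+\dots+q_k^2+2\varepsilon$, return $\textsc{heavy}(M,v_1)$;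 else return $\textsc{light}(M)$. *Pairing step of $\textsc{balanced}$ and $\textsc{light}$.* Shuffle $M$ uniformly at random and compare the 1st ball with the 2nd, the 3rd with the 4th, and so on. Let $X$ list the second ball of every pair of equal colors and let $Y$ list the pairs of different colors. If $N$ is odd, one ball $z$ stays unpaired; let $X'$ be $X$ together with $z$ if $N$ is odd and $|X|$ is even, and $X'=X$ otherwise. Call $\textsc{majority}(X')$. If it returns "no majority", return "no majority". Otherwise it returns a ball $v$ and a multiplicity; if $N$ is odd, also compare $v$ with $z$. Let $e=1$ if $N$ is odd and $z$ has the color of $v$, and $e=0$ otherwise; let $k$ be the multiplicity of the color of $v$ in $X$ (the returned multiplicity, minus $e$ if $z\in X'$). *$\textsc{balanced}(M)$.* After the pairing step, for each pair of $Y$ compare $v$ with its first ball and, only if the colors differ, with its second ball; let $c$ be the number of pairs in which a ball of the color of $v$ was found. Let $\mathsf{cnt}=2k+e+c$. If $\mathsf{cnt}\le N/2$, return "no majority", else return $v$ with multiplicity $\mathsf{cnt}$. *$\textsc{light}(M)$.* After the pairing step, let $\mathsf{cnt}=2k+e-|X|$ (always at least $1$). Go through the pairs of $Y$ in order; for each,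 compare $v$ with its first ball and, only if the colors differ, with its second ball; if both differ from $v$ in color, decrease $\mathsf{cnt}$ by $1$; as soon as $\mathsf{cnt}=0$, return "no majority". If the list ends with $\mathsf{cnt}>0$, return $v$ with multiplicity $\lfloor N/2\rfloor+\mathsf{cnt}$. *$\textsc{heavy}(M,v)$.* Compare $v$ with every ball of $M$; let $\mathsf{cnt}$ be the number of balls of its color and $X$ the list of the others. If $\mathsf{cnt}>N/2$, return $v$ with multiplicity $\mathsf{cnt}$. Otherwise let $k=\lceil N/2\rceil-\mathsf{cnt}$, shuffle $X$ uniformly at random and compare its 1st ball with the 2nd, the 3rd with the 4th, and so on, stopping as soon as $k$ pairs of different colors have been found (at once if $k=0$); in that case return "no majority". If the pairs are exhausted before that, run the Boyer–Moore algorithm on $M$ (one sweep that maintains a candidate and a counter, then counting the final candidate by comparing it with every ball of $M$, at most $2N$ comparisons in total) and return its answer. **Theorem.** Let $T$ be the number of comparisons performed by $\textsc{majority}$ on the list of all $n$ balls. 1. For every $n$, every coloring and every outcome of the random choices the answer is correct: if a ball $v$ and a number $k$ are returned, then $k>\lfloor n/2\rfloor$ and exactly $k$ balls have the color of $v$; if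 "no majority" is returned, no color occurs on more than $\lfloor n/2\rfloor$ balls. 2. There are constants $c>0$ and $C$ such that for every $n\ge 1$ and every coloring of $n$ balls $$\Pr\Bigl[T\le \tfrac76 n+C\,n^{9/10}\Bigr]\ \ge\ 1-\exp(-c\log^2 n).$$ 3. There is a function $f:\mathbb N\to\mathbb R$ with $f(n)=o(n)$ such that $\mathbb E[T]\le\frac76 n+f(n)$ for every $n$ and every coloring of $n$ balls. -/

import Mathlib

universe u

namespace ColorMajority

/-! ## The comparison model

A randomized algorithm on balls of type `β` is a tree: it may stop with an answer, compare the
colors of two balls and branch on the outcome, or draw a uniformly random permutation.  It has no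
other access to the colors. -/

/-- Randomized comparison algorithms on balls from `β` with answers in `α`. -/
inductive Alg (β α : Type) : Type
  | done (a : α) : Alg β α
  | compare (x y : β) (next : Bool → Alg β α) : Alg β α
  | randPerm (n : ℕ) (next : Equiv.Perm (Fin n) → Alg β α) : Alg β α

namespace Alg

variable {β α γ : Type}

/-- Run the first algorithm, then continue with the second one on its answer. -/
def andThen : Alg β α → (α → Alg β γ) → Alg β γ
  | done a, f => f a
  | compare x y next, f => compare x y (fun b => andThen (next b) f)
  | randPerm n next, f => randPerm n (fun σ => andThen (next σ) f)

instance : Monad (Alg β) where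
  pure := done
  bind := andThen

/-- The joint law of the answer and of the number of comparisons, for fixed colors of the balls.
Every permutation drawn is uniform and independent of the previous ones. -/
noncomputable def run {κ : Type u} [DecidableEq κ] (color : β → κ) : Alg β α → PMF (α × ℕ)
  | done a => PMF.pure (a, 0)
  | compare x y next =>
      (run color (next (decide (color x = color y)))).map (fun r => (r.1, r.2 + 1))
  | randPerm n next =>
      (PMF.uniformOfFintype (Equiv.Perm (Fin n))).bind (fun σ => run color (next σ))

end Alg

variable {β : Type}

/-- `cmp(x, y)`: one color comparison, true for equality. -/
def cmp (x y : β) : Alg β Bool :=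
  Alg.compare x y Alg.done

/-- Randomly shuffle a list. -/
def shuffle (M : List β) : Alg β (List β) :=
  Alg.randPerm M.length (fun σ => Alg.done (List.ofFn (fun i => M.get (σ i))))

/-! ## Pieces shared by the subprocedures

The answer of a majority procedure on a list is `some (v, k)` (the color of `v` is the majority,
with multiplicity `k`) or `none` (there is no majority). -/

/-- Compare `M[1]` with `M[2]`, `M[3]` with `M[4]`, and so on.  Returns the list `X` holding the
second ball of every pair of equal colors, the list `Y` of the pairs of different colors, and the
unpaired last ball, if the length is odd. -/
def splitPairs : List β → Alg β (List β × List (β × β) × Option β)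
  | [] => pure ([], [], none)
  | [z] => pure ([], [], some z)
  | x :: y :: l => do
      let b ← cmp x y
      let r ← splitPairs l
      pure (if b then (y :: r.1, r.2.1, r.2.2) else (r.1, (x, y) :: r.2.1, r.2.2))

/-- The input of the recursive call: `X`, and also the unpaired ball if there is one and `|X|` is
even. -/
def reduced (X : List β) : Option β → List β
  | none => X
  | some z => if Even X.length then X ++ [z] else X

/-- Given the multiplicity `k` of the color of `v` in `reduced X o`, find its multiplicity in `X`
and its multiplicity (0 or 1) among the unpaired balls `o`, with at most one comparison. -/
def resolve (v : β) (k : ℕ) (X : List β) : Option β → Alg β (ℕ × ℕ)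
  | none => pure (k, 0)
  | some z => do
      if ← cmp v z then
        pure (if Even X.length then k - 1 else k, 1)
      else
        pure (k, 0)

/-- Compare `v` with every ball; returns the number of balls of its color and the list of the
others. -/
def separate (v : β) : List β → Alg β (ℕ × List β)
  | [] => pure (0, [])
  | x :: l => do
      let b ← cmp v x
      let r ← separate v l
      pure (if b then (r.1 + 1, r.2) else (r.1, x :: r.2))

/-! ## The Boyer-Moore algorithm -/

/-- The sweep of the Boyer-Moore algorithm, with the current candidate and counter. -/
def boyerMooreSweep : List β → β → ℕ → Alg β β
  | [], v, _ => pure v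
  | x :: l, _, 0 => boyerMooreSweep l x 1
  | x :: l, v, c + 1 => do
      if ← cmp v x then
        boyerMooreSweep l v (c + 2)
      else
        boyerMooreSweep l v c

/-- The Boyer-Moore algorithm: find the only candidate in one sweep, then count it. -/
def boyerMoore (M : List β) : Alg β (Option (β × ℕ)) :=
  match M with
  | [] => pure none
  | x :: l => do
      let v ← boyerMooreSweep l x 1
      let r ← separate v M
      pure (if M.length < 2 * r.1 then some (v, r.1) else none)

/-! ## The procedure `balanced` -/

/-- The number of balls of the color of `v` in a list of pairs of different colors; the second ball
of a pair is inspected only if the first one is not of that color. -/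
def countInPairs (v : β) : List (β × β) → Alg β ℕ
  | [] => pure 0
  | (x, y) :: l => do
      if ← cmp v x then
        let c ← countInPairs v l
        pure (c + 1)
      else if ← cmp v y then
        let c ← countInPairs v l
        pure (c + 1)
      else
        countInPairs v l

/-- `balanced(M)`; the argument `rec` is the procedure called recursively. -/
def balanced (rec : List β → Alg β (Option (β × ℕ))) (M : List β) :
    Alg β (Option (β × ℕ)) := do
  let S ← shuffle M
  let (X, Y, o) ← splitPairs S
  match ← rec (reduced X o) with
  | none => pure none
  | some (v, k') => do
      let (k, e) ← resolve v k' X o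
      let c ← countInPairs v Y
      let cnt := 2 * k + e + c
      pure (if 2 * cnt ≤ M.length then none else some (v, cnt))

/-! ## The procedure `heavy` -/

/-- Compare consecutive pairs until `k` pairs of different colors are found; the answer tells
whether this succeeded. -/
def findDistinctPairs : List β → ℕ → Alg β Bool
  | _, 0 => pure true
  | x :: y :: l, k + 1 => do
      if ← cmp x y then
        findDistinctPairs l (k + 1)
      else
        findDistinctPairs l k
  | _, _ + 1 => pure false

/-- `heavy(M, v)`. -/
def heavy (M : List β) (v : β) : Alg β (Option (β × ℕ)) := do
  let (cnt, X) ← separate v M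
  if M.length < 2 * cnt then
    pure (some (v, cnt))
  else
    -- the number of pairs wanted is `⌈|M| / 2⌉ - cnt`
    let S ← shuffle X
    if ← findDistinctPairs S ((M.length + 1) / 2 - cnt) then
      pure none
    else
      boyerMoore M

/-! ## The procedure `light` -/

/-- Go through pairs of different colors, decreasing the counter at every pair without a ball of
the color of `v`, until the counter is 0 or the list ends; returns the final counter. -/
def lightLoop (v : β) : List (β × β) → ℕ → Alg β ℕ
  | _, 0 => pure 0
  | [], cnt + 1 => pure (cnt + 1)
  | (x, y) :: l, cnt + 1 => do
      if ← cmp v x then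
        lightLoop v l (cnt + 1)
      else if ← cmp v y then
        lightLoop v l (cnt + 1)
      else
        lightLoop v l cnt

/-- `light(M)`; the argument `rec` is the procedure called recursively. -/
def light (rec : List β → Alg β (Option (β × ℕ))) (M : List β) :
    Alg β (Option (β × ℕ)) := do
  let S ← shuffle M
  let (X, Y, o) ← splitPairs S
  match ← rec (reduced X o) with
  | none => pure none
  | some (v, k') => do
      let (k, e) ← resolve v k' X o
      -- this counter is at least 1, because the color of `v` is the majority in `reduced X o`
      let cnt ← lightLoop v Y (2 * k + e - X.length)
      pure (if cnt = 0 then none else some (v, M.length / 2 + cnt))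

/-! ## The main procedure -/

/-- Put `x` into its color class, given as a list of representatives with class sizes. -/
def insertClass (x : β) : List (β × ℕ) → Alg β (List (β × ℕ))
  | [] => pure [(x, 1)]
  | (v, c) :: L => do
      if ← cmp v x then
        pure ((v, c + 1) :: L)
      else
        let L' ← insertClass x L
        pure ((v, c) :: L')

/-- Add all balls of a list to the color classes found so far. -/
def classify : List β → List (β × ℕ) → Alg β (List (β × ℕ))
  | [], L => pure L
  | x :: l, L => do
      let L' ← insertClass x L
      classify l L'

open Classical in
/-- `majority(M)`.  The first argument bounds the depth of the recursion.  A recursive call is on a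
strictly shorter list, so a bound of `|M|` is never exhausted on a nonempty list. -/
noncomputable def majorityAux : ℕ → List β → Alg β (Option (β × ℕ))
  | 0, _ => pure none
  | _ + 1, [] => pure none
  | _ + 1, [x] => pure (some (x, 1))
  | fuel + 1, M => do
      let n : ℝ := M.length
      let ε : ℝ := n ^ (-(1 / 10) : ℝ)
      let S ← shuffle M
      let sample := S.take ⌈n ^ (1 / 3 : ℝ)⌉₊
      let L ← classify sample []
      let q : ℕ → ℝ := fun c => (c : ℝ) / sample.length
      -- representatives, by non-increasing frequency in the sample
      match L.mergeSort (fun a b => decide (b.2 ≤ a.2)) with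
      | [] => pure none -- impossible, as the sample is not empty
      | (v₁, c₁) :: rest =>
          let q₁ := q c₁
          let q₂ := q ((rest.map Prod.snd).headD 0)
          if q₁ ∈ Set.Icc (1 / 2 - 4 * ε) (1 / 2 + 4 * ε) ∧
              q₂ ∈ Set.Icc (1 / 2 - 4 * ε) (1 / 2 + 4 * ε) then
            balanced (majorityAux fuel) M
          else if (0.45 : ℝ) ≤ q₁ ∧ (rest.map (fun r => q r.2 ^ 2)).sum + 2 * ε ≤ q₁ ^ 2 then
            heavy M v₁
          else
            light (majorityAux fuel) M

/-- The algorithm on a list of balls. -/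
noncomputable def majority (M : List β) : Alg β (Option (β × ℕ)) :=
  majorityAux M.length M

/-! ## Correctness and cost -/

/-- The number of balls of color `a`. -/
def multiplicity {n : ℕ} {κ : Type u} [DecidableEq κ] (color : Fin n → κ) (a : κ) : ℕ :=
  (Finset.univ.filter (fun i => color i = a)).card

/-- An answer is correct if it is a ball whose color is on more than `⌊n / 2⌋` balls together with
the multiplicity of that color, or if it says that there is no such color and there is none. -/
def IsCorrect {n : ℕ} {κ : Type u} [DecidableEq κ] (color : Fin n → κ) :
    Option (Fin n × ℕ) → Prop
  | some (v, k) => multiplicity color (color v) = k ∧ n / 2 < k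
  | none => ∀ a : κ, multiplicity color a ≤ n / 2

/-- The joint law of the answer and of the number of comparisons of the algorithm on `n` balls. -/
noncomputable def majorityLaw {n : ℕ} {κ : Type u} [DecidableEq κ] (color : Fin n → κ) :
    PMF (Option (Fin n × ℕ) × ℕ) :=
  (majority (List.finRange n)).run color

end ColorMajority

/-! Correctness is deterministic. In a pair of different colors no color occurs twice, so a majority
of `M` must already be a majority of `reduced X`, where `z` is added or not according to parity. The
recursion therefore delivers the only possible candidate, and the final loop determines its
multiplicity or refutes it (`num_eq_pairs`, `num_reduced_of_majority`). In `heavy`, every pair of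
different colors wastes a ball for any given color.

For the cost, let `h = N / 2` be the number of pairs, `p` the frequency of the candidate and `s` the
sum of the squares of all frequencies. A shuffled list behaves like independent pairs: about `h s`
pairs have equal colors, `h p ^ 2` of them with the candidate's color, so a returned candidate
satisfies `u = 2 p ^ 2 - s ≥ 0` up to fluctuations. Testing it on `t` pairs costs about `t w` with
`w = 2 (1 - s) - p (1 - p)`. If the recursion costs `7/6` per ball, one level is affordable as soon
as `h + 7/6 h s + t w ≤ 7/3 h`. For two colors of frequency `1/2` this is an equality with `t = h`,
and `balanced` treats the neighborhood of that point (`balanced_real`). In `light` the counter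
starts near `h u` and drops with probability `r = 1 - s - 2 p (1 - p)` per pair, so `t` is about `h
u / r`; this suffices if `p ≤ 0.46` or `u` is negligible (`light_poly`, `light_real`). In the
remaining case `heavy` finds enough pairs of different colors among about `N (1 - p) ^ 2` balls and
costs less than `7/6 N` outright (`heavyCost_le`). The sample tells these cases apart up to `tol`.

The fluctuations are controlled by a martingale bound for functions of a random permutation that
change little under transpositions (`sum_exp_perm_le`). All prefixes and all colors are treated at
once, because the candidate depends on the recursion and the stopping point on the candidate. Errors
of order `N ^ (9/10)` per level form a geometric series; lists shorter than `n ^ (9/10)` are charged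
the deterministic linear bound. That bound also turns the tail estimate into the expectation. -/

namespace ColorMajority

open scoped ENNReal

/-! ### Laws, failure probabilities and union bounds for algorithms. -/

section Semantics

variable {β α γ : Type} {κ : Type u} [DecidableEq κ] (color : β → κ)

theorem run_pure (a : α) : (pure a : Alg β α).run color = PMF.pure (a, 0) := rfl

theorem run_cmp (x y : β) :
    (cmp x y).run color = PMF.pure (decide (color x = color y), 1) := by
  simp [cmp, Alg.run, PMF.pure_map]

theorem run_shuffle (M : List β) :
    (shuffle M).run color = (PMF.uniformOfFintype (Equiv.Perm (Fin M.length))).map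
      (fun σ => (List.ofFn (fun i => M.get (σ i)), 0)) := by
  simp [shuffle, Alg.run, PMF.map, Function.comp_def]

/-- The law of a composed algorithm: the costs are added. -/
theorem run_bind (a : Alg β α) (f : α → Alg β γ) :
    (a >>= f).run color =
      (a.run color).bind (fun r => ((f r.1).run color).map (fun r' => (r'.1, r'.2 + r.2))) := by
  change (a.andThen f).run color = _
  induction a with
  | done a =>
    simp only [Alg.andThen, Alg.run, PMF.pure_bind, add_zero]
    exact (PMF.map_id _).symm
  | compare x y next ih =>
    simp only [Alg.andThen, Alg.run, ih, PMF.bind_map, PMF.map_bind, PMF.map_comp]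
    rfl
  | randPerm n next ih => simp only [Alg.andThen, Alg.run, ih, PMF.bind_bind]

/-- The probability that the answer and the cost violate `Q`. -/
noncomputable def failProb (a : Alg β α) (Q : α → ℕ → Prop) : ℝ≥0∞ :=
  (a.run color).toOuterMeasure {r | ¬ Q r.1 r.2}

/-- The algorithm makes no random choices that matter: its answer is `v` and its cost is `c`. -/
def Det (a : Alg β α) (v : α) (c : ℕ) : Prop := a.run color = PMF.pure (v, c)

variable {color}

theorem Det.pure (a : α) : Det color (Pure.pure a : Alg β α) a 0 := rfl

theorem Det.cmp (x y : β) : Det color (cmp x y) (decide (color x = color y)) 1 := run_cmp color x y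

theorem Det.bind {a : Alg β α} {f : α → Alg β γ} {v : α} {w : γ} {c d : ℕ}
    (ha : Det color a v c) (hf : Det color (f v) w d) : Det color (a >>= f) w (d + c) := by
  unfold Det at *
  rw [run_bind, ha, PMF.pure_bind, hf, PMF.pure_map]

theorem failProb_mono {a : Alg β α} {Q Q' : α → ℕ → Prop} (h : ∀ x c, Q x c → Q' x c) :
    failProb color a Q' ≤ failProb color a Q :=
  MeasureTheory.measure_mono fun _ hr hq => hr (h _ _ hq)

theorem failProb_and_le (a : Alg β α) (Q Q' : α → ℕ → Prop) :
    failProb color a (fun x c => Q x c ∧ Q' x c) ≤ failProb color a Q + failProb color a Q' := by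
  refine le_trans (MeasureTheory.measure_mono ?_) (MeasureTheory.measure_union_le _ _)
  intro r hr
  by_cases h : Q r.1 r.2
  · exact Or.inr fun h' => hr ⟨h, h'⟩
  · exact Or.inl h

theorem failProb_eq_zero_iff {a : Alg β α} {Q : α → ℕ → Prop} :
    failProb color a Q = 0 ↔ ∀ r ∈ (a.run color).support, Q r.1 r.2 := by
  rw [failProb, PMF.toOuterMeasure_apply_eq_zero_iff, Set.disjoint_left]
  simp

theorem failProb_pure {x : α} {Q : α → ℕ → Prop} (h : Q x 0) (δ : ℝ≥0∞) :
    failProb color (pure x : Alg β α) Q ≤ δ := by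
  refine le_trans (le_of_eq ?_) zero_le
  rw [failProb_eq_zero_iff, run_pure]
  simpa using h

theorem failProb_det {a : Alg β α} {v : α} {c : ℕ} (ha : Det color a v c) {Q : α → ℕ → Prop}
    (h : Q v c) (δ : ℝ≥0∞) : failProb color a Q ≤ δ := by
  refine le_trans (le_of_eq ?_) zero_le
  rw [failProb_eq_zero_iff, ha]
  simpa using h

theorem failProb_bind_eq (a : Alg β α) (f : α → Alg β γ) (Q : γ → ℕ → Prop) :
    failProb color (a >>= f) Q =
      ∑' r, a.run color r * failProb color (f r.1) (fun y d => Q y (d + r.2)) := by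
  rw [failProb, run_bind, PMF.toOuterMeasure_bind_apply]
  refine tsum_congr fun r => ?_
  rw [PMF.toOuterMeasure_map_apply]
  rfl

theorem failProb_le_one (a : Alg β α) (Q : α → ℕ → Prop) : failProb color a Q ≤ 1 := by
  refine le_trans (MeasureTheory.measure_mono (Set.subset_univ _)) ?_
  rw [(PMF.toOuterMeasure_apply_eq_one_iff _ _).2 (Set.subset_univ _)]

/-- A union bound along a composition. -/
theorem failProb_bind_le {a : Alg β α} {f : α → Alg β γ} {P : α → ℕ → Prop} {Q : γ → ℕ → Prop}
    {δ₁ δ₂ : ℝ≥0∞} (ha : failProb color a P ≤ δ₁)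
    (hf : ∀ x c, P x c → failProb color (f x) (fun y d => Q y (d + c)) ≤ δ₂) :
    failProb color (a >>= f) Q ≤ δ₁ + δ₂ := by
  classical
  rw [failProb_bind_eq]
  have hle : ∀ r : α × ℕ, a.run color r * failProb color (f r.1) (fun y d => Q y (d + r.2)) ≤
      Set.indicator {r : α × ℕ | ¬ P r.1 r.2} (a.run color) r + a.run color r * δ₂ := by
    intro r
    by_cases hr : P r.1 r.2
    · exact le_add_left (mul_le_mul_right (hf _ _ hr) _)
    · rw [Set.indicator_of_mem (show r ∈ {r : α × ℕ | ¬ P r.1 r.2} from hr)]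
      exact le_add_right (mul_le_of_le_one_right' (failProb_le_one _ _))
  refine (ENNReal.tsum_le_tsum hle).trans ?_
  rw [ENNReal.tsum_add, ENNReal.tsum_mul_right, PMF.tsum_coe, one_mul,
    ← PMF.toOuterMeasure_apply]
  exact add_le_add_left ha _

theorem failProb_det_bind {a : Alg β α} {f : α → Alg β γ} {v : α} {c : ℕ} (ha : Det color a v c)
    {Q : γ → ℕ → Prop} {δ : ℝ≥0∞} (hf : failProb color (f v) (fun y d => Q y (d + c)) ≤ δ) :
    failProb color (a >>= f) Q ≤ δ := by
  rw [← zero_add δ]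
  refine failProb_bind_le (P := fun x c' => x = v ∧ c' = c) (failProb_det ha ⟨rfl, rfl⟩ 0) ?_
  rintro x c ⟨rfl, rfl⟩
  exact hf

theorem failProb_shuffle (M : List β) (P : List β → ℕ → Prop) :
    failProb color (shuffle M) P = (PMF.uniformOfFintype (Equiv.Perm (Fin M.length))).toOuterMeasure
      {σ | ¬ P (List.ofFn (fun i => M.get (σ i))) 0} := by
  rw [failProb, run_shuffle, PMF.toOuterMeasure_map_apply]
  rfl

/-- If every shuffled list is handled well, so is a shuffle. -/
theorem failProb_shuffle_bind {M : List β} {f : List β → Alg β γ} {Q : γ → ℕ → Prop}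
    {P : List β → Prop} {δ₁ δ₂ : ℝ≥0∞} (hP : failProb color (shuffle M) (fun S _ => P S) ≤ δ₁)
    (hf : ∀ S : List β, S.Perm M → P S → failProb color (f S) Q ≤ δ₂) :
    failProb color (shuffle M >>= f) Q ≤ δ₁ + δ₂ := by
  -- Being a permutation of `M` at no cost is a sure event, so it can be added to `P` without
  -- raising `δ₁`.
  refine failProb_bind_le (P := fun S c => (S.Perm M ∧ c = 0) ∧ P S)
    ((failProb_and_le _ _ _).trans ?_) ?_
  · rw [← zero_add δ₁]
    refine add_le_add (le_of_eq ?_) hP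
    rw [failProb_eq_zero_iff, run_shuffle]
    intro r hr
    rw [PMF.support_map] at hr
    obtain ⟨σ, -, rfl⟩ := hr
    refine ⟨?_, rfl⟩
    have := Equiv.Perm.ofFn_comp_perm σ M.get
    rwa [List.ofFn_get] at this
  · rintro S c ⟨⟨hS, rfl⟩, hPS⟩
    exact hf S hS hPS

end Semantics

/-! ### Counting in pairs; the subroutines that need no randomness. -/

section Pairs

variable {β : Type} {κ : Type u} [DecidableEq κ] (color : β → κ)

/-- The number of balls of color `a` in a list. -/
def num (a : κ) (l : List β) : ℕ := l.countP (fun x => decide (color x = a))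

/-- The consecutive disjoint pairs of a list. -/
def pairs : List β → List (β × β)
  | x :: y :: l => (x, y) :: pairs l
  | _ => []

/-- The last ball of a list of odd length. -/
def leftover : List β → Option β
  | [] => none
  | [z] => some z
  | _ :: _ :: l => leftover l

/-- The second balls of the pairs of equal colors. -/
def sames (P : List (β × β)) : List β :=
  (P.filter (fun q => decide (color q.1 = color q.2))).map Prod.snd

/-- The pairs of different colors. -/
def diffs (P : List (β × β)) : List (β × β) :=
  P.filter (fun q => decide (color q.1 ≠ color q.2))

/-- The number of pairs with a ball of color `a`. -/
def hits (a : κ) (P : List (β × β)) : ℕ :=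
  P.countP (fun q => decide (color q.1 = a ∨ color q.2 = a))

/-- The number of comparisons that look for the color `a` in a list of pairs. -/
def probeCost (a : κ) (P : List (β × β)) : ℕ :=
  (P.map (fun q => if color q.1 = a then 1 else 2)).sum

variable {color}

@[simp] theorem num_nil (a : κ) : num color a [] = 0 := rfl

theorem num_cons (a : κ) (x : β) (l : List β) :
    num color a (x :: l) = num color a l + if color x = a then 1 else 0 := by
  simp [num, List.countP_cons]

theorem num_append (a : κ) (l l' : List β) :
    num color a (l ++ l') = num color a l + num color a l' := List.countP_append

theorem num_le_length (a : κ) (l : List β) : num color a l ≤ l.length := List.countP_le_length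

theorem num_perm {l l' : List β} (h : l.Perm l') (a : κ) : num color a l = num color a l' :=
  h.countP_eq _

theorem length_pairs : ∀ l : List β, (pairs l).length = l.length / 2
  | [] => by simp [pairs]
  | [_] => by simp [pairs]
  | x :: y :: l => by simp [pairs, length_pairs l]; omega

theorem length_leftover : ∀ l : List β, (leftover l).toList.length = l.length % 2
  | [] => rfl
  | [_] => rfl
  | x :: y :: l => by simp [leftover, length_leftover l]; omega

theorem length_sames_add_diffs (P : List (β × β)) :
    (sames color P).length + (diffs color P).length = P.length := by
  induction P with
  | nil => rfl
  | cons q P ih =>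
    simp only [sames, diffs, List.length_map, List.filter_cons, List.length_cons] at ih ⊢
    by_cases h : color q.1 = color q.2 <;> simp [h] at ih ⊢ <;> omega

/-- An equal pair holds two balls of color `a` or none and is represented once in `sames`; a pair of
different colors holds at most one, so there `hits` counts balls as well as pairs. -/
theorem num_eq_pairs (a : κ) : ∀ l : List β, num color a l =
    2 * num color a (sames color (pairs l)) + hits color a (diffs color (pairs l)) +
      num color a (leftover l).toList
  | [] => rfl
  | [_] => by simp [pairs, sames, diffs, hits, leftover]
  | x :: y :: l => by
    have ih := num_eq_pairs a l
    simp only [num_cons, pairs, leftover, sames, diffs, hits, List.filter_cons] at ih ⊢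
    by_cases h : color x = color y
    · simp only [h, decide_true, if_true, List.map_cons, num_cons, ne_eq, not_true_eq_false,
        decide_false, Bool.false_eq_true, if_false]
      simp only [ne_eq] at ih
      split_ifs <;> omega
    · simp only [h, decide_false, Bool.false_eq_true, if_false, ne_eq, not_false_eq_true,
        decide_true, if_true, List.countP_cons, decide_eq_true_eq]
      simp only [ne_eq] at ih
      by_cases hx : color x = a <;> by_cases hy : color y = a
      · exact absurd (hx.trans hy.symm) h
      all_goals simp only [hx, hy, if_true, if_false, or_true, true_or, or_self]; omega

theorem probeCost_le (a : κ) (P : List (β × β)) : probeCost color a P ≤ 2 * P.length := by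
  induction P with
  | nil => simp [probeCost]
  | cons q P ih =>
    simp only [probeCost, List.map_cons, List.sum_cons, List.length_cons] at ih ⊢
    split_ifs <;> omega

/-! ### The deterministic parts of the algorithm -/

theorem det_splitPairs : ∀ l : List β, Det color (splitPairs l)
    (sames color (pairs l), diffs color (pairs l), leftover l) (l.length / 2)
  | [] => by simp [pairs, leftover, sames, diffs, splitPairs, Det.pure]
  | [_] => by simp [pairs, leftover, sames, diffs, splitPairs, Det.pure]
  | x :: y :: l => by
    have hlen : (x :: y :: l).length / 2 = 0 + l.length / 2 + 1 := by simp; omega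
    rw [hlen]
    refine (Det.cmp (color := color) x y).bind ((det_splitPairs l).bind ?_)
    by_cases hxy : color x = color y
    · simpa [hxy, pairs, leftover, sames, diffs] using Det.pure _
    · simpa [hxy, pairs, leftover, sames, diffs] using Det.pure _

theorem det_resolve (v : β) (X : List β) (o : Option β) :
    ∃ c ≤ 1, Det color (resolve v (num color (color v) (reduced X o)) X o)
      (num color (color v) X, num color (color v) o.toList) c := by
  cases o with
  | none => exact ⟨0, by simp, Det.pure _⟩
  | some z =>
    refine ⟨1, le_rfl, ?_⟩
    have h := (Det.cmp (color := color) v z).bind (f := fun b => if b then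
        (pure (if Even X.length then num color (color v) (reduced X (some z)) - 1
          else num color (color v) (reduced X (some z)), 1) : Alg β (ℕ × ℕ))
      else pure (num color (color v) (reduced X (some z)), 0))
      (w := (num color (color v) X, num color (color v) (some z).toList)) (d := 0) ?_
    · exact h
    · by_cases hz : color v = color z
      · by_cases hX : Even X.length
        · simp [hz, hX, reduced, num_append, num_cons, Det, run_pure]
        · simp [hz, hX, reduced, num_cons, Det, run_pure]
      · by_cases hX : Even X.length
        · simp [hz, Ne.symm hz, hX, reduced, num_append, num_cons, Det, run_pure]
        · simp [hz, Ne.symm hz, hX, reduced, num_cons, Det, run_pure]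

theorem det_separate (v : β) : ∀ l : List β, Det color (separate v l)
    (num color (color v) l, l.filter (fun x => decide (color x ≠ color v))) l.length
  | [] => Det.pure _
  | x :: l => by
    have hlen : (x :: l).length = 0 + l.length + 1 := by simp
    rw [hlen]
    refine (Det.cmp (color := color) v x).bind ((det_separate v l).bind ?_)
    by_cases hx : color v = color x
    · simpa [hx, num_cons] using Det.pure _
    · simpa [hx, Ne.symm hx, num_cons] using Det.pure _

/-- The counter stands for `k` extra copies of the candidate `v`: no color but that of `w` is a
strict majority of these copies together with `l`. This is inherited backwards through the sweep,
since cancelling a copy against a ball of another color removes two balls, at most one of them of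
color `a`. -/
theorem det_boyerMooreSweep : ∀ (l : List β) (v : β) (k : ℕ),
    ∃ w, ∃ c ≤ l.length, Det color (boyerMooreSweep l v k) w c ∧
      ∀ a, a ≠ color w → 2 * num color a l + (if color v = a then 2 * k else 0) ≤ l.length + k
  | [], v, k => ⟨v, 0, by simp, Det.pure _, fun a ha => by simp [Ne.symm ha]⟩
  | x :: l, v, 0 => by
    obtain ⟨w, c, hc, hd, h⟩ := det_boyerMooreSweep l x 1
    refine ⟨w, c, by simp; omega, hd, fun a ha => ?_⟩
    have := h a ha
    rw [num_cons]
    simp only [List.length_cons]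
    split_ifs at this ⊢ <;> omega
  | x :: l, v, k + 1 => by
    by_cases hx : color v = color x
    · obtain ⟨w, c, hc, hd, h⟩ := det_boyerMooreSweep l v (k + 2)
      refine ⟨w, c + 1, by simp; omega, ?_, fun a ha => ?_⟩
      · refine (Det.cmp (color := color) v x).bind ?_
        simpa [hx] using hd
      · have := h a ha
        rw [num_cons]
        simp only [List.length_cons, ← hx]
        split_ifs at this ⊢ <;> omega
    · obtain ⟨w, c, hc, hd, h⟩ := det_boyerMooreSweep l v k
      refine ⟨w, c + 1, by simp; omega, ?_, fun a ha => ?_⟩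
      · refine (Det.cmp (color := color) v x).bind ?_
        simpa [hx] using hd
      · have := h a ha
        rw [num_cons]
        simp only [List.length_cons]
        split_ifs at this ⊢ <;> first | omega | (exfalso; simp_all)

variable (color) in
/-- Correctness of the answer of a majority procedure on a list. -/
def CorrectOn (M : List β) : Option (β × ℕ) → Prop
  | some (v, k) => num color (color v) M = k ∧ M.length / 2 < k
  | none => ∀ a : κ, num color a M ≤ M.length / 2

theorem det_boyerMoore (M : List β) :
    ∃ r, ∃ c ≤ 2 * M.length, Det color (boyerMoore M) r c ∧ CorrectOn color M r := by
  cases M with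
  | nil => exact ⟨none, 0, by simp, Det.pure _, fun a => by simp⟩
  | cons x l =>
    obtain ⟨w, c, hc, hd, h⟩ := det_boyerMooreSweep (color := color) l x 1
    refine ⟨_, _, ?_, hd.bind ((det_separate w (x :: l)).bind (Det.pure _)), ?_⟩
    · simp; omega
    · split_ifs with hw
      · simp only [CorrectOn, true_and]
        simp only at hw
        omega
      · intro a
        by_cases ha : a = color w
        · subst ha
          simp only at hw
          omega
        · have := h a ha
          rw [num_cons]
          simp only [List.length_cons]
          split_ifs at this ⊢ <;> omega

theorem det_countInPairs (v : β) : ∀ P : List (β × β),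
    Det color (countInPairs v P) (hits color (color v) P) (probeCost color (color v) P)
  | [] => Det.pure _
  | (x, y) :: P => by
    have ih := det_countInPairs v P
    by_cases hx : color v = color x
    · have hp : probeCost color (color v) ((x, y) :: P) = 0 + probeCost color (color v) P + 1 := by
        simp [probeCost, hx]; omega
      rw [hp]
      refine (Det.cmp (color := color) v x).bind ?_
      have : hits color (color v) ((x, y) :: P) = hits color (color v) P + 1 := by
        simp [hits, hx]
      rw [this]
      simpa [hx] using ih.bind (f := fun c => pure (c + 1)) (Det.pure _)
    · have hx' : color x ≠ color v := Ne.symm hx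
      have hp : probeCost color (color v) ((x, y) :: P) = probeCost color (color v) P + 1 + 1 := by
        simp [probeCost, hx']; omega
      rw [hp]
      refine (Det.cmp (color := color) v x).bind ?_
      simp only [hx, decide_false, Bool.false_eq_true, if_false]
      refine (Det.cmp (color := color) v y).bind ?_
      by_cases hy : color v = color y
      · have : hits color (color v) ((x, y) :: P) = hits color (color v) P + 1 := by
          simp [hits, hy]
        rw [this]
        simpa [hy] using ih.bind (f := fun c => pure (c + 1)) (Det.pure _)
      · have : hits color (color v) ((x, y) :: P) = hits color (color v) P := by
          simp [hits, hx', Ne.symm hy]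
        rw [this]
        simpa [hy] using ih

/-- The last clause locates the stopping time: the search does not go beyond any prefix that already
contains `k` pairs of different colors, so its cost is read off from the statistics of a prefix
chosen in advance. -/
theorem det_findDistinctPairs : ∀ (l : List β) (k : ℕ),
    ∃ c, Det color (findDistinctPairs l k) (decide (k ≤ (diffs color (pairs l)).length)) c ∧
      c ≤ (pairs l).length ∧ ∀ t, k ≤ (diffs color ((pairs l).take t)).length → c ≤ t
  | l, 0 => ⟨0, by cases l <;> simpa [findDistinctPairs] using Det.pure _, by simp, by simp⟩
  | [], k + 1 => ⟨0, Det.pure _, by simp, by simp⟩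
  | [_], k + 1 => ⟨0, Det.pure _, by simp, by simp⟩
  | x :: y :: l, k + 1 => by
    by_cases hx : color x = color y
    · obtain ⟨c, hd, hc, ht⟩ := det_findDistinctPairs l (k + 1)
      refine ⟨c + 1, (Det.cmp (color := color) x y).bind ?_, by simpa [pairs] using hc, ?_⟩
      · simpa [hx, pairs, diffs] using hd
      · intro t h
        cases t with
        | zero => simp [diffs] at h
        | succ t =>
          have := ht t (by simpa [hx, pairs, diffs] using h)
          omega
    · obtain ⟨c, hd, hc, ht⟩ := det_findDistinctPairs l k
      refine ⟨c + 1, (Det.cmp (color := color) x y).bind ?_, by simpa [pairs] using hc, ?_⟩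
      · simpa [hx, pairs, diffs] using hd
      · intro t h
        cases t with
        | zero => simp [diffs] at h
        | succ t =>
          have := ht t (by simpa [hx, pairs, diffs] using h)
          omega

/-- The counter of `lightLoop` drops by one at each pair without a ball of the color of `v`. -/
theorem det_lightLoop (v : β) : ∀ (P : List (β × β)) (k : ℕ),
    ∃ c, Det color (lightLoop v P k) (k - (P.length - hits color (color v) P)) c ∧
      c ≤ probeCost color (color v) P ∧
      ∀ P₁ P₂, P = P₁ ++ P₂ → k + hits color (color v) P₁ ≤ P₁.length →
        c ≤ probeCost color (color v) P₁
  | P, 0 => ⟨0, by cases P <;> simpa [lightLoop] using Det.pure _, by simp, by simp⟩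
  | [], k + 1 => ⟨0, Det.pure _, by simp, by simp⟩
  | (x, y) :: P, k + 1 => by
    have hle : hits color (color v) P ≤ P.length := List.countP_le_length
    by_cases hx : color v = color x
    · obtain ⟨c, hd, hc, ht⟩ := det_lightLoop v P (k + 1)
      have hh : ∀ P', hits color (color v) ((x, y) :: P') = hits color (color v) P' + 1 :=
        fun P' => by simp [hits, hx]
      have hp : ∀ P', probeCost color (color v) ((x, y) :: P') =
          probeCost color (color v) P' + 1 := fun P' => by simp [probeCost, hx]; omega
      refine ⟨c + 1, (Det.cmp (color := color) v x).bind ?_, by rw [hp]; omega, ?_⟩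
      · rw [hh]
        simpa [hx] using hd
      -- The counter is still positive, so a prefix with enough misses to exhaust it cannot be
      -- empty.
      · intro P₁ P₂ h hk
        cases P₁ with
        | nil => simp [hits] at hk
        | cons q P₁ =>
          obtain ⟨rfl, rfl⟩ := List.cons_eq_cons.1 h
          rw [hh, List.length_cons] at hk
          have := ht P₁ P₂ rfl (by omega)
          rw [hp]
          omega
    · have hx' : color x ≠ color v := Ne.symm hx
      have hp : ∀ P', probeCost color (color v) ((x, y) :: P') =
          probeCost color (color v) P' + 2 := fun P' => by simp [probeCost, hx']; omega
      by_cases hy : color v = color y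
      · obtain ⟨c, hd, hc, ht⟩ := det_lightLoop v P (k + 1)
        have hh : ∀ P', hits color (color v) ((x, y) :: P') = hits color (color v) P' + 1 :=
          fun P' => by simp [hits, hy]
        refine ⟨c + 1 + 1, (Det.cmp (color := color) v x).bind ?_, by rw [hp]; omega, ?_⟩
        · simp only [hx, decide_false, Bool.false_eq_true, if_false]
          refine (Det.cmp (color := color) v y).bind ?_
          rw [hh]
          simpa [hy] using hd
        · intro P₁ P₂ h hk
          cases P₁ with
          | nil => simp [hits] at hk
          | cons q P₁ =>
            obtain ⟨rfl, rfl⟩ := List.cons_eq_cons.1 h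
            rw [hh, List.length_cons] at hk
            have := ht P₁ P₂ rfl (by omega)
            rw [hp]
            omega
      · obtain ⟨c, hd, hc, ht⟩ := det_lightLoop v P k
        have hh : ∀ P', hits color (color v) ((x, y) :: P') = hits color (color v) P' :=
          fun P' => by simp [hits, hx', Ne.symm hy]
        refine ⟨c + 1 + 1, (Det.cmp (color := color) v x).bind ?_, by rw [hp]; omega, ?_⟩
        · simp only [hx, decide_false, Bool.false_eq_true, if_false]
          refine (Det.cmp (color := color) v y).bind ?_
          have : k + 1 - (((x, y) :: P).length - hits color (color v) P) =
              k - (P.length - hits color (color v) P) := by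
            simp only [List.length_cons]; omega
          rw [hh, this]
          simpa [hy] using hd
        · intro P₁ P₂ h hk
          cases P₁ with
          | nil => simp [hits] at hk
          | cons q P₁ =>
            obtain ⟨rfl, rfl⟩ := List.cons_eq_cons.1 h
            rw [hh, List.length_cons] at hk
            have := ht P₁ P₂ rfl (by omega)
            rw [hp]
            omega

end Pairs

/-! ### Color classes of the sample and sums of squares. -/

section Classes

variable {β : Type} {κ : Type u} [DecidableEq κ] (color : β → κ)

/-- The number of ordered pairs of balls of equal colors, that is, the sum of the squares of the
multiplicities of the colors. -/
def sumSq (l : List β) : ℕ := (l.map (fun x => num color (color x) l)).sum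

/-- `L` lists representatives of the color classes of `l` with their sizes. -/
structure IsClasses (l : List β) (L : List (β × ℕ)) : Prop where
  nodup : (L.map (fun q => color q.1)).Nodup
  count : ∀ q ∈ L, q.2 = num color (color q.1) l
  cover : ∀ x ∈ l, ∃ q ∈ L, color q.1 = color x
  sq : (L.map (fun q => q.2 ^ 2)).sum = sumSq color l

variable {color}

theorem sum_indicator_eq_num (a : κ) (l : List β) :
    (l.map (fun y => if a = color y then 1 else 0)).sum = num color a l := by
  induction l with
  | nil => rfl
  | cons x l ih =>
    rw [num_cons, List.map_cons, List.sum_cons, ih, add_comm]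
    simp only [eq_comm]

theorem sumSq_cons (x : β) (l : List β) :
    sumSq color (x :: l) = sumSq color l + 2 * num color (color x) l + 1 := by
  have h : (l.map (fun y => num color (color y) (x :: l))).sum =
      sumSq color l + num color (color x) l := by
    simp only [num_cons, List.sum_map_add, sum_indicator_eq_num, sumSq]
  rw [sumSq, List.map_cons, List.sum_cons, h, num_cons, if_pos rfl]
  ring

theorem sumSq_perm {l l' : List β} (h : l.Perm l') : sumSq color l = sumSq color l' := by
  unfold sumSq
  simp only [num_perm h]
  exact (h.map _).sum_eq

theorem IsClasses.perm {l l' : List β} {L : List (β × ℕ)} (h : IsClasses color l L)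
    (hl : l.Perm l') : IsClasses color l' L where
  nodup := h.nodup
  count := fun q hq => (h.count q hq).trans (num_perm hl _)
  cover := fun x hx => h.cover x (hl.mem_iff.2 hx)
  sq := h.sq.trans (sumSq_perm hl)

theorem IsClasses.perm_right {l : List β} {L L' : List (β × ℕ)} (h : IsClasses color l L)
    (hL : L.Perm L') : IsClasses color l L' where
  nodup := (hL.map _).nodup_iff.1 h.nodup
  count := fun q hq => h.count q (hL.mem_iff.2 hq)
  cover := fun x hx => (h.cover x hx).imp fun _ hq => ⟨hL.mem_iff.1 hq.1, hq.2⟩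
  sq := (hL.map _).sum_eq.symm.trans h.sq

theorem det_insertClass (x : β) : ∀ L : List (β × ℕ),
    ∃ L', ∃ c ≤ L.length, Det color (insertClass x L) L' c ∧
      ((∃ L₁ v k L₂, L = L₁ ++ (v, k) :: L₂ ∧ color v = color x ∧ L' = L₁ ++ (v, k + 1) :: L₂) ∨
        ((∀ q ∈ L, color q.1 ≠ color x) ∧ L' = L ++ [(x, 1)]))
  | [] => ⟨[(x, 1)], 0, by simp, Det.pure _, Or.inr ⟨by simp, rfl⟩⟩
  | (v, k) :: L => by
    by_cases hv : color v = color x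
    · refine ⟨(v, k + 1) :: L, 1, by simp, ?_, Or.inl ⟨[], v, k, L, rfl, hv, rfl⟩⟩
      refine (Det.cmp (color := color) v x).bind (d := 0) ?_
      simpa [hv] using Det.pure _
    · obtain ⟨L', c, hc, hd, h⟩ := det_insertClass x L
      refine ⟨(v, k) :: L', 0 + c + 1, by simp; omega, ?_, ?_⟩
      · refine (Det.cmp (color := color) v x).bind ?_
        simp only [hv, decide_false, Bool.false_eq_true, if_false]
        exact hd.bind (Det.pure _)
      · rcases h with ⟨L₁, w, k', L₂, rfl, hw, rfl⟩ | ⟨h, rfl⟩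
        · exact Or.inl ⟨(v, k) :: L₁, w, k', L₂, rfl, hw, rfl⟩
        · refine Or.inr ⟨?_, rfl⟩
          intro q hq
          rcases List.mem_cons.1 hq with rfl | hq
          · exact hv
          · exact h q hq

/-- The representatives have pairwise different colors, so the new ball enlarges exactly one class
or opens a new one. -/
theorem IsClasses.insert {x : β} {l : List β} {L : List (β × ℕ)} (h : IsClasses color l L) :
    ∃ L', ∃ c ≤ L.length, Det color (insertClass x L) L' c ∧ L'.length ≤ L.length + 1 ∧
      IsClasses color (x :: l) L' := by
  obtain ⟨L', c, hc, hd, hL⟩ := det_insertClass (color := color) x L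
  refine ⟨L', c, hc, hd, ?_⟩
  rcases hL with ⟨L₁, v, k, L₂, rfl, hv, rfl⟩ | ⟨hx, rfl⟩
  · have hnd := h.nodup
    have hk : k = num color (color v) l := h.count (v, k) (by simp)
    have hp : (L₁ ++ (v, k) :: L₂).Perm ((v, k) :: (L₁ ++ L₂)) := List.perm_middle
    have hne : ∀ q ∈ L₁ ++ L₂, color x ≠ color q.1 := by
      have := ((hp.map _).nodup_iff.1 hnd)
      rw [List.map_cons, List.nodup_cons] at this
      intro q hq hq'
      exact this.1 (List.mem_map.2 ⟨q, hq, by rw [← hq', hv]⟩)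
    refine ⟨by simp, ⟨?_, ?_, ?_, ?_⟩⟩
    · simpa using hnd
    · intro q hq
      rw [num_cons]
      rcases List.mem_cons.1 (List.perm_middle.mem_iff.1 hq) with rfl | hq
      · simp [hv, hk]
      · rw [if_neg (hne q hq)]
        exact h.count q (hp.mem_iff.2 (List.mem_cons_of_mem _ hq))
    · intro y hy
      rcases List.mem_cons.1 hy with rfl | hy
      · exact ⟨(v, k + 1), by simp, hv⟩
      · obtain ⟨q, hq, hqy⟩ := h.cover y hy
        rcases List.mem_cons.1 (hp.mem_iff.1 hq) with rfl | hq
        · exact ⟨(v, k + 1), by simp, hqy⟩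
        · exact ⟨q, List.perm_middle.mem_iff.2 (List.mem_cons_of_mem _ hq), hqy⟩
    -- A class growing from `k` to `k + 1` raises the sum of squares by `2 * k + 1`, which is the
    -- increment in `sumSq_cons`.
    · have := h.sq
      rw [sumSq_cons, ← this, ← hv, ← hk]
      simp only [List.map_append, List.map_cons, List.sum_append, List.sum_cons]
      ring
  · have h0 : num color (color x) l = 0 := by
      rw [num, List.countP_eq_zero]
      intro y hy hyx
      obtain ⟨q, hq, hqy⟩ := h.cover y hy
      exact hx q hq (hqy.trans (by simpa using hyx))
    refine ⟨by simp, ⟨?_, ?_, ?_, ?_⟩⟩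
    · rw [List.map_append, List.nodup_append]
      refine ⟨h.nodup, by simp, ?_⟩
      intro a ha b hb
      obtain ⟨q, hq, rfl⟩ := List.mem_map.1 ha
      simp only [List.map_cons, List.map_nil, List.mem_singleton] at hb
      rw [hb]
      exact hx q hq
    · intro q hq
      rw [num_cons]
      rcases List.mem_append.1 hq with hq | hq
      · rw [if_neg (Ne.symm (hx q hq))]
        exact h.count q hq
      · rw [List.mem_singleton] at hq
        subst hq
        simp [h0]
    · intro y hy
      rcases List.mem_cons.1 hy with rfl | hy
      · exact ⟨(y, 1), by simp, rfl⟩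
      · obtain ⟨q, hq, hqy⟩ := h.cover y hy
        exact ⟨q, by simp [hq], hqy⟩
    · rw [sumSq_cons, ← h.sq, h0]
      simp

theorem IsClasses.classify : ∀ {l₀ : List β} {L : List (β × ℕ)} (_ : IsClasses color l₀ L)
    (l : List β), ∃ L', ∃ c ≤ l.length * (L.length + l.length),
      Det color (classify l L) L' c ∧ IsClasses color (l ++ l₀) L'
  | l₀, L, h, [] => ⟨L, 0, by simp, Det.pure _, h⟩
  | l₀, L, h, x :: l => by
    obtain ⟨L₁, c₁, hc₁, hd₁, hl₁, h₁⟩ := h.insert (x := x)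
    obtain ⟨L₂, c₂, hc₂, hd₂, h₂⟩ := h₁.classify l
    refine ⟨L₂, c₂ + c₁, ?_, hd₁.bind hd₂, h₂.perm ?_⟩
    · simp only [List.length_cons]
      nlinarith
    · exact List.perm_middle

theorem det_classify (l : List β) : ∃ L, ∃ c ≤ l.length ^ 2,
    Det color (classify l []) L c ∧ IsClasses color l L := by
  have h : IsClasses color ([] : List β) [] := ⟨by simp, by simp, by simp, rfl⟩
  obtain ⟨L, c, hc, hd, hL⟩ := h.classify l
  refine ⟨L, c, by simpa [pow_two] using hc, hd, by simpa using hL⟩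

/-- What the sorted list of the color classes of a sample tells about the sample. -/
theorem IsClasses.of_mergeSort {l : List β} {L : List (β × ℕ)} (h : IsClasses color l L)
    {v : β} {k : ℕ} {rest : List (β × ℕ)}
    (hs : L.mergeSort (fun a b => decide (b.2 ≤ a.2)) = (v, k) :: rest) :
    k = num color (color v) l ∧ (∀ a, num color a l ≤ k) ∧
      k ^ 2 + (rest.map (fun q => q.2 ^ 2)).sum = sumSq color l := by
  have hp : L.Perm ((v, k) :: rest) := hs ▸ (List.mergeSort_perm L _).symm
  have h' := h.perm_right hp
  have hsort := List.pairwise_mergeSort (le := fun a b : β × ℕ => decide (b.2 ≤ a.2))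
    (by simp only [decide_eq_true_eq]; intros; omega)
    (by intro a b; simp only [Bool.or_eq_true, decide_eq_true_eq]; omega) L
  rw [hs, List.pairwise_cons] at hsort
  refine ⟨h'.count (v, k) (by simp), ?_, by simpa using h'.sq⟩
  intro a
  by_cases ha : num color a l = 0
  · omega
  · obtain ⟨x, hx, hxa⟩ := List.countP_pos_iff.1 (Nat.pos_of_ne_zero ha)
    obtain ⟨q, hq, hqx⟩ := h'.cover x hx
    have hxa' : color x = a := by simpa using hxa
    have hqc := h'.count q hq
    rw [hqx, hxa'] at hqc
    rw [← hqc]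
    rcases List.mem_cons.1 hq with rfl | hq
    · exact le_rfl
    · simpa using hsort.1 q hq

theorem IsClasses.mergeSort_ne_nil {l : List β} {L : List (β × ℕ)} (h : IsClasses color l L)
    (hl : l ≠ []) : L.mergeSort (fun a b => decide (b.2 ≤ a.2)) ≠ [] := by
  intro hs
  obtain ⟨x, hx⟩ := List.exists_mem_of_ne_nil l hl
  obtain ⟨q, hq, -⟩ := h.cover x hx
  have := (List.mergeSort_perm L (fun a b => decide (b.2 ≤ a.2))).mem_iff.2 hq
  simp [hs] at this

end Classes

/-! ### Correctness and cost of `balanced`, `light` and `heavy`, given the shuffle and the recursive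
call. -/

section Procedures

variable {β : Type} {κ : Type u} [DecidableEq κ] {color : β → κ}

theorem failProb_true {α : Type} (a : Alg β α) : failProb color a (fun _ _ => True) = 0 := by
  simp [failProb_eq_zero_iff]

theorem length_reduced_le {S X : List β} (h : 2 * X.length ≤ 2 * (S.length / 2)) :
    (reduced X (leftover S)).length ≤ (S.length + 1) / 2 := by
  have h2 := length_leftover S
  cases ho : leftover S with
  | none => simp only [reduced]; omega
  | some z =>
    rw [ho] at h2
    simp only [Option.toList_some, List.length_cons, List.length_nil] at h2
    simp only [reduced]
    split_ifs <;> simp <;> omega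

theorem length_reduced_le_add_one (X : List β) (o : Option β) :
    (reduced X o).length ≤ X.length + 1 := by
  cases o with
  | none => simp [reduced]
  | some z => simp only [reduced]; split_ifs <;> simp

variable (color) in
/-- The list `X` of the pairing step for a shuffled list `S`. -/
abbrev kept (S : List β) : List β := sames color (pairs S)

theorem num_eq_kept (a : κ) (l : List β) : num color a l =
    2 * num color a (kept color l) + hits color a (diffs color (pairs l)) +
      num color a (leftover l).toList := num_eq_pairs a l

theorem length_kept_add_diffs (l : List β) :
    (kept color l).length + (diffs color (pairs l)).length = l.length / 2 :=
  (length_sames_add_diffs _).trans (length_pairs l)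

/-- A majority in `reduced X` has a positive initial counter. -/
theorem majority_reduced {S : List β} {a : κ}
    (h : (reduced (kept color S) (leftover S)).length / 2 <
      num color a (reduced (kept color S) (leftover S))) :
    (kept color S).length + 1 ≤
      2 * num color a (kept color S) + num color a (leftover S).toList := by
  cases ho : leftover S with
  | none =>
    rw [ho] at h
    simp only [reduced] at h
    simp only [Option.toList_none, num_nil]
    omega
  | some z =>
    rw [ho] at h
    simp only [reduced] at h
    have h1 := num_le_length (color := color) a (some z).toList
    simp only [Option.toList_some, List.length_cons, List.length_nil] at h1 ⊢
    -- With an unpaired ball the reduced list has odd length in both cases, so a majority wins by at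
    -- least one ball. If `z` was appended, `2 (k + e) ≥ |X| + 2` and `e ≤ 1`; otherwise `2 k ≥ |X|
    -- + 1`.
    split_ifs at h with hX
    · rw [num_append, List.length_append, List.length_cons, List.length_nil] at h
      obtain ⟨r, hr⟩ := hX
      omega
    · rw [Nat.even_iff] at hX
      omega

/-- A majority of the list survives in `reduced X`. -/
theorem num_reduced_of_majority {S : List β} {a : κ}
    (h : (reduced (kept color S) (leftover S)).length / 2 ≥
      num color a (reduced (kept color S) (leftover S))) : num color a S ≤ S.length / 2 := by
  have h1 := num_eq_kept (color := color) a S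
  have h3 := length_kept_add_diffs (color := color) S
  have h4 : hits color a (diffs color (pairs S)) ≤ (diffs color (pairs S)).length :=
    List.countP_le_length
  have h5 := length_leftover S
  cases ho : leftover S with
  | none =>
    rw [ho] at h h1 h5
    simp only [reduced] at h
    simp only [Option.toList_none, num_nil] at h1
    omega
  | some z =>
    rw [ho] at h h1 h5
    simp only [reduced] at h
    have h6 := num_le_length (color := color) a (some z).toList
    simp only [Option.toList_some, List.length_cons, List.length_nil] at h h1 h5 h6
    -- The odd length again gains a unit: either `2 (k + e) ≤ |X|`, or `2 k ≤ |X| - 1` and `e ≤ 1`.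
    -- Hence `2 k + e ≤ |X|`, and each pair of different colors adds at most one ball.
    split_ifs at h with hX
    · rw [num_append, List.length_append, List.length_cons, List.length_nil] at h
      obtain ⟨r, hr⟩ := hX
      omega
    · rw [Nat.even_iff] at hX
      omega

/-- No other color than the majority of `reduced X` can be the majority of the list. -/
theorem num_le_of_ne {S : List β} {a b : κ} (hab : a ≠ b)
    (h : (reduced (kept color S) (leftover S)).length / 2 <
      num color a (reduced (kept color S) (leftover S))) : num color b S ≤ S.length / 2 := by
  apply num_reduced_of_majority
  have : ∀ l : List β, num color a l + num color b l ≤ l.length := by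
    intro l
    induction l with
    | nil => simp
    | cons x l ih =>
      rw [num_cons, num_cons, List.length_cons]
      split_ifs <;> first | omega | (exfalso; simp_all)
  have := this (reduced (kept color S) (leftover S))
  omega

variable (color) in
/-- What is known about the cost `T` of a call of `balanced` or `light` in which the list was
shuffled into `S`; the cost `T'` of the recursive call satisfies `R`. -/
def PairingCost (R : List β → ℕ → Prop) (L : List β → β → ℕ → Prop) (S : List β) (T : ℕ) : Prop :=
  ∃ T', R (reduced (kept color S) (leftover S)) T' ∧
    (T ≤ S.length / 2 + T' ∨ ∃ v c, (kept color S).length + 1 ≤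
        2 * num color (color v) (kept color S) + num color (color v) (leftover S).toList ∧
      L S v c ∧ T ≤ S.length / 2 + T' + 1 + c)

variable (color) in
/-- The cost of the comparisons with the candidate `v` in `balanced`. -/
def BalancedLoop (S : List β) (v : β) (c : ℕ) : Prop :=
  c ≤ probeCost color (color v) (diffs color (pairs S))

variable (color) in
/-- The cost of the comparisons with the candidate `v` in `light`. -/
def LightLoop (S : List β) (v : β) (c : ℕ) : Prop :=
  c ≤ probeCost color (color v) (diffs color (pairs S)) ∧
    ∀ t, 2 * num color (color v) (kept color S) + num color (color v) (leftover S).toList +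
        hits color (color v) (diffs color ((pairs S).take t)) ≤
      (diffs color ((pairs S).take t)).length + (kept color S).length →
      c ≤ probeCost color (color v) (diffs color ((pairs S).take t))

theorem CorrectOn.perm {M M' : List β} (h : M.Perm M') {r : Option (β × ℕ)}
    (hr : CorrectOn color M r) : CorrectOn color M' r := by
  cases r with
  | none => exact fun a => by rw [← num_perm h, ← h.length_eq]; exact hr a
  | some q =>
    obtain ⟨v, k⟩ := q
    obtain ⟨h1, h2⟩ := hr
    exact ⟨by rw [← num_perm h, h1], by rwa [← h.length_eq]⟩

variable {rec : List β → Alg β (Option (β × ℕ))} {M : List β} {P : List β → Prop}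
  {R : List β → ℕ → Prop} {δ₁ δ₂ : ℝ≥0∞}

/-- Apart from the shuffle and the recursive call everything is deterministic, so only these two can
fail. The hypothesis on `rec` covers every list of the right length, so the dependence of its input
on the shuffle is harmless. `P` and `R` stay free because the lemma serves twice: for the sure
linear bound and for the bound with high probability. -/
theorem failProb_balanced_le (hP : failProb color (shuffle M) (fun S _ => P S) ≤ δ₁)
    (hrec : ∀ X : List β, X.length ≤ (M.length + 1) / 2 →
      failProb color (rec X) (fun r T => CorrectOn color X r ∧ R X T) ≤ δ₂) :
    failProb color (balanced rec M) (fun r T => CorrectOn color M r ∧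
      ∃ S : List β, S.Perm M ∧ P S ∧ PairingCost color R (BalancedLoop color) S T) ≤
      δ₁ + δ₂ := by
  refine failProb_shuffle_bind hP fun S hS hPS => failProb_det_bind (det_splitPairs S) ?_
  have hlen := length_kept_add_diffs (color := color) S
  have hX := hrec (reduced (kept color S) (leftover S))
    (by rw [← hS.length_eq]; exact length_reduced_le (by omega))
  rw [← add_zero δ₂]
  refine failProb_bind_le hX ?_
  rintro (_ | ⟨v, k⟩) T' ⟨hc, hR⟩
  · refine failProb_pure ⟨?_, S, hS, hPS, T', hR, Or.inl (by omega)⟩ 0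
    exact CorrectOn.perm (r := none) hS fun a => num_reduced_of_majority (hc a)
  · obtain ⟨rfl, hk⟩ := hc
    obtain ⟨c, hc1, hd⟩ := det_resolve (color := color) v (kept color S) (leftover S)
    refine failProb_det_bind hd (failProb_det_bind (det_countInPairs v _) (failProb_pure ?_ 0))
    refine ⟨CorrectOn.perm hS ?_, S, hS, hPS, T', hR,
      Or.inr ⟨v, _, majority_reduced hk, le_refl _, by omega⟩⟩
    have h1 := num_eq_kept (color := color) (color v) S
    rw [show 2 * num color (color v) (kept color S) + num color (color v) (leftover S).toList +
      hits color (color v) (diffs color (pairs S)) = num color (color v) S by omega,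
      ← hS.length_eq]
    split_ifs with h2
    · intro a
      by_cases ha : color v = a
      · rw [← ha]; omega
      · exact num_le_of_ne ha hk
    · exact ⟨rfl, by omega⟩

theorem failProb_light_le (hP : failProb color (shuffle M) (fun S _ => P S) ≤ δ₁)
    (hrec : ∀ X : List β, X.length ≤ (M.length + 1) / 2 →
      failProb color (rec X) (fun r T => CorrectOn color X r ∧ R X T) ≤ δ₂) :
    failProb color (light rec M) (fun r T => CorrectOn color M r ∧
      ∃ S : List β, S.Perm M ∧ P S ∧ PairingCost color R (LightLoop color) S T) ≤
      δ₁ + δ₂ := by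
  refine failProb_shuffle_bind hP fun S hS hPS => failProb_det_bind (det_splitPairs S) ?_
  have hlen := length_kept_add_diffs (color := color) S
  have hX := hrec (reduced (kept color S) (leftover S))
    (by rw [← hS.length_eq]; exact length_reduced_le (by omega))
  rw [← add_zero δ₂]
  refine failProb_bind_le hX ?_
  rintro (_ | ⟨v, k⟩) T' ⟨hc, hR⟩
  · refine failProb_pure ⟨?_, S, hS, hPS, T', hR, Or.inl (by omega)⟩ 0
    exact CorrectOn.perm (r := none) hS fun a => num_reduced_of_majority (hc a)
  · obtain ⟨rfl, hk⟩ := hc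
    obtain ⟨c, hc1, hd⟩ := det_resolve (color := color) v (kept color S) (leftover S)
    have hm := majority_reduced hk
    obtain ⟨c', hd', hc', hloop⟩ := det_lightLoop (color := color) v (diffs color (pairs S))
      (2 * num color (color v) (kept color S) + num color (color v) (leftover S).toList -
        (kept color S).length)
    refine failProb_det_bind hd (failProb_det_bind hd' (failProb_pure ?_ 0))
    refine ⟨CorrectOn.perm hS ?_, S, hS, hPS, T', hR,
      Or.inr ⟨v, c', hm, ⟨hc', fun t ht => ?_⟩, by omega⟩⟩
    -- By `h1`, the initial counter minus the number of pairs missed by `v` is the multiplicity of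
    -- its color minus `⌊N / 2⌋`. The truncated final counter is therefore zero exactly when `v` is
    -- no majority.
    · have h1 := num_eq_kept (color := color) (color v) S
      have h4 : hits color (color v) (diffs color (pairs S)) ≤ (diffs color (pairs S)).length :=
        List.countP_le_length
      rw [← hS.length_eq]
      have hle := length_leftover S
      split_ifs with h2
      · intro a
        by_cases ha : color v = a
        · rw [← ha]; omega
        · exact num_le_of_ne ha hk
      · exact ⟨by omega, by omega⟩
    · refine hloop _ (diffs color ((pairs S).drop t)) ?_ (by omega)
      rw [diffs, diffs, diffs, ← List.filter_append, List.take_append_drop]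

theorem length_others (v : β) (M : List β) :
    (M.filter (fun x => decide (color x ≠ color v))).length + num color (color v) M =
      M.length := by
  rw [← List.countP_eq_length_filter, num, add_comm]
  simpa using (List.length_eq_countP_add_countP
    (fun x => decide (color x = color v)) (l := M)).symm

theorem num_others {a : κ} {v : β} (ha : a ≠ color v) (M : List β) :
    num color a (M.filter (fun x => decide (color x ≠ color v))) = num color a M := by
  rw [num, num, List.countP_filter]
  refine List.countP_congr fun x _ => ?_
  simp only [ne_eq, Bool.and_eq_true, decide_eq_true_eq]
  exact ⟨fun h => h.1, fun h => ⟨h, h ▸ ha⟩⟩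

variable (color) in
/-- What is known about the cost `T` of `heavy` on `M` if the other balls were shuffled into `S`. -/
def HeavyCost (M : List β) (v : β) (S : List β) (T : ℕ) : Prop :=
  T ≤ 4 * M.length ∧ ∀ t, (M.length + 1) / 2 ≤ num color (color v) M +
    (diffs color ((pairs S).take t)).length → T ≤ M.length + t

/-- Each pair of different colors contains a ball not of color `a`, so `⌈N / 2⌉ - cnt` such pairs
among the `N - cnt` other balls leave at most `⌊N / 2⌋` for any color `a` other than that of `v`.
The shuffle only takes place if `v` itself is no majority, so `hP` is asked for only then. -/
theorem failProb_heavy_le {v : β} (hP : num color (color v) M * 2 ≤ M.length →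
      failProb color (shuffle (M.filter (fun x => decide (color x ≠ color v))))
      (fun S _ => P S) ≤ δ₁) :
    failProb color (heavy M v) (fun r T => CorrectOn color M r ∧ (T ≤ M.length ∨
      ∃ S : List β, S.Perm (M.filter (fun x => decide (color x ≠ color v))) ∧
        num color (color v) M * 2 ≤ M.length ∧ P S ∧ HeavyCost color M v S T)) ≤ δ₁ := by
  refine failProb_det_bind (det_separate v M) ?_
  simp only
  split_ifs with h
  · exact failProb_pure ⟨⟨rfl, by omega⟩, Or.inl (by simp)⟩ _
  · replace hP := hP (by omega)
    rw [← add_zero δ₁]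
    refine failProb_shuffle_bind hP fun S hS hPS => ?_
    obtain ⟨c, hd, hc, ht⟩ := det_findDistinctPairs (color := color) S
      ((M.length + 1) / 2 - num color (color v) M)
    have hlo := length_others (color := color) v M
    have hlp := length_pairs S
    rw [hS.length_eq] at hlp
    refine failProb_det_bind hd ?_
    split_ifs with h2
    · rw [decide_eq_true_eq] at h2
      refine failProb_pure ⟨?_, Or.inr ⟨S, hS, by omega, hPS, by omega, fun t h3 => ?_⟩⟩ 0
      · intro a
        by_cases ha : a = color v
        · rw [ha]; omega
        · rw [← num_others ha, ← num_perm hS]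
          have h3 := num_eq_pairs (color := color) a S
          have h4 := length_sames_add_diffs (color := color) (pairs S)
          have h5 : hits color a (diffs color (pairs S)) ≤ (diffs color (pairs S)).length :=
            List.countP_le_length
          have h6 := length_leftover S
          have h7 := num_le_length (color := color) a (leftover S).toList
          have h8 := num_le_length (color := color) a (sames color (pairs S))
          have h9 := hS.length_eq
          omega
      · have := ht t (by omega)
        omega
    · obtain ⟨r, c', hc', hd', hr⟩ := det_boyerMoore (color := color) M
      refine failProb_det hd' ⟨hr, Or.inr ⟨S, hS, by omega, hPS, by omega, fun t h3 => ?_⟩⟩ 0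
      -- Boyer–Moore runs only after all pairs were exhausted in vain, and then no prefix contains
      -- enough pairs of different colors.
      exfalso
      rw [decide_eq_true_eq] at h2
      have h4 : (diffs color ((pairs S).take t)).length ≤ (diffs color (pairs S)).length :=
        ((List.take_sublist t _).filter _).length_le
      omega

end Procedures

/-! ### One level of the recursion, and the sure linear bound. -/

section Main

variable {β : Type} {κ : Type u} [DecidableEq κ] {color : β → κ}

/-- The sample size for a list of `n` balls. -/
noncomputable def sampleSize (n : ℕ) : ℕ := ⌈(n : ℝ) ^ (1 / 3 : ℝ)⌉₊

/-- The tolerance for a list of `n` balls. -/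
noncomputable def tol (n : ℕ) : ℝ := (n : ℝ) ^ (-(1 / 10) : ℝ)

theorem sampleSize_le {n : ℕ} (hn : 1 ≤ n) : sampleSize n ≤ n := by
  refine Nat.ceil_le.2 ?_
  have h : (1 : ℝ) ≤ n := by exact_mod_cast hn
  calc (n : ℝ) ^ (1 / 3 : ℝ) ≤ (n : ℝ) ^ (1 : ℝ) :=
        Real.rpow_le_rpow_of_exponent_le h (by norm_num)
    _ = n := Real.rpow_one _

theorem one_le_sampleSize {n : ℕ} (hn : 1 ≤ n) : 1 ≤ sampleSize n :=
  Nat.ceil_pos.2 (Real.rpow_pos_of_pos (by exact_mod_cast hn) _)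

theorem sampleSize_sq_le {n : ℕ} (hn : 1 ≤ n) :
    ((sampleSize n : ℝ)) ^ 2 ≤ 4 * (n : ℝ) ^ (2 / 3 : ℝ) := by
  have h : (1 : ℝ) ≤ n := by exact_mod_cast hn
  have h1 : (1 : ℝ) ≤ (n : ℝ) ^ (1 / 3 : ℝ) := Real.one_le_rpow h (by norm_num)
  have h2 : (sampleSize n : ℝ) ≤ 2 * (n : ℝ) ^ (1 / 3 : ℝ) := by
    have := (Nat.ceil_lt_add_one (zero_le_one.trans h1)).le
    unfold sampleSize
    linarith
  have h3 : (n : ℝ) ^ (2 / 3 : ℝ) = ((n : ℝ) ^ (1 / 3 : ℝ)) ^ 2 := by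
    rw [← Real.rpow_natCast, ← Real.rpow_mul (by positivity)]
    norm_num
  rw [h3]
  have h0 : (0 : ℝ) ≤ sampleSize n := Nat.cast_nonneg _
  nlinarith

theorem sampleSize_sq_le_four_mul {n : ℕ} (hn : 1 ≤ n) : sampleSize n ^ 2 ≤ 4 * n := by
  have h : (1 : ℝ) ≤ n := by exact_mod_cast hn
  have h1 := sampleSize_sq_le hn
  have h2 : (n : ℝ) ^ (2 / 3 : ℝ) ≤ n := by
    calc (n : ℝ) ^ (2 / 3 : ℝ) ≤ (n : ℝ) ^ (1 : ℝ) :=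
          Real.rpow_le_rpow_of_exponent_le h (by norm_num)
      _ = n := Real.rpow_one _
  have : ((sampleSize n ^ 2 : ℕ) : ℝ) ≤ (4 * n : ℕ) := by push_cast; linarith
  exact_mod_cast this

variable {M : List β} {P : List β → Prop} {Q : Option (β × ℕ) → ℕ → Prop} {δ₁ δ₂ : ℝ≥0∞}
  {fuel : ℕ}

/-- One level of the recursion: the branches are entered with the corresponding information about
the sample. -/
theorem failProb_majorityAux_succ_le (hM : 2 ≤ M.length)
    (hP : failProb color (shuffle M) (fun S _ => P S) ≤ δ₁)
    (h : ∀ S : List β, S.Perm M → P S → ∀ (v : β) (k k₂ : ℕ),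
      let m := sampleSize M.length
      let ε := tol M.length
      let W := S.take m
      k = num color (color v) W → (∀ a, num color a W ≤ k) → k ^ 2 + k₂ ^ 2 ≤ sumSq color W →
      ∀ c ≤ m ^ 2,
      ((k / m : ℝ) ∈ Set.Icc (1 / 2 - 4 * ε) (1 / 2 + 4 * ε) →
        (k₂ / m : ℝ) ∈ Set.Icc (1 / 2 - 4 * ε) (1 / 2 + 4 * ε) →
        failProb color (balanced (majorityAux fuel) M) (fun r T => Q r (T + c)) ≤ δ₂) ∧
      ((0.45 : ℝ) ≤ k / m → (sumSq color W / m ^ 2 : ℝ) + 2 * ε ≤ 2 * (k / m : ℝ) ^ 2 →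
        failProb color (heavy M v) (fun r T => Q r (T + c)) ≤ δ₂) ∧
      ((k / m : ℝ) < 0.45 ∨ 2 * (k / m : ℝ) ^ 2 < (sumSq color W / m ^ 2 : ℝ) + 2 * ε →
        failProb color (light (majorityAux fuel) M) (fun r T => Q r (T + c)) ≤ δ₂)) :
    failProb color (majorityAux (fuel + 1) M) Q ≤ δ₁ + δ₂ := by
  obtain ⟨x, y, l, rfl⟩ : ∃ x y l, M = x :: y :: l := by
    match M, hM with
    | x :: y :: l, _ => exact ⟨x, y, l, rfl⟩
  refine failProb_shuffle_bind hP fun S hS hPS => ?_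
  change failProb color (classify (S.take (sampleSize (x :: y :: l).length)) [] >>= _) Q ≤ δ₂
  obtain ⟨L, c, hc, hd, hL⟩ := det_classify (color := color) (S.take (sampleSize (x :: y :: l).length))
  have hm1 : sampleSize (x :: y :: l).length ≤ (x :: y :: l).length := sampleSize_le (by omega)
  have hm0 : 1 ≤ sampleSize (x :: y :: l).length := one_le_sampleSize (by omega)
  have hlen : (S.take (sampleSize (x :: y :: l).length)).length = sampleSize (x :: y :: l).length := by
    rw [List.length_take, hS.length_eq, min_eq_left hm1]
  rw [hlen] at hc
  refine failProb_det_bind hd ?_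
  have hne := hL.mergeSort_ne_nil (by rw [← List.length_pos_iff, hlen]; omega)
  obtain ⟨⟨v, k⟩, rest, hs⟩ := List.exists_cons_of_ne_nil hne
  obtain ⟨h1, h2, h3⟩ := hL.of_mergeSort hs
  -- The second largest class size defaults to 0 if the sample has one color only.
  have hk₂ : k ^ 2 + ((rest.map Prod.snd).headD 0) ^ 2 ≤
      sumSq color (S.take (sampleSize (x :: y :: l).length)) := by
    rw [← h3]
    cases rest <;> simp
  obtain ⟨hB, hH, hLi⟩ := h S hS hPS v k _ h1 h2 hk₂ c hc
  -- The sum over the other classes is the sum over all classes minus the first square. The test for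
  -- `heavy` thus says that the sum of all squared sample frequencies plus `2 ε` is at most `2 q₁ ^
  -- 2`.
  have hsum : (rest.map (fun r => ((r.2 : ℝ) / (S.take (sampleSize (x :: y :: l).length)).length) ^ 2)).sum =
      (sumSq color (S.take (sampleSize (x :: y :: l).length)) : ℝ) / (sampleSize (x :: y :: l).length : ℝ) ^ 2 -
        ((k : ℝ) / sampleSize (x :: y :: l).length) ^ 2 := by
    rw [hlen, ← h3]
    push_cast
    rw [div_pow, add_div, add_sub_cancel_left, div_eq_mul_inv, ← List.sum_map_mul_right]
    simp [div_eq_mul_inv, Function.comp_def, mul_pow]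
  clear h
  change failProb color (match L.mergeSort (fun a b => decide (b.2 ≤ a.2)) with
    | [] => _
    | (v₁, c₁) :: rest => _) _ ≤ _
  rw [hs]
  simp only [sampleSize, tol] at *
  rw [hsum, hlen]
  split_ifs with hb hh
  · exact hB hb.1 hb.2
  · exact hH hh.1 (by linarith [hh.2])
  · refine hLi ?_
    by_contra hcon
    push Not at hcon
    exact hh ⟨hcon.1, by linarith [hcon.2]⟩

variable (color) in
/-- The answer is always correct, with at most linearly many comparisons. -/
theorem failProb_majorityAux_eq_zero : ∀ (fuel : ℕ) (M : List β), M.length ≤ fuel →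
    failProb color (majorityAux fuel M)
      (fun r T => CorrectOn color M r ∧ T ≤ 40 * M.length) = 0
  | 0, M, h => by
    have : M = [] := List.length_eq_zero_iff.1 (by omega)
    subst this
    exact le_antisymm (failProb_pure ⟨fun a => by simp, by simp⟩ 0) zero_le
  | fuel + 1, [], h => le_antisymm (failProb_pure ⟨fun a => by simp, by simp⟩ 0) zero_le
  | fuel + 1, [x], h =>
    le_antisymm (failProb_pure ⟨⟨by simp [num_cons], by simp⟩, by simp⟩ 0) zero_le
  | fuel + 1, x :: y :: l, h => by
    set M := x :: y :: l with hM
    have hM2 : 2 ≤ M.length := by simp [hM]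
    have hrec : ∀ X : List β, X.length ≤ (M.length + 1) / 2 →
        failProb color (majorityAux fuel X)
          (fun r T => CorrectOn color X r ∧ T ≤ 40 * X.length) ≤ 0 := fun X hX =>
      (failProb_majorityAux_eq_zero fuel X (by omega)).le
    have hm := sampleSize_sq_le_four_mul (n := M.length) (by omega)
    have htrue : ∀ l : List β, failProb color (shuffle l) (fun _ _ => True) ≤ 0 :=
      fun l => (failProb_true _).le
    -- The recursive list has at most `(N + 1) / 2` balls, so the recursion uses about half of `40
    -- N`. Pairing and counting are linear, the sample costs at most `4 N`, and there is room to
    -- spare already for `N = 2`.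
    have key : ∀ (L : List β → β → ℕ → Prop),
        (∀ S v c, L S v c → c ≤ probeCost color (color v) (diffs color (pairs S))) →
        ∀ S : List β, S.Perm M → ∀ T,
          PairingCost color (fun X T => T ≤ 40 * X.length) L S T →
          ∀ c ≤ sampleSize M.length ^ 2, T + c ≤ 40 * M.length := by
      rintro L hL S hS T ⟨T', hT', hT⟩ c hc
      have h1 := length_kept_add_diffs (color := color) S
      have h3 := length_reduced_le (S := S) (X := kept color S) (by omega)
      have h2 := length_reduced_le_add_one (kept color S) (leftover S)
      have h4 := hS.length_eq
      rcases hT with hT | ⟨v, c', -, hc', hT⟩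
      · omega
      · have := hL S v c' hc'
        have h5 := probeCost_le (color := color) (color v) (diffs color (pairs S))
        omega
    refine le_antisymm ?_ zero_le
    rw [← add_zero (0 : ℝ≥0∞)]
    refine failProb_majorityAux_succ_le hM2 (P := fun _ => True) (htrue M) ?_
    intro S hS _ v k k₂ m ε W hk hmax hk₂ c hc
    replace hc : c ≤ sampleSize M.length ^ 2 := hc
    refine ⟨fun _ _ => ?_, fun _ _ => ?_, fun _ => ?_⟩
    · rw [← add_zero (0 : ℝ≥0∞)]
      refine le_trans (failProb_mono ?_) (failProb_balanced_le (htrue M) hrec)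
      rintro r T ⟨hr, S', hS', -, hT⟩
      exact ⟨hr, key _ (fun S v c h => h) S' hS' T hT c hc⟩
    · refine le_trans (failProb_mono ?_) (failProb_heavy_le fun _ => htrue _)
      rintro r T ⟨hr, hT | ⟨S', -, -, -, hT, -⟩⟩
      · exact ⟨hr, by omega⟩
      · exact ⟨hr, by omega⟩
    · rw [← add_zero (0 : ℝ≥0∞)]
      refine le_trans (failProb_mono ?_) (failProb_light_le (htrue M) hrec)
      rintro r T ⟨hr, S', hS', -, hT⟩
      exact ⟨hr, key _ (fun S v c h => h.1) S' hS' T hT c hc⟩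

end Main

/-! ### Concentration for functions of a uniformly random permutation. -/

section Concentration

/-- Hoeffding's bound for the exponential moment of a centred bounded finite family. -/
theorem sum_exp_le {ι : Type*} [Fintype ι] (g : ι → ℝ) (c : ℝ) (h0 : ∑ i, g i = 0)
    (hc : ∀ i, |g i| ≤ c) : ∑ i, Real.exp (g i) ≤ Fintype.card ι * Real.exp (c ^ 2 / 2) := by
  have h : ∀ i, Real.exp (g i) ≤ Real.cosh c + g i / c * Real.sinh c := by
    intro i
    have hc0 : 0 ≤ c := (abs_nonneg _).trans (hc i)
    rcases hc0.eq_or_lt with rfl | hpos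
    · have : g i = 0 := abs_nonpos_iff.1 (hc i)
      simp [this]
    · have := Real.exp_mul_le_cosh_add_mul_sinh (t := g i / c)
        (by rw [abs_div, abs_of_pos hpos]; exact (div_le_one hpos).2 (hc i)) c
      rwa [div_mul_cancel₀ _ hpos.ne'] at this
  calc ∑ i, Real.exp (g i) ≤ ∑ i, (Real.cosh c + g i / c * Real.sinh c) :=
        Finset.sum_le_sum fun i _ => h i
    _ = Fintype.card ι * Real.cosh c := by
        rw [Finset.sum_add_distrib, ← Finset.sum_mul, ← Finset.sum_div, h0]
        simp
    _ ≤ _ := mul_le_mul_of_nonneg_left (Real.cosh_le_exp_half_sq c) (Nat.cast_nonneg _)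

/-- The mean of a function of a uniformly random permutation. -/
noncomputable def permMean {n : ℕ} (f : Equiv.Perm (Fin n) → ℝ) : ℝ :=
  (∑ σ, f σ) / Fintype.card (Equiv.Perm (Fin n))

theorem card_perm_pos (n : ℕ) : (0 : ℝ) < Fintype.card (Equiv.Perm (Fin n)) := by
  exact_mod_cast Fintype.card_pos

/-- A conjugate of a transposition is a transposition. Hence, once the value `p` at 0 is fixed, the
remaining permutation inherits the Lipschitz condition with the same constant. -/
theorem decomposeFin_symm_swap_mul {n : ℕ} (p : Fin (n + 1)) (a b : Fin n)
    (e : Equiv.Perm (Fin n)) :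
    Equiv.Perm.decomposeFin.symm (p, Equiv.swap a b * e) =
      Equiv.swap (Equiv.swap 0 p a.succ) (Equiv.swap 0 p b.succ) *
        Equiv.Perm.decomposeFin.symm (p, e) := by
  have key : ∀ z, Equiv.swap (Equiv.swap 0 p a.succ) (Equiv.swap 0 p b.succ)
      (Equiv.swap 0 p z) = Equiv.swap 0 p (Equiv.swap a.succ b.succ z) := by
    intro z
    exact (DFunLike.congr_fun (Equiv.mul_swap_eq_swap_mul (Equiv.swap 0 p) a.succ b.succ) z).symm
  ext i
  refine congrArg _ ?_
  refine Fin.cases ?_ (fun x => ?_) i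
  · have := key 0
    rw [Equiv.swap_apply_left, Equiv.swap_apply_of_ne_of_ne (Fin.succ_ne_zero a).symm
      (Fin.succ_ne_zero b).symm, Equiv.swap_apply_left] at this
    rw [Equiv.Perm.mul_apply, Equiv.Perm.decomposeFin_symm_apply_zero,
      Equiv.Perm.decomposeFin_symm_apply_zero, this]
  · rw [Equiv.Perm.mul_apply, Equiv.Perm.decomposeFin_symm_apply_succ,
      Equiv.Perm.decomposeFin_symm_apply_succ, key, Equiv.Perm.mul_apply]
    congr 1
    have := (Fin.succ_injective n).swap_apply a b (e x)
    exact this.symm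

/-- This couples the permutations with value `p` at 0 to those with value 0 by a single
transposition, so the conditional means differ by at most `L`. -/
theorem decomposeFin_symm_eq_swap_mul {n : ℕ} (p : Fin (n + 1)) (e : Equiv.Perm (Fin n)) :
    Equiv.Perm.decomposeFin.symm (p, e) =
      Equiv.swap 0 p * Equiv.Perm.decomposeFin.symm (0, e) := by
  ext i
  refine congrArg _ ?_
  refine Fin.cases ?_ (fun x => ?_) i
  · simp
  · simp

/-- Exponential moments of a function of the first `m` values of a random permutation that changes
by at most `L` when two values are interchanged. -/
theorem sum_exp_perm_le (L : ℝ) : ∀ (m n : ℕ) (f : Equiv.Perm (Fin n) → ℝ),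
    (∀ σ a b, |f (Equiv.swap a b * σ) - f σ| ≤ L) →
    (∀ σ τ, (∀ i : Fin n, (i : ℕ) < m → σ i = τ i) → f σ = f τ) →
    ∑ σ, Real.exp (f σ - permMean f) ≤
      Fintype.card (Equiv.Perm (Fin n)) * Real.exp (2 * m * L ^ 2) := by
  have hconst : ∀ (n : ℕ) (f : Equiv.Perm (Fin n) → ℝ) (y : ℝ), 0 ≤ y →
      (∀ σ τ, f σ = f τ) → ∑ σ, Real.exp (f σ - permMean f) ≤
      Fintype.card (Equiv.Perm (Fin n)) * Real.exp y := by
    intro n f y hy hf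
    have hmean : permMean f = f 1 := by
      rw [permMean, Finset.sum_congr rfl fun σ _ => hf σ 1, Finset.sum_const, Finset.card_univ,
        nsmul_eq_mul, mul_div_cancel_left₀ _ (card_perm_pos n).ne']
    rw [Finset.sum_congr rfl fun σ _ => by rw [hmean, hf σ 1, sub_self, Real.exp_zero]]
    rw [Finset.sum_const, Finset.card_univ, nsmul_eq_mul]
    exact mul_le_mul_of_nonneg_left (Real.one_le_exp hy) (Nat.cast_nonneg _)
  intro m
  induction m with
  | zero =>
    intro n f _ hd
    exact hconst n f _ (by simp) fun σ τ => hd σ τ (by simp)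
  | succ m ih =>
    intro n f hL hd
    cases n with
    | zero => exact hconst 0 f _ (by positivity) fun σ τ => by rw [Subsingleton.elim σ τ]
    | succ n =>
      -- `F p` is `f` conditioned on `σ 0 = p`; it depends on only `m` further values, so induction
      -- applies to it.
      set F : Fin (n + 1) → Equiv.Perm (Fin n) → ℝ :=
        fun p e => f (Equiv.Perm.decomposeFin.symm (p, e)) with hF
      have hsum : ∀ g : Equiv.Perm (Fin (n + 1)) → ℝ,
          ∑ σ, g σ = ∑ p, ∑ e, g (Equiv.Perm.decomposeFin.symm (p, e)) := by
        intro g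
        rw [← Fintype.sum_prod_type' (f := fun p e => g (Equiv.Perm.decomposeFin.symm (p, e)))]
        exact (Equiv.sum_comp Equiv.Perm.decomposeFin.symm g).symm
      have hcard : (Fintype.card (Equiv.Perm (Fin (n + 1))) : ℝ) =
          (n + 1) * Fintype.card (Equiv.Perm (Fin n)) := by
        rw [Fintype.card_perm, Fintype.card_perm, Fintype.card_fin, Fintype.card_fin,
          Nat.factorial_succ]
        push_cast; ring
      have hn0 := card_perm_pos n
      have hmean : ∑ p, (permMean (F p) - permMean f) = 0 := by
        rw [Finset.sum_sub_distrib, Finset.sum_const, Finset.card_univ, Fintype.card_fin,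
          nsmul_eq_mul]
        have : permMean f = (∑ p, permMean (F p)) / (n + 1) := by
          simp only [permMean]
          rw [← Finset.sum_div, hsum f, hcard]
          field_simp
          rfl
        rw [this]
        push_cast
        field_simp
        ring
      have hdiff : ∀ p, |permMean (F p) - permMean (F 0)| ≤ L := by
        intro p
        rw [permMean, permMean, ← sub_div, ← Finset.sum_sub_distrib, abs_div, abs_of_pos hn0,
          div_le_iff₀ hn0]
        refine (Finset.abs_sum_le_sum_abs _ _).trans ?_
        refine (Finset.sum_le_sum (g := fun _ => L) fun e _ => ?_).trans ?_
        · simp only [hF]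
          rw [decomposeFin_symm_eq_swap_mul p e]
          exact hL _ _ _
        · rw [Finset.sum_const, Finset.card_univ, nsmul_eq_mul, mul_comm]
      have hdiff0 : |permMean (F 0) - permMean f| ≤ L := by
        have hn : (0 : ℝ) < n + 1 := by positivity
        have h1 : (n + 1 : ℝ) * (permMean (F 0) - permMean f) =
            ∑ p, (permMean (F 0) - permMean (F p)) := by
          rw [Finset.sum_sub_distrib, sub_eq_zero.1 ((Finset.sum_sub_distrib _ _).symm.trans hmean)]
          simp [mul_sub]
        have h2 : |∑ p, (permMean (F 0) - permMean (F p))| ≤ (n + 1) * L := by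
          refine (Finset.abs_sum_le_sum_abs _ _).trans ?_
          refine (Finset.sum_le_sum (g := fun _ => L) fun p _ => ?_).trans ?_
          · rw [abs_sub_comm]; exact hdiff p
          · simp
        rw [← h1, abs_mul, abs_of_pos hn] at h2
        exact le_of_mul_le_mul_left h2 hn
      have hstep : ∀ p, ∑ e, Real.exp (F p e - permMean (F p)) ≤
          Fintype.card (Equiv.Perm (Fin n)) * Real.exp (2 * m * L ^ 2) := by
        intro p
        refine ih n (F p) ?_ ?_
        · intro σ a b
          simp only [hF]
          rw [decomposeFin_symm_swap_mul]
          exact hL _ _ _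
        · intro σ τ h
          refine hd _ _ fun i hi => ?_
          revert hi
          refine Fin.cases ?_ (fun x => ?_) i
          · simp
          · intro hx
            rw [Equiv.Perm.decomposeFin_symm_apply_succ, Equiv.Perm.decomposeFin_symm_apply_succ,
              h x (by simpa using hx)]
      have hL0 : 0 ≤ L := (abs_nonneg _).trans hdiff0
      -- Going through `F 0` costs `L` twice. Hoeffding's bound with range `2 * L` then contributes
      -- `2 * L ^ 2` to the exponent for each revealed value.
      have houter := sum_exp_le (fun p => permMean (F p) - permMean f) (2 * L) hmean fun p => by
        have := abs_add_le (permMean (F p) - permMean (F 0)) (permMean (F 0) - permMean f)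
        rw [sub_add_sub_cancel] at this
        linarith [hdiff p]
      rw [Fintype.card_fin] at houter
      calc ∑ σ, Real.exp (f σ - permMean f)
          = ∑ p, Real.exp (permMean (F p) - permMean f) *
              ∑ e, Real.exp (F p e - permMean (F p)) := by
            rw [hsum]
            refine Finset.sum_congr rfl fun p _ => ?_
            rw [Finset.mul_sum]
            refine Finset.sum_congr rfl fun e _ => ?_
            rw [← Real.exp_add]
            congr 1
            ring
        _ ≤ ∑ p, Real.exp (permMean (F p) - permMean f) *
              (Fintype.card (Equiv.Perm (Fin n)) * Real.exp (2 * m * L ^ 2)) :=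
            Finset.sum_le_sum fun p _ =>
              mul_le_mul_of_nonneg_left (hstep p) (Real.exp_pos _).le
        _ ≤ ((n + 1 : ℕ) * Real.exp ((2 * L) ^ 2 / 2)) *
              (Fintype.card (Equiv.Perm (Fin n)) * Real.exp (2 * m * L ^ 2)) := by
            rw [← Finset.sum_mul]
            exact mul_le_mul_of_nonneg_right houter (by positivity)
        _ = _ := by
            rw [hcard]
            have : Real.exp (2 * ((m + 1 : ℕ) : ℝ) * L ^ 2) =
                Real.exp ((2 * L) ^ 2 / 2) * Real.exp (2 * m * L ^ 2) := by
              rw [← Real.exp_add]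
              congr 1
              push_cast
              ring
            rw [this]
            push_cast
            ring

/-- Markov's inequality for a uniformly random permutation. -/
theorem uniform_perm_le_of_sum_le {n : ℕ} {A : Set (Equiv.Perm (Fin n))}
    {g : Equiv.Perm (Fin n) → ℝ} {x : ℝ} (hg : ∀ σ, 0 ≤ g σ) (hA : ∀ σ ∈ A, 1 ≤ g σ)
    (h : ∑ σ, g σ ≤ Fintype.card (Equiv.Perm (Fin n)) * x) :
    (PMF.uniformOfFintype (Equiv.Perm (Fin n))).toOuterMeasure A ≤ ENNReal.ofReal x := by
  classical
  rw [PMF.toOuterMeasure_uniformOfFintype_apply]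
  have h0 := card_perm_pos n
  have h1 : (Fintype.card A : ℝ) ≤ ∑ σ, g σ := by
    rw [← Finset.sum_filter_add_sum_filter_not Finset.univ (fun σ => σ ∈ A)]
    have : (Fintype.card A : ℝ) ≤ ∑ σ with σ ∈ A, g σ := by
      rw [Fintype.card_subtype, Finset.cast_card]
      exact Finset.sum_le_sum fun σ hσ => hA σ (Finset.mem_filter.1 hσ).2
    exact this.trans (le_add_of_nonneg_right (Finset.sum_nonneg fun σ _ => hg σ))
  have h2 : (Fintype.card A : ℝ) / Fintype.card (Equiv.Perm (Fin n)) ≤ x := by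
    rw [div_le_iff₀ h0]; linarith
  refine le_trans (le_of_eq ?_) (ENNReal.ofReal_le_ofReal h2)
  rw [ENNReal.ofReal_div_of_pos h0, ENNReal.ofReal_natCast, ENNReal.ofReal_natCast]

/-- Concentration of a function of the first `m` values of a random permutation. -/
theorem perm_concentration_upper {n m : ℕ} (hm : 0 < m) {L : ℝ} (hL0 : 0 < L)
    {f : Equiv.Perm (Fin n) → ℝ} (hL : ∀ σ a b, |f (Equiv.swap a b * σ) - f σ| ≤ L)
    (hd : ∀ σ τ, (∀ i : Fin n, (i : ℕ) < m → σ i = τ i) → f σ = f τ) {l : ℝ} (hl : 0 ≤ l) :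
    (PMF.uniformOfFintype (Equiv.Perm (Fin n))).toOuterMeasure {σ | l ≤ f σ - permMean f} ≤
      ENNReal.ofReal (Real.exp (-(l ^ 2 / (8 * m * L ^ 2)))) := by
  have hm' : (0 : ℝ) < m := by exact_mod_cast hm
  -- This `θ` minimizes the Chernoff exponent `2 * m * (θ * L) ^ 2 - θ * l`.
  set θ : ℝ := l / (4 * m * L ^ 2) with hθ
  have hθ0 : 0 ≤ θ := by positivity
  have hmean : permMean (fun σ => θ * f σ) = θ * permMean f := by
    rw [permMean, permMean, ← Finset.mul_sum, mul_div_assoc]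
  have h := sum_exp_perm_le (θ * L) m n (fun σ => θ * f σ)
    (fun σ a b => by
      rw [← mul_sub, abs_mul, abs_of_nonneg hθ0]
      exact mul_le_mul_of_nonneg_left (hL σ a b) hθ0)
    (fun σ τ h => by simp only [hd σ τ h])
  refine uniform_perm_le_of_sum_le
    (g := fun σ => Real.exp (θ * f σ - permMean (fun σ => θ * f σ)) * Real.exp (-(θ * l)))
    (fun σ => by positivity) ?_ ?_
  · intro σ hσ
    rw [← Real.exp_add]
    refine Real.one_le_exp ?_
    rw [hmean]
    have := mul_le_mul_of_nonneg_left hσ hθ0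
    linarith
  · rw [← Finset.sum_mul]
    refine (mul_le_mul_of_nonneg_right h (Real.exp_pos _).le).trans (le_of_eq ?_)
    rw [mul_assoc, ← Real.exp_add]
    congr 2
    rw [hθ]
    field_simp
    ring

theorem perm_concentration {n m : ℕ} (hm : 0 < m) {L : ℝ} (hL0 : 0 < L)
    {f : Equiv.Perm (Fin n) → ℝ} (hL : ∀ σ a b, |f (Equiv.swap a b * σ) - f σ| ≤ L)
    (hd : ∀ σ τ, (∀ i : Fin n, (i : ℕ) < m → σ i = τ i) → f σ = f τ) {l : ℝ} (hl : 0 ≤ l) :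
    (PMF.uniformOfFintype (Equiv.Perm (Fin n))).toOuterMeasure {σ | l ≤ |f σ - permMean f|} ≤
      ENNReal.ofReal (2 * Real.exp (-(l ^ 2 / (8 * m * L ^ 2)))) := by
  have h1 := perm_concentration_upper hm hL0 hL hd hl
  have h2 := perm_concentration_upper (f := fun σ => -f σ) hm hL0
    (fun σ a b => by rw [← abs_neg]; convert hL σ a b using 2; ring)
    (fun σ τ h => by rw [hd σ τ h]) hl
  have hmean : permMean (fun σ => -f σ) = -permMean f := by
    rw [permMean, permMean, Finset.sum_neg_distrib, neg_div]
  rw [two_mul, ENNReal.ofReal_add (Real.exp_pos _).le (Real.exp_pos _).le]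
  refine le_trans (MeasureTheory.measure_mono ?_)
    ((MeasureTheory.measure_union_le _ _).trans (add_le_add h1 h2))
  intro σ hσ
  rcases le_abs.1 (show l ≤ |f σ - permMean f| from hσ) with h | h
  · exact Or.inl h
  · refine Or.inr ?_
    simp only [Set.mem_ofPred_eq, hmean]
    linarith

end Concentration

/-! ### Means of local statistics of a random permutation. -/

section PermMeans

theorem permMean_finsetSum {n : ℕ} {ι : Type*} (s : Finset ι) (H : ι → Equiv.Perm (Fin n) → ℝ) :
    permMean (fun σ => ∑ j ∈ s, H j σ) = ∑ j ∈ s, permMean (H j) := by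
  simp only [permMean]
  rw [Finset.sum_comm, Finset.sum_div]

theorem permMean_const {n : ℕ} (c : ℝ) : permMean (fun _ : Equiv.Perm (Fin n) => c) = c := by
  rw [permMean, Finset.sum_const, Finset.card_univ, nsmul_eq_mul,
    mul_div_cancel_left₀ _ (card_perm_pos n).ne']

theorem permMean_comp_mul {n : ℕ} (f : Equiv.Perm (Fin n) → ℝ) (τ : Equiv.Perm (Fin n)) :
    permMean (fun σ => f (σ * τ)) = permMean f := by
  rw [permMean, permMean]
  congr 1
  exact Equiv.sum_comp (Equiv.mulRight τ) f

/-- By symmetry the mean is the same at every position, and the sum over all positions does not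
depend on the permutation. -/
theorem permMean_apply {n : ℕ} (h : Fin n → ℝ) (i : Fin n) :
    permMean (fun σ => h (σ i)) = (∑ x, h x) / n := by
  have hn : (0 : ℝ) < n := by exact_mod_cast i.pos
  have h1 : ∀ j, permMean (fun σ => h (σ j)) = permMean (fun σ => h (σ i)) := fun j => by
    rw [← permMean_comp_mul (fun σ => h (σ j)) (Equiv.swap i j)]
    simp
  have h2 : ∑ j, permMean (fun σ => h (σ j)) = ∑ x, h x := by
    rw [← permMean_finsetSum]
    simp only [fun σ : Equiv.Perm (Fin n) => Equiv.sum_comp σ h]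
    exact permMean_const _
  rw [Finset.sum_congr rfl fun j _ => h1 j, Finset.sum_const, Finset.card_univ, Fintype.card_fin,
    nsmul_eq_mul] at h2
  rw [eq_div_iff hn.ne', mul_comm, h2]

theorem permMean_apply₂ {n : ℕ} (h : Fin n → Fin n → ℝ) {i j : Fin n} (hij : i ≠ j) :
    permMean (fun σ => h (σ i) (σ j)) =
      (∑ x, ∑ y, h x y - ∑ x, h x x) / (n * (n - 1)) := by
  have hn : (1 : ℝ) < n := by
    have : 1 < n := by have := i.isLt; have := j.isLt; have := Fin.val_ne_of_ne hij; omega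
    exact_mod_cast this
  have h1 : ∀ i' j', i' ≠ j' →
      permMean (fun σ => h (σ i') (σ j')) = permMean (fun σ => h (σ i) (σ j)) := by
    intro i' j' hij'
    -- The product of the two transpositions carries `i` to `i'` and `j` to `j'`.
    rw [← permMean_comp_mul (fun σ => h (σ i) (σ j))
      (Equiv.swap (Equiv.swap i i' j) j' * Equiv.swap i i')]
    have e1 : Equiv.swap (Equiv.swap i i' j) j' i' = i' := by
      refine Equiv.swap_apply_of_ne_of_ne (fun hc => hij ?_) hij'
      rw [eq_comm, Equiv.swap_apply_eq_iff, Equiv.swap_apply_right] at hc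
      exact hc.symm
    simp only [Equiv.Perm.mul_apply, Equiv.swap_apply_left, e1]
  have h2 : ∑ i', ∑ j', permMean (fun σ => h (σ i') (σ j')) -
      ∑ i', permMean (fun σ => h (σ i') (σ i')) = ∑ x, ∑ y, h x y - ∑ x, h x x := by
    congr 1
    · have : ∀ σ : Equiv.Perm (Fin n), ∑ i', ∑ j', h (σ i') (σ j') = ∑ x, ∑ y, h x y := by
        intro σ
        rw [← Equiv.sum_comp σ (fun x => ∑ y, h x y)]
        exact Finset.sum_congr rfl fun x _ => Equiv.sum_comp σ (h (σ x))
      simp only [← permMean_finsetSum, this, permMean_const]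
    · have : ∀ σ : Equiv.Perm (Fin n), ∑ i', h (σ i') (σ i') = ∑ x, h x x := fun σ =>
        Equiv.sum_comp σ (fun x => h x x)
      simp only [← permMean_finsetSum, this, permMean_const]
  have h3 : ∑ i', ∑ j', permMean (fun σ => h (σ i') (σ j')) -
      ∑ i', permMean (fun σ => h (σ i') (σ i')) =
      n * (n - 1) * permMean (fun σ => h (σ i) (σ j)) := by
    rw [← Finset.sum_sub_distrib]
    have : ∀ i', ∑ j', permMean (fun σ => h (σ i') (σ j')) - permMean (fun σ => h (σ i') (σ i')) =
        (n - 1) * permMean (fun σ => h (σ i) (σ j)) := by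
      intro i'
      rw [← Finset.add_sum_erase _ _ (Finset.mem_univ i'), add_sub_cancel_left,
        Finset.sum_congr rfl fun j' hj' => h1 i' j' (Finset.ne_of_mem_erase hj').symm,
        Finset.sum_const, Finset.card_erase_of_mem (Finset.mem_univ _), Finset.card_univ,
        Fintype.card_fin, nsmul_eq_mul, Nat.cast_sub i'.pos, Nat.cast_one]
    rw [Finset.sum_congr rfl fun i' _ => this i', Finset.sum_const, Finset.card_univ,
      Fintype.card_fin, nsmul_eq_mul, mul_assoc]
  rw [← h2, h3, mul_div_cancel_left₀]
  exact (mul_pos (by linarith) (by linarith)).ne'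

/-- A sum of local terms changes by at most two when two values are interchanged. -/
theorem abs_sum_swap_sub_le {n t : ℕ} (H : Fin t → Equiv.Perm (Fin n) → ℝ) (blk : Fin n → ℕ)
    (h0 : ∀ j σ, 0 ≤ H j σ) (h1 : ∀ j σ, H j σ ≤ 1)
    (hloc : ∀ (j : Fin t) σ τ, (∀ i, blk i = j → σ i = τ i) → H j σ = H j τ)
    (σ : Equiv.Perm (Fin n)) (a b : Fin n) :
    |∑ j, H j (Equiv.swap a b * σ) - ∑ j, H j σ| ≤ 2 := by
  rw [← Finset.sum_sub_distrib]
  refine (Finset.abs_sum_le_sum_abs _ _).trans ?_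
  set s : Finset ℕ := {blk (σ⁻¹ a), blk (σ⁻¹ b)} with hs
  have hterm : ∀ j : Fin t, |H j (Equiv.swap a b * σ) - H j σ| ≤ if (j : ℕ) ∈ s then 1 else 0 := by
    intro j
    split_ifs with hj
    · rw [abs_le]
      constructor <;> linarith [h0 j σ, h1 j σ, h0 j (Equiv.swap a b * σ),
        h1 j (Equiv.swap a b * σ)]
    · rw [hloc j (Equiv.swap a b * σ) σ, sub_self, abs_zero]
      intro i hi
      rw [Equiv.Perm.mul_apply]
      refine Equiv.swap_apply_of_ne_of_ne (fun hc => hj ?_) (fun hc => hj ?_)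
      · rw [hs, ← hi, ← hc]; simp
      · rw [hs, ← hi, ← hc]; simp
  refine (Finset.sum_le_sum fun j _ => hterm j).trans ?_
  rw [Finset.sum_ite, Finset.sum_const_zero, add_zero, Finset.sum_const, nsmul_eq_mul, mul_one]
  have : (Finset.univ.filter (fun j : Fin t => (j : ℕ) ∈ s)).card ≤ s.card :=
    Finset.card_le_card_of_injOn (fun j => (j : ℕ)) (fun j hj => (Finset.mem_filter.1 hj).2)
      (fun x _ y _ hxy => Fin.ext hxy)
  exact_mod_cast this.trans Finset.card_le_two

end PermMeans

/-! ### Concentration for samples and for consecutive pairs of a shuffled list. -/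

section Shuffles

variable {β : Type} {κ : Type u} [DecidableEq κ] {color : β → κ}

theorem countP_ofFn {α : Type*} {t : ℕ} (g : Fin t → α) (p : α → Bool) :
    ((List.ofFn g).countP p : ℝ) = ∑ j, if p (g j) then 1 else 0 := by
  have : ∀ l : List α, (l.countP p : ℝ) = (l.map (fun x => if p x then (1 : ℝ) else 0)).sum := by
    intro l
    induction l with
    | nil => simp
    | cons x l ih => rw [List.countP_cons, List.map_cons, List.sum_cons, ← ih]; push_cast; ring
  rw [this, List.map_ofFn, List.sum_ofFn]
  rfl

theorem getElem_pairs : ∀ (l : List β) (j : ℕ) (h : 2 * j + 1 < l.length)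
    (h' : j < (pairs l).length), (pairs l)[j] = (l[2 * j], l[2 * j + 1])
  | x :: y :: l, 0, _, _ => rfl
  | x :: y :: l, j + 1, h, h' =>
    getElem_pairs l j (by simp only [List.length_cons] at h; omega) (by simpa [pairs] using h')

theorem take_pairs_eq_ofFn (l : List β) {t : ℕ} (ht : 2 * t ≤ l.length) :
    (pairs l).take t = List.ofFn (fun j : Fin t =>
      (l[2 * (j : ℕ)]'(by omega), l[2 * (j : ℕ) + 1]'(by omega))) := by
  have hlen := length_pairs l
  refine List.ext_getElem (by simp; omega) fun j h1 h2 => ?_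
  rw [List.length_ofFn] at h2
  rw [List.getElem_take, getElem_pairs l j (by omega), List.getElem_ofFn]

/-- The number of ordered pairs of elements of `M` (with repetition) that satisfy `p`. -/
def pairNum (p : β × β → Bool) (M : List β) : ℕ :=
  (M.map (fun x => M.countP (fun y => p (x, y)))).sum

theorem sum_get_ite (p : β → Bool) (M : List β) :
    ∑ i : Fin M.length, (if p (M.get i) then (1 : ℝ) else 0) = M.countP p := by
  rw [← countP_ofFn, List.ofFn_get]

theorem sum_sum_get_ite (p : β × β → Bool) (M : List β) :
    ∑ i : Fin M.length, ∑ j : Fin M.length, (if p (M.get i, M.get j) then (1 : ℝ) else 0) =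
      pairNum p M := by
  rw [Finset.sum_congr rfl fun i _ => sum_get_ite (fun y => p (M.get i, y)) M]
  rw [← List.sum_ofFn (f := fun i : Fin M.length => (M.countP (fun y => p (M.get i, y)) : ℝ))]
  have : List.ofFn (fun i : Fin M.length => (M.countP (fun y => p (M.get i, y)) : ℝ)) =
      (M.map (fun x => M.countP (fun y => p (x, y)))).map (Nat.cast : ℕ → ℝ) := by
    conv_rhs => rw [← List.ofFn_get M]
    rw [List.map_map, List.map_ofFn]
    simp [Function.comp_def]
  rw [this, pairNum, Nat.cast_list_sum]

/-- The count depends on the first `m` values only, so the exponent contains the sample size rather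
than the length of `M`; this is what makes so small a sample useful. -/
theorem failProb_sample_le {M : List β} {m : ℕ} (hm : 0 < m) (hmM : m ≤ M.length) (a : κ)
    {l : ℝ} (hl : 0 ≤ l) :
    failProb color (shuffle M) (fun S _ =>
      |(num color a (S.take m) : ℝ) - m * num color a M / M.length| < l) ≤
      ENNReal.ofReal (2 * Real.exp (-(l ^ 2 / (32 * m)))) := by
  set H : Fin m → Equiv.Perm (Fin M.length) → ℝ := fun j σ =>
    if color (M.get (σ ⟨j, j.isLt.trans_le hmM⟩)) = a then 1 else 0 with hH
  have hnum : ∀ σ : Equiv.Perm (Fin M.length),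
      (num color a ((List.ofFn (fun i => M.get (σ i))).take m) : ℝ) = ∑ j, H j σ := by
    intro σ
    have : (List.ofFn (fun i => M.get (σ i))).take m =
        List.ofFn (fun j : Fin m => M.get (σ ⟨j, j.isLt.trans_le hmM⟩)) := by
      refine List.ext_getElem (by simpa using hmM) fun j h1 h2 => ?_
      simp
    rw [num, this, countP_ofFn]
    simp [hH]
  have hmean : permMean (fun σ => ∑ j, H j σ) = m * num color a M / M.length := by
    rw [permMean_finsetSum]
    have : ∀ j, permMean (H j) = num color a M / M.length := by
      intro j
      have := permMean_apply (fun i => if color (M.get i) = a then (1 : ℝ) else 0)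
        ⟨j, j.isLt.trans_le hmM⟩
      refine this.trans ?_
      rw [num, ← sum_get_ite]
      simp
    rw [Finset.sum_congr rfl fun j _ => this j, Finset.sum_const, Finset.card_univ,
      Fintype.card_fin, nsmul_eq_mul, mul_div_assoc]
  have h := perm_concentration hm two_pos (f := fun σ => ∑ j, H j σ) (l := l)
    (abs_sum_swap_sub_le H (fun i => i) (fun j σ => by simp only [hH]; split_ifs <;> norm_num)
      (fun j σ => by simp only [hH]; split_ifs <;> norm_num)
      (fun j σ τ h => by simp only [hH, h ⟨j, j.isLt.trans_le hmM⟩ rfl]))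
    (fun σ τ h => Finset.sum_congr rfl fun j _ => by
      simp only [hH, h ⟨j, j.isLt.trans_le hmM⟩ j.isLt]) hl
  rw [failProb_shuffle]
  simp only [hnum, ← hmean, not_lt]
  refine h.trans (le_of_eq ?_)
  congr 4
  ring

/-- A transposition affects at most two pairs, hence the Lipschitz constant 2. The exact mean
excludes the diagonal and divides by `N (N - 1)`; for `t ≤ N / 2` it differs from the value for
independent draws by at most 1, which is the 1 in `l + 1`. -/
theorem failProb_pairs_le {M : List β} (hM : 2 ≤ M.length) (p : β × β → Bool) {t : ℕ}
    (ht : 2 * t ≤ M.length) {l : ℝ} (hl : 0 ≤ l) :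
    failProb color (shuffle M) (fun S _ =>
      |(((pairs S).take t).countP p : ℝ) - t * pairNum p M / M.length ^ 2| < l + 1) ≤
      ENNReal.ofReal (2 * Real.exp (-(l ^ 2 / (32 * M.length)))) := by
  have i0 : ∀ j : Fin t, 2 * (j : ℕ) < M.length := fun j => by omega
  have i1 : ∀ j : Fin t, 2 * (j : ℕ) + 1 < M.length := fun j => by omega
  set H : Fin t → Equiv.Perm (Fin M.length) → ℝ := fun j σ =>
    if p (M.get (σ ⟨2 * j, i0 j⟩), M.get (σ ⟨2 * j + 1, i1 j⟩)) then 1 else 0 with hH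
  have hnum : ∀ σ : Equiv.Perm (Fin M.length),
      (((pairs (List.ofFn (fun i => M.get (σ i)))).take t).countP p : ℝ) = ∑ j, H j σ := by
    intro σ
    rw [take_pairs_eq_ofFn _ (by simpa using ht), countP_ofFn]
    simp [hH]
  set N : ℝ := (M.length : ℝ) with hN
  have hN2 : (2 : ℝ) ≤ N := by rw [hN]; exact_mod_cast hM
  set D : ℝ := (pairNum p M : ℝ) with hD
  set E : ℝ := (M.countP (fun x => p (x, x)) : ℝ) with hE
  have hmean : permMean (fun σ => ∑ j, H j σ) = t * ((D - E) / (N * (N - 1))) := by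
    rw [permMean_finsetSum]
    have : ∀ j, permMean (H j) = (D - E) / (N * (N - 1)) := by
      intro j
      have := permMean_apply₂ (fun i j => if p (M.get i, M.get j) then (1 : ℝ) else 0)
        (i := ⟨2 * j, i0 j⟩) (j := ⟨2 * j + 1, i1 j⟩) (by simp)
      refine this.trans ?_
      rw [sum_sum_get_ite, sum_get_ite (fun x => p (x, x))]
    rw [Finset.sum_congr rfl fun j _ => this j, Finset.sum_const, Finset.card_univ,
      Fintype.card_fin, nsmul_eq_mul]
  have hE0 : 0 ≤ E := Nat.cast_nonneg _
  have hEN : E ≤ N := by rw [hE, hN]; exact_mod_cast List.countP_le_length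
  have hD0 : 0 ≤ D := Nat.cast_nonneg _
  have hDN : D ≤ N ^ 2 := by
    have : pairNum p M ≤ M.length * M.length := by
      refine (List.sum_le_card_nsmul _ M.length ?_).trans (by simp)
      intro y hy
      obtain ⟨x, -, rfl⟩ := List.mem_map.1 hy
      exact List.countP_le_length
    rw [hD, hN, pow_two]
    exact_mod_cast this
  have htN : 2 * (t : ℝ) ≤ N := by rw [hN]; exact_mod_cast ht
  have ht0 : (0 : ℝ) ≤ t := Nat.cast_nonneg _
  have hclose : |t * ((D - E) / (N * (N - 1))) - t * D / N ^ 2| ≤ 1 := by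
    have hN1 : 0 < N - 1 := by linarith
    have : t * ((D - E) / (N * (N - 1))) - t * D / N ^ 2 =
        t * (D - N * E) / (N ^ 2 * (N - 1)) := by
      field_simp
      ring
    rw [this, abs_div, abs_of_pos (by positivity : 0 < N ^ 2 * (N - 1)), div_le_one (by positivity),
      abs_mul, abs_of_nonneg ht0]
    have h1 : |D - N * E| ≤ N ^ 2 := by
      rw [abs_le]
      constructor <;> nlinarith
    have h2 : (t : ℝ) ≤ N - 1 := by linarith
    calc (t : ℝ) * |D - N * E| ≤ (N - 1) * N ^ 2 := mul_le_mul h2 h1 (abs_nonneg _) hN1.le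
      _ = _ := by ring
  have h := perm_concentration (by omega : 0 < M.length) two_pos (f := fun σ => ∑ j, H j σ) (l := l)
    (abs_sum_swap_sub_le H (fun i => i / 2)
      (fun j σ => by simp only [hH]; split_ifs <;> norm_num)
      (fun j σ => by simp only [hH]; split_ifs <;> norm_num)
      (fun j σ τ h => by
        simp only [hH]
        rw [h ⟨2 * j, i0 j⟩ (by simp), h ⟨2 * j + 1, i1 j⟩ (by simp; omega)]))
    (fun σ τ h => by rw [Equiv.ext fun i => h i i.isLt]) hl
  rw [failProb_shuffle]
  refine le_trans (MeasureTheory.measure_mono ?_) (h.trans (le_of_eq ?_))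
  · intro σ hσ
    simp only [hnum, not_lt, Set.mem_ofPred_eq] at hσ ⊢
    have := abs_add_le (∑ j, H j σ - permMean (fun σ => ∑ j, H j σ))
      (permMean (fun σ => ∑ j, H j σ) - t * D / N ^ 2)
    rw [sub_add_sub_cancel] at this
    rw [← hmean] at hclose
    linarith
  · congr 4
    ring

/-- A union bound. -/
theorem failProb_forall_le {α ι : Type} (a : Alg β α) (s : Finset ι) (Q : ι → α → Prop) (x : ℝ)
    (h : ∀ i ∈ s, failProb color a (fun y _ => Q i y) ≤ ENNReal.ofReal x) :
    failProb color a (fun y _ => ∀ i ∈ s, Q i y) ≤ s.card * ENNReal.ofReal x := by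
  classical
  induction s using Finset.induction_on with
  | empty => simp [failProb_true]
  | insert i s hi ih =>
    rw [Finset.card_insert_of_notMem hi]
    push_cast
    rw [add_mul, one_mul, add_comm]
    refine le_trans (le_trans (failProb_mono ?_)
      (failProb_and_le a (fun y _ => Q i y) (fun y _ => ∀ i ∈ s, Q i y)))
      (add_le_add (h i (Finset.mem_insert_self _ _))
        (ih fun j hj => h j (Finset.mem_insert_of_mem hj)))
    rintro y c ⟨h1, h2⟩ j hj
    rcases Finset.mem_insert.1 hj with rfl | hj
    · exact h1
    · exact h2 j hj

end Shuffles

/-! ### The inequalities behind the constant `7/6`. -/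

section RealInequalities

/-- With `s = 2 p ^ 2 - u` this is `7/6 s r + u w ≤ 4/3 r`, the budget of `light` multiplied by `r =
1 - 2 p + u`. The difference of the sides is convex in `u` (leading coefficient `5/6`), so the chord
between `u = 0` and `u = p ^ 2` bounds it. At `u = p ^ 2` the inequality fails for `p` near `1/2`,
hence the restriction on `p`. -/
theorem light_poly {p u : ℝ} (hp0 : 0 ≤ p) (hp : p ≤ 0.46) (hu0 : 0 ≤ u) (hu : u ≤ p ^ 2) :
    7 / 6 * (2 * p ^ 2 - u) * (1 - 2 * p + u) + u * (2 - p - 3 * p ^ 2 + 2 * u) ≤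
      4 / 3 * (1 - 2 * p + u) := by
  have ha : (7 / 3 * p ^ 2 - 4 / 3) * (1 - 2 * p) ≤ 0 :=
    mul_nonpos_of_nonpos_of_nonneg (by nlinarith) (by linarith)
  have hend : 7 / 6 * p ^ 2 * (1 - p) ^ 2 + p ^ 2 * (2 - p - p ^ 2) ≤ 4 / 3 * (1 - p) ^ 2 := by
    have h1 : 7 / 6 * p ^ 2 * (1 - p) + p ^ 2 * (2 + p) ≤ 4 / 3 * (1 - p) := by nlinarith
    nlinarith
  set b : ℝ := 7 / 6 * (2 * p ^ 2 - (1 - 2 * p)) + (2 - p - 3 * p ^ 2) - 4 / 3 + 5 / 6 * p ^ 2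
    with hb
  have hsplit : 7 / 6 * (2 * p ^ 2 - u) * (1 - 2 * p + u) + u * (2 - p - 3 * p ^ 2 + 2 * u) -
      4 / 3 * (1 - 2 * p + u) =
      (7 / 3 * p ^ 2 - 4 / 3) * (1 - 2 * p) + b * u - 5 / 6 * u * (p ^ 2 - u) := by
    rw [hb]; ring
  have hend' : (7 / 3 * p ^ 2 - 4 / 3) * (1 - 2 * p) + b * p ^ 2 ≤ 0 := by
    have : (7 / 3 * p ^ 2 - 4 / 3) * (1 - 2 * p) + b * p ^ 2 =
      7 / 6 * p ^ 2 * (1 - p) ^ 2 + p ^ 2 * (2 - p - p ^ 2) - 4 / 3 * (1 - p) ^ 2 := by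
      rw [hb]; ring
    linarith
  have hbu : (7 / 3 * p ^ 2 - 4 / 3) * (1 - 2 * p) + b * u ≤ 0 := by
    rcases le_total b 0 with h | h
    · nlinarith
    · nlinarith
  have : 0 ≤ 5 / 6 * u * (p ^ 2 - u) := by
    have := mul_nonneg hu0 (sub_nonneg.2 hu)
    linarith
  linarith

/-- The number `t` of pairs that `light` inspects can be chosen such that the total cost is small.
Here `h` is the number of pairs, `d` the size of the random fluctuations, `p` the frequency of the
candidate and `s` the sum of the squares of all frequencies. -/
theorem light_real {h : ℕ} {d s p : ℝ} (hd : 1 ≤ d) (hdh : 1000 * d ≤ h) (hp0 : 0 ≤ p)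
    (hp1 : p ≤ 1) (hs0 : p ^ 2 ≤ s) (hs1 : s ≤ p ^ 2 + (1 - p) ^ 2)
    (hu : -(3 * d) ≤ h * (2 * p ^ 2 - s)) (hcase : p ≤ 0.46 ∨ h * (2 * p ^ 2 - s) ≤ 110 * d) :
    ∃ t ≤ h, (t = h ∨ h * (2 * p ^ 2 - s) + 7 * d ≤ t * (1 - s - 2 * p * (1 - p))) ∧
      h + 7 / 6 * (h * s + d) + t * (2 - 2 * s - p + p ^ 2) + 3 * d ≤ 7 / 3 * h + 1000 * d := by
  have hh0 : (0 : ℝ) < h := by linarith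
  obtain ⟨u, hudef⟩ : ∃ u, u = 2 * p ^ 2 - s := ⟨_, rfl⟩
  obtain ⟨r, hr⟩ : ∃ r, r = 1 - s - 2 * p * (1 - p) := ⟨_, rfl⟩
  obtain ⟨w, hw⟩ : ∃ w, w = 2 - 2 * s - p + p ^ 2 := ⟨_, rfl⟩
  rw [← hudef] at hu hcase ⊢
  rw [← hr, ← hw]
  have hs : s = 2 * p ^ 2 - u := by linarith
  have hr' : r = 1 - 2 * p + u := by rw [hr, hs]; ring
  have hw' : w = 2 - p - 3 * p ^ 2 + 2 * u := by rw [hw, hs]; ring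
  have hpp : 0 ≤ p * (1 - p) := mul_nonneg hp0 (by linarith)
  have hp2' := sq_nonneg p
  have hs1' : s ≤ 1 - 2 * (p * (1 - p)) := hs1.trans_eq (by ring)
  have hr1 : r ≤ 1 := by linarith
  have hw3 : w = 2 - 2 * s - p * (1 - p) := by rw [hw]; ring
  have hw0 : 0 ≤ w := by linarith
  have hw2 : w ≤ 2 := by linarith
  -- The least `t` after which the counter is exhausted, fluctuations included; rounding up costs
  -- one more `r`.
  have hceil : 0 < r → h * u + 7 * d + r ≤ h * r → ∃ t : ℕ, t ≤ h ∧
      h * u + 7 * d ≤ t * r ∧ t * r ≤ h * u + 7 * d + r := by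
    intro hr0 hle
    have hT0 : 0 ≤ (h * u + 7 * d) / r := div_nonneg (by linarith) hr0.le
    have hlt := Nat.ceil_lt_add_one hT0
    have hge := Nat.le_ceil ((h * u + 7 * d) / r)
    refine ⟨⌈(h * u + 7 * d) / r⌉₊, ?_, ?_, ?_⟩
    · have : (h * u + 7 * d) / r + 1 ≤ h := by
        rw [div_add_one hr0.ne', div_le_iff₀ hr0]; exact hle
      have : (⌈(h * u + 7 * d) / r⌉₊ : ℝ) ≤ h := by linarith
      exact_mod_cast this
    · rwa [div_le_iff₀ hr0] at hge
    · have := mul_le_mul_of_nonneg_right hlt.le hr0.le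
      rwa [add_mul, one_mul, div_mul_cancel₀ _ hr0.ne'] at this
  by_cases hI : p ≤ 0.46
  · have hrlow : 0.07 ≤ r := by
      have : 0.07 * (h : ℝ) ≤ h * r := by rw [hr']; nlinarith
      nlinarith
    have hr0 : 0 < r := by linarith
    obtain ⟨t, ht, htl, htu⟩ := hceil hr0 (by
      have : (h : ℝ) * r = h * (1 - 2 * p) + h * u := by rw [hr']; ring
      nlinarith)
    refine ⟨t, ht, Or.inr htl, ?_⟩
    -- Since `t * r` is about `h * u`, this is the claim multiplied by `r` without error terms. For
    -- `u ≤ 0` it is trivial.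
    have hmain : 7 / 6 * s * r + u * w ≤ 4 / 3 * r := by
      rcases le_total 0 u with h0 | h0
      · have := light_poly hp0 hI h0 (by linarith)
        rw [hs, hr', hw']
        linarith
      · have h1 := mul_nonneg (neg_nonneg.2 h0) hw0
        have h2 := mul_le_mul_of_nonneg_right (show s ≤ 1 by linarith) hr0.le
        linarith
    have htw : t * r * w ≤ h * (u * w) + 16 * d := by
      have h1 := mul_le_mul_of_nonneg_right htu hw0
      have h2 : (7 * d + r) * w ≤ (8 * d) * 2 :=
        mul_le_mul (by linarith) hw2 hw0 (by linarith)
      linarith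
    have hdr : 16 * d ≤ 300 * d * r := by
      have := mul_le_mul_of_nonneg_left hrlow (show 0 ≤ 300 * d by linarith)
      linarith
    have : r * (7 / 6 * (h * s) + t * w) ≤ r * (4 / 3 * h + 300 * d) := by
      have := mul_le_mul_of_nonneg_left hmain hh0.le
      linarith
    have := le_of_mul_le_mul_left this hr0
    linarith
  · have hK : h * u ≤ 110 * d := hcase.resolve_left hI
    obtain ⟨y, hy⟩ : ∃ y, y = 1 - 2 * p := ⟨_, rfl⟩
    have hpy : p = (1 - y) / 2 := by linarith
    -- Now `u` is negligible. If `p` is at least about `1/2`, testing all pairs is affordable.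
    -- Otherwise `r ≥ y / 2` bounds `t * y` by a multiple of `d`, so that `t * w` exceeds `3/4 h` by
    -- only a multiple of `d`, while `s` is at most about `1/2`: again `1 + 7/12 + 3/4 = 7/3`.
    by_cases hII : h * y ≤ 8 * d
    · refine ⟨h, le_rfl, Or.inl rfl, ?_⟩
      have h1 : 7 / 6 * s + w = 4 / 3 + 5 / 6 * y - y ^ 2 / 6 + 5 / 6 * u := by
        rw [hw', hs, hpy]; ring
      have h2 : h * (7 / 6 * s + w) ≤ h * (4 / 3 + 5 / 6 * y + 5 / 6 * u) :=
        mul_le_mul_of_nonneg_left (by rw [h1]; nlinarith [sq_nonneg y]) hh0.le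
      nlinarith
    · push Not at hII
      have hy0 : 0 < y := by
        by_contra hc
        push Not at hc
        nlinarith
      have hy1 : y ≤ 1 := by linarith
      have hhr : h * r = h * y + h * u := by rw [hr', hy]; ring
      have hry : y ≤ 2 * r := by
        have : (h : ℝ) * y ≤ h * (2 * r) := by linarith
        exact le_of_mul_le_mul_left this hh0
      have hr0 : 0 < r := by linarith
      obtain ⟨t, ht, htl, htu⟩ := hceil hr0 (by linarith)
      refine ⟨t, ht, Or.inr htl, ?_⟩
      have ht0 : (0 : ℝ) ≤ t := Nat.cast_nonneg _
      have hth : (t : ℝ) ≤ h := by exact_mod_cast ht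
      have hty : t * y ≤ 236 * d := by
        have := mul_le_mul_of_nonneg_left hry ht0
        linarith
      have htuu : t * u ≤ 110 * d := by
        rcases le_total 0 u with h0 | h0
        · exact (mul_le_mul_of_nonneg_right hth h0).trans hK
        · have := mul_nonneg ht0 (neg_nonneg.2 h0)
          linarith
      have hwle : w ≤ 3 / 4 + 2 * y + 2 * u := by
        rw [hw', hpy]
        nlinarith [sq_nonneg y]
      have htw : t * w ≤ 3 / 4 * h + 2 * (236 * d) + 2 * (110 * d) := by
        have := mul_le_mul_of_nonneg_left hwle ht0
        linarith
      have hp2 : 2 * p ^ 2 ≤ 1 / 2 := by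
        have := pow_le_pow_left₀ hp0 (show p ≤ 1 / 2 by linarith) 2
        linarith
      have hhs : h * s ≤ h * (1 / 2) + 3 * d := by
        rw [hs, mul_sub]
        have := mul_le_mul_of_nonneg_left hp2 hh0.le
        linarith
      linarith

/-- With `p = 1/2 + x` the cost is `11/4 h - 5/6 h s + h x ^ 2` up to multiples of `d`, and `s` is
at least about `1/2`. An upper bound on `x` is assumed; the lower one holds because the candidate
won the recursion, which forces `2 p ^ 2 ≥ s` up to fluctuations. -/
theorem balanced_real {h d s p : ℝ} (hd : 0 ≤ d) (hh : 0 ≤ h) (hp0 : 0 ≤ p)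
    (hp1 : p ≤ 1) (hs : h / 2 - 410 * d ≤ h * s) (hp : h * p ≤ h / 2 + 410 * d)
    (hu : -(3 * d) ≤ h * (2 * p ^ 2 - s)) :
    h + 7 / 6 * (h * s + d) + h * (2 - 2 * s - p + p ^ 2) + 3 * d ≤ 7 / 3 * h + 1000 * d := by
  obtain ⟨x, hx⟩ : ∃ x, p = 1 / 2 + x := ⟨p - 1 / 2, by ring⟩
  have hx2 : h * x ^ 2 ≤ 413 / 2 * d := by
    rcases le_total 0 x with h0 | h0
    · have : x * (h * x) ≤ 1 / 2 * (410 * d) := by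
        have h1 : h * x ≤ 410 * d := by rw [hx] at hp; linarith
        exact mul_le_mul (by linarith) h1 (mul_nonneg hh h0) (by norm_num)
      nlinarith
    · have h1 : h * (-x) ≤ 413 * d := by
        have h2 : 2 * p ^ 2 ≤ 1 / 2 + x := by rw [hx]; nlinarith
        have := mul_le_mul_of_nonneg_left h2 hh
        linarith
      have : (-x) * (h * (-x)) ≤ 1 / 2 * (413 * d) :=
        mul_le_mul (by linarith) h1 (mul_nonneg hh (by linarith)) (by norm_num)
      nlinarith
  have : h * (2 - 2 * s - p + p ^ 2) = 7 / 4 * h + h * x ^ 2 - 2 * (h * s) := by rw [hx]; ring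
  linarith

end RealInequalities

/-! ### Numbers of pairs of each kind. -/

section Counting

variable {β : Type} {κ : Type u} [DecidableEq κ] (color : β → κ)

/-- A pair of equal colors. -/
abbrev eqPair (q : β × β) : Bool := decide (color q.1 = color q.2)

/-- A pair in which both balls have the color `a`. -/
abbrev bothPair (a : κ) (q : β × β) : Bool := decide (color q.1 = a) && decide (color q.2 = a)

/-- A pair in which only the first ball has the color `a`. -/
abbrev firstPair (a : κ) (q : β × β) : Bool := decide (color q.1 = a) && decide (color q.2 ≠ a)

/-- A pair in which only the second ball has the color `a`. -/
abbrev secondPair (a : κ) (q : β × β) : Bool := decide (color q.1 ≠ a) && decide (color q.2 = a)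

variable {color}

theorem length_sames (P : List (β × β)) : (sames color P).length = P.countP (eqPair color) := by
  rw [sames, List.length_map, List.countP_eq_length_filter]

theorem num_sames (a : κ) (P : List (β × β)) :
    num color a (sames color P) = P.countP (bothPair color a) := by
  rw [sames, num, List.countP_map, List.countP_filter]
  refine List.countP_congr fun q _ => ?_
  simp only [Function.comp_apply, Bool.and_eq_true, decide_eq_true_eq]
  constructor
  · rintro ⟨h1, h2⟩; exact ⟨h2.trans h1, h1⟩
  · rintro ⟨h1, h2⟩; exact ⟨h2, h1.trans h2.symm⟩

theorem hits_diffs (a : κ) (P : List (β × β)) : hits color a (diffs color P) =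
    P.countP (firstPair color a) + P.countP (secondPair color a) := by
  rw [hits, diffs, List.countP_filter]
  induction P with
  | nil => rfl
  | cons q P ih =>
    simp only [List.countP_cons, ih]
    by_cases h1 : color q.1 = a <;> by_cases h2 : color q.2 = a
    · simp [h1, h2]
    · simp [h1, h2, Ne.symm h2]; omega
    · simp [h1, h2]; omega
    · simp [h1, h2]

theorem probeCost_diffs (a : κ) (P : List (β × β)) :
    probeCost color a (diffs color P) + P.countP (firstPair color a) =
      2 * (diffs color P).length := by
  induction P with
  | nil => rfl
  | cons q P ih =>
    simp only [diffs, probeCost] at ih ⊢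
    simp only [List.countP_cons, List.filter_cons]
    by_cases h1 : color q.1 = a <;> by_cases h2 : color q.2 = a
    · simp [h1, h2] at ih ⊢; omega
    · simp [h1, h2, Ne.symm h2] at ih ⊢; omega
    · simp [h1, h2] at ih ⊢; omega
    · by_cases h3 : color q.1 = color q.2
      · simp [h2, h3] at ih ⊢; omega
      · simp [h1, h3] at ih ⊢; omega

theorem pairNum_and (f g : β → Bool) (M : List β) :
    pairNum (fun q => f q.1 && g q.2) M = M.countP f * M.countP g := by
  have : ∀ M' : List β, (M'.map (fun x => M.countP (fun y => f x && g y))).sum =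
      M'.countP f * M.countP g := by
    intro M'
    induction M' with
    | nil => simp
    | cons x l ih =>
      rw [List.map_cons, List.sum_cons, ih, List.countP_cons]
      cases f x <;> simp; ring
  exact this M

theorem pairNum_eqPair (M : List β) : pairNum (eqPair color) M = sumSq color M := by
  unfold pairNum sumSq num
  simp only [eq_comm]

theorem countP_ne (a : κ) (M : List β) :
    M.countP (fun x => decide (color x ≠ a)) = M.length - num color a M := by
  have := List.length_eq_countP_add_countP (fun x => decide (color x = a)) (l := M)
  simp only [decide_eq_true_eq] at this
  rw [num]
  simp only [ne_eq]
  omega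

theorem sumSq_le (M : List β) : sumSq color M ≤ M.length ^ 2 := by
  refine (List.sum_le_card_nsmul _ M.length ?_).trans (by simp [pow_two])
  intro y hy
  obtain ⟨x, -, rfl⟩ := List.mem_map.1 hy
  exact num_le_length _ _

theorem pairNum_ne (M : List β) :
    pairNum (fun q => decide (color q.1 ≠ color q.2)) M + sumSq color M = M.length ^ 2 := by
  have : ∀ M' : List β, (M'.map (fun x => M.countP (fun y => decide (color x ≠ color y)))).sum +
      (M'.map (fun x => num color (color x) M)).sum = M'.length * M.length := by
    intro M'
    induction M' with
    | nil => simp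
    | cons x l ih =>
      have h1 := countP_ne (color := color) (color x) M
      have h2 := num_le_length (color := color) (color x) M
      simp only [ne_comm (b := color x)] at h1
      rw [List.map_cons, List.map_cons, List.sum_cons, List.sum_cons, List.length_cons, h1,
        add_mul, ← ih]
      omega
  rw [pow_two]
  exact this M

theorem sumSq_split (v : β) (M : List β) : sumSq color M = num color (color v) M ^ 2 +
    sumSq color (M.filter (fun x => decide (color x ≠ color v))) := by
  induction M with
  | nil => rfl
  | cons x l ih =>
    rw [sumSq_cons, ih, num_cons]
    by_cases hx : color x = color v
    · simp [hx]; ring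
    · rw [if_neg hx, List.filter_cons_of_pos (by simpa using hx), sumSq_cons, num_others hx]
      ring

/-- Double counting of the pairs of equal colors between two lists. -/
theorem sum_num_comm (l l' : List β) : (l.map (fun x => num color (color x) l')).sum =
    (l'.map (fun y => num color (color y) l)).sum := by
  induction l with
  | nil => simp
  | cons x l ih =>
    simp only [num_cons, List.sum_map_add, List.map_cons, List.sum_cons, ih,
      sum_indicator_eq_num]
    omega

end Counting

/-! ### Good samples and good shuffles, and their failure probabilities. -/

section Deviations

variable {β : Type} {κ : Type u} [DecidableEq κ] {color : β → κ}

/-- The size of the random fluctuations that are tolerated for a list of `n` balls. -/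
noncomputable def dev (n : ℕ) : ℝ := n * tol n / 100

/-- A bound for the probability of a larger fluctuation. -/
noncomputable def tail (n : ℕ) : ℝ := 2 * Real.exp (-((n : ℝ) ^ (2 / 15 : ℝ) / 2000000))

theorem tail_nonneg (n : ℕ) : 0 ≤ tail n := by unfold tail; positivity

/-- The right side is `n ^ (4/5)`. It is weakened to the exponent `2/15 = 1/3 - 1/5` dictated by the
small sample, so that one `tail` serves both kinds of events. -/
theorem mul_tol_sq {n : ℕ} (hn : 1 ≤ n) : (n : ℝ) ^ (2 / 15 : ℝ) ≤ n * tol n ^ 2 := by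
  have h : (1 : ℝ) ≤ n := by exact_mod_cast hn
  have : n * tol n ^ 2 = (n : ℝ) ^ (4 / 5 : ℝ) := by
    rw [tol, ← Real.rpow_natCast, ← Real.rpow_mul (by positivity),
      ← Real.rpow_one_add' (by positivity) (by norm_num)]
    norm_num
  rw [this]
  exact Real.rpow_le_rpow_of_exponent_le h (by norm_num)

theorem sampleSize_mul_tol_sq {n : ℕ} (hn : 1 ≤ n) :
    (n : ℝ) ^ (2 / 15 : ℝ) ≤ sampleSize n * tol n ^ 2 := by
  have h : (0 : ℝ) < n := by exact_mod_cast hn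
  have h2 : tol n ^ 2 = (n : ℝ) ^ (-(1 / 5) : ℝ) := by
    rw [tol, ← Real.rpow_natCast, ← Real.rpow_mul (by positivity)]
    norm_num
  have h3 : (n : ℝ) ^ (2 / 15 : ℝ) = (n : ℝ) ^ (1 / 3 : ℝ) * (n : ℝ) ^ (-(1 / 5) : ℝ) := by
    rw [← Real.rpow_add h]
    norm_num
  rw [h2, h3]
  exact mul_le_mul_of_nonneg_right (Nat.le_ceil _) (by positivity)

/-- `n` may exceed the length of the list: `heavy` shuffles only the other balls but measures
fluctuations on the scale of the whole list. -/
theorem failProb_pairs_le_tail {M : List β} (hM : 2 ≤ M.length) {n : ℕ} (hn : M.length ≤ n)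
    (hd : 2 ≤ dev n) (p : β × β → Bool) {t : ℕ} (ht : 2 * t ≤ M.length) :
    failProb color (shuffle M) (fun S _ =>
      |(((pairs S).take t).countP p : ℝ) - t * pairNum p M / M.length ^ 2| ≤ dev n) ≤
      ENNReal.ofReal (tail n) := by
  refine (failProb_mono fun S _ h => ?_).trans ((failProb_pairs_le hM p ht
    (show 0 ≤ dev n / 2 by linarith)).trans (ENNReal.ofReal_le_ofReal ?_))
  · have : dev n / 2 + 1 ≤ dev n := by linarith
    exact h.le.trans this
  · unfold tail
    have hL : (0 : ℝ) < M.length := by exact_mod_cast (by omega : 0 < M.length)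
    have hLn : (M.length : ℝ) ≤ n := by exact_mod_cast hn
    have h1 := mul_tol_sq (n := n) (by omega)
    have h2 : (n : ℝ) ^ (2 / 15 : ℝ) / 2000000 ≤ (dev n / 2) ^ 2 / (32 * M.length) := by
      rw [le_div_iff₀ (by positivity), dev]
      have h3 : (n : ℝ) ^ (2 / 15 : ℝ) * M.length ≤ n * tol n ^ 2 * n :=
        mul_le_mul h1 hLn hL.le (by positivity)
      have h4 : 0 ≤ (n : ℝ) * tol n ^ 2 * n := by positivity
      linarith
    have := Real.exp_le_exp.2 (neg_le_neg h2)
    linarith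

theorem failProb_sample_le_tail {M : List β} (hM : 1 ≤ M.length) (a : κ) :
    failProb color (shuffle M) (fun S _ =>
      |(num color a (S.take (sampleSize M.length)) : ℝ) -
        sampleSize M.length * num color a M / M.length| ≤
        sampleSize M.length * (tol M.length / 100)) ≤ ENNReal.ofReal (tail M.length) := by
  have htol : 0 ≤ tol M.length := by unfold tol; positivity
  refine (failProb_mono fun S _ h => ?_).trans
    ((failProb_sample_le (one_le_sampleSize hM) (sampleSize_le hM) a
    (show 0 ≤ sampleSize M.length * (tol M.length / 100) by positivity)).trans
      (ENNReal.ofReal_le_ofReal ?_))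
  · exact h.le
  · unfold tail
    have hm : (0 : ℝ) < sampleSize M.length := by exact_mod_cast one_le_sampleSize hM
    have h1 := sampleSize_mul_tol_sq (n := M.length) hM
    have h2 : (M.length : ℝ) ^ (2 / 15 : ℝ) / 2000000 ≤
        (sampleSize M.length * (tol M.length / 100)) ^ 2 / (32 * sampleSize M.length) := by
      rw [le_div_iff₀ (by positivity)]
      have h3 := mul_le_mul_of_nonneg_right h1 hm.le
      have h4 : 0 ≤ sampleSize M.length * tol M.length ^ 2 * sampleSize M.length := by positivity
      linarith
    have := Real.exp_le_exp.2 (neg_le_neg h2)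
    linarith

variable (color) in
/-- All color frequencies in the sample are close to those in `M`. -/
def GoodSample (M S : List β) : Prop :=
  ∀ i ∈ (Finset.univ : Finset (Fin M.length)),
    |(num color (color (M.get i)) (S.take (sampleSize M.length)) : ℝ) -
      sampleSize M.length * num color (color (M.get i)) M / M.length| ≤
      sampleSize M.length * (tol M.length / 100)

/-- The union bound runs over balls instead of colors, as the type of colors may be infinite. -/
theorem failProb_goodSample_le {M : List β} (hM : 1 ≤ M.length) :
    failProb color (shuffle M) (fun S _ => GoodSample color M S) ≤
      M.length * ENNReal.ofReal (tail M.length) := by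
  have := failProb_forall_le (color := color) (shuffle M)
    (Finset.univ : Finset (Fin M.length)) (fun i S =>
    |(num color (color (M.get i)) (S.take (sampleSize M.length)) : ℝ) -
      sampleSize M.length * num color (color (M.get i)) M / M.length| ≤
      sampleSize M.length * (tol M.length / 100)) (tail M.length)
    fun i _ => failProb_sample_le_tail hM _
  rwa [Finset.card_univ, Fintype.card_fin] at this

variable (color) in
/-- The pairs of each kind are distributed evenly over the shuffled list `S`. -/
def GoodShuffle (M S : List β) : Prop :=
  ∀ j ∈ Finset.range (M.length / 2 + 1) ×ˢ (Finset.univ : Finset (Fin M.length)),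
    ∀ p ∈ [eqPair color, bothPair color (color (M.get j.2)), firstPair color (color (M.get j.2)),
      secondPair color (color (M.get j.2))],
    |(((pairs S).take j.1).countP p : ℝ) - j.1 * pairNum p M / M.length ^ 2| ≤ dev M.length

theorem failProb_goodShuffle_le {M : List β} (hM : 2 ≤ M.length) (hd : 2 ≤ dev M.length) :
    failProb color (shuffle M) (fun S _ => GoodShuffle color M S) ≤
      ((M.length / 2 + 1) * M.length : ℕ) * ENNReal.ofReal (4 * tail M.length) := by
  have := failProb_forall_le (color := color) (shuffle M)
    (Finset.range (M.length / 2 + 1) ×ˢ (Finset.univ : Finset (Fin M.length)))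
    (fun j S => ∀ p ∈ [eqPair color, bothPair color (color (M.get j.2)),
        firstPair color (color (M.get j.2)), secondPair color (color (M.get j.2))],
      |(((pairs S).take j.1).countP p : ℝ) - j.1 * pairNum p M / M.length ^ 2| ≤ dev M.length)
    (4 * tail M.length) ?_
  · rwa [Finset.card_product, Finset.card_range, Finset.card_univ, Fintype.card_fin] at this
  · intro j hj
    have ht : 2 * j.1 ≤ M.length := by
      have := Finset.mem_range.1 (Finset.mem_product.1 hj).1
      omega
    have h := fun p => failProb_pairs_le_tail (color := color) hM le_rfl hd p ht
    have hx := tail_nonneg M.length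
    rw [show 4 * tail M.length = tail M.length + (tail M.length + (tail M.length + tail M.length))
      by ring, ENNReal.ofReal_add hx (by positivity), ENNReal.ofReal_add hx (by positivity),
      ENNReal.ofReal_add hx hx]
    simp only [List.forall_mem_cons]
    refine (failProb_and_le _ _ _).trans (add_le_add (h _) ?_)
    refine (failProb_and_le _ _ _).trans (add_le_add (h _) ?_)
    refine (failProb_and_le _ _ _).trans (add_le_add (h _) ?_)
    refine (failProb_mono ?_).trans (h (secondPair color (color (M.get j.2))))
    exact fun S _ hS => ⟨hS, by simp⟩

/-- The frequency of a color. -/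
noncomputable def freq (color : β → κ) (a : κ) (M : List β) : ℝ := num color a M / M.length

/-- The sum of the squares of the frequencies of the colors. -/
noncomputable def freqSq (color : β → κ) (M : List β) : ℝ := sumSq color M / M.length ^ 2

theorem freq_nonneg (a : κ) (M : List β) : 0 ≤ freq color a M := by unfold freq; positivity

theorem freq_le_one (a : κ) (M : List β) : freq color a M ≤ 1 := by
  refine div_le_one_of_le₀ ?_ (Nat.cast_nonneg _)
  exact_mod_cast num_le_length a M

theorem freq_sq_le_freqSq (v : β) (M : List β) : freq color (color v) M ^ 2 ≤ freqSq color M := by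
  rw [freq, freqSq, div_pow]
  refine div_le_div_of_nonneg_right ?_ (by positivity)
  exact_mod_cast (sumSq_split (color := color) v M) ▸ Nat.le_add_right _ _

theorem freqSq_le (v : β) {M : List β} (hM : M ≠ []) :
    freqSq color M ≤ freq color (color v) M ^ 2 + (1 - freq color (color v) M) ^ 2 := by
  have h0 : (0 : ℝ) < M.length := by exact_mod_cast List.length_pos_iff.2 hM
  have h1 := sumSq_split (color := color) v M
  have h2 := sumSq_le (color := color) (M.filter (fun x => decide (color x ≠ color v)))
  have h3 := length_others (color := color) v M
  have h4 : ((M.filter (fun x => decide (color x ≠ color v))).length : ℝ) =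
      M.length - num color (color v) M := by rw [← h3]; push_cast; ring
  have h5 : (sumSq color M : ℝ) ≤ num color (color v) M ^ 2 +
      (M.length - num color (color v) M) ^ 2 := by
    rw [← h4, h1]
    push_cast
    exact_mod_cast Nat.add_le_add_left h2 _
  rw [freq, freqSq, one_sub_div h0.ne', div_pow, div_pow, ← add_div]
  exact div_le_div_of_nonneg_right h5 (by positivity)

/-- A random pair is equal with probability `s`, and has the color of `x` in the first place only
with probability `p (1 - p)`. Probing costs 2 per pair of different colors minus 1 whenever the
first ball matches: two `dev` from the equal pairs and one from the first matches. A miss is a pair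
of different colors without a match in either place, again three `dev`. -/
theorem GoodShuffle.bounds {M S : List β} (h : GoodShuffle color M S) (hS : S.Perm M) {x : β}
    (hx : x ∈ M) {t : ℕ} (ht : t ≤ M.length / 2) :
    let P := (pairs S).take t
    let p := freq color (color x) M
    let s := freqSq color M
    |((sames color P).length : ℝ) - t * s| ≤ dev M.length ∧
    |(num color (color x) (sames color P) : ℝ) - t * p ^ 2| ≤ dev M.length ∧
    (probeCost color (color x) (diffs color P) : ℝ) ≤
      t * (2 - 2 * s - p + p ^ 2) + 3 * dev M.length ∧
    t * (1 - s - 2 * p * (1 - p)) - 3 * dev M.length + hits color (color x) (diffs color P) ≤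
      (diffs color P).length := by
  intro P p s
  have h0 : (0 : ℝ) < M.length := by
    exact_mod_cast List.length_pos_iff.2 (List.ne_nil_of_mem hx)
  obtain ⟨i, rfl⟩ := List.get_of_mem hx
  have h' := h (t, i) (by simp; omega)
  simp only [List.forall_mem_cons] at h'
  obtain ⟨hE, hA, hB, hC, -⟩ := h'
  have e1 : (t : ℝ) * sumSq color M / M.length ^ 2 = t * s := by simp only [s, freqSq]; ring
  have hle := num_le_length (color := color) (color (M.get i)) M
  rw [pairNum_eqPair, e1] at hE
  rw [pairNum_and (fun y => decide (color y = color (M.get i)))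
    (fun y => decide (color y = color (M.get i)))] at hA
  rw [pairNum_and (fun y => decide (color y = color (M.get i)))
    (fun y => decide (color y ≠ color (M.get i))), countP_ne] at hB
  rw [pairNum_and (fun y => decide (color y ≠ color (M.get i)))
    (fun y => decide (color y = color (M.get i))), countP_ne] at hC
  change |_ - (t : ℝ) * (num color (color (M.get i)) M * num color (color (M.get i)) M : ℕ) / _|
    ≤ _ at hA
  change |_ - (t : ℝ) * (num color (color (M.get i)) M *
    (M.length - num color (color (M.get i)) M) : ℕ) / _| ≤ _ at hB
  change |_ - (t : ℝ) * ((M.length - num color (color (M.get i)) M) *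
    num color (color (M.get i)) M : ℕ) / _| ≤ _ at hC
  rw [Nat.cast_mul] at hA
  rw [Nat.cast_mul, Nat.cast_sub hle] at hB hC
  have e2 : (t : ℝ) * (num color (color (M.get i)) M * num color (color (M.get i)) M) /
      M.length ^ 2 = t * p ^ 2 := by simp only [p, freq]; ring
  have e3 : (t : ℝ) * (num color (color (M.get i)) M *
      (M.length - num color (color (M.get i)) M)) / M.length ^ 2 = t * (p * (1 - p)) := by
    simp only [p, freq]; field_simp
  have e4 : (t : ℝ) * ((M.length - num color (color (M.get i)) M) *
      num color (color (M.get i)) M) / M.length ^ 2 = t * (p * (1 - p)) := by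
    rw [← e3]; ring
  rw [e2] at hA
  rw [e3] at hB
  rw [e4] at hC
  have hlen := length_sames_add_diffs (color := color) P
  have hPt : P.length = t := by
    simp only [P, List.length_take, length_pairs, hS.length_eq]
    omega
  rw [hPt] at hlen
  have hprobe := probeCost_diffs (color := color) (color (M.get i)) P
  have hhits := hits_diffs (color := color) (color (M.get i)) P
  rw [← length_sames] at hE
  rw [← num_sames] at hA
  have hlen' : ((sames color P).length : ℝ) + (diffs color P).length = t := by
    exact_mod_cast hlen
  have hprobe' : (probeCost color (color (M.get i)) (diffs color P) : ℝ) +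
      P.countP (firstPair color (color (M.get i))) = 2 * (diffs color P).length := by
    exact_mod_cast hprobe
  have hhits' : (hits color (color (M.get i)) (diffs color P) : ℝ) =
      P.countP (firstPair color (color (M.get i))) +
        P.countP (secondPair color (color (M.get i))) := by exact_mod_cast hhits
  have hE' := abs_le.1 hE
  have hB' := abs_le.1 hB
  have hC' := abs_le.1 hC
  refine ⟨hE, hA, ?_, ?_⟩
  · linarith [hE'.1, hB'.1]
  · linarith [hE'.2, hB'.2, hC'.2]

end Deviations

/-! ### Cost of each branch after a good sample and a good shuffle. -/

section Costs

variable {β : Type} {κ : Type u} [DecidableEq κ] {color : β → κ}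

/-- The cost of a call of `balanced` or `light` in terms of the cost of its final loop. -/
theorem GoodShuffle.pairingCost_le {M S : List β} (h : GoodShuffle color M S) (hS : S.Perm M)
    (hd : 1 ≤ dev M.length) {L : List β → β → ℕ → Prop} {G : ℝ} {T : ℕ}
    (hT : PairingCost color (fun X T' => (T' : ℝ) ≤ 7 / 6 * X.length + G) L S T)
    (hL : ∀ x ∈ M, ∀ v c, color x = color v → L S v c →
      let p := freq color (color v) M
      let s := freqSq color M;
      -(3 * dev M.length) ≤ (M.length / 2 : ℕ) * (2 * p ^ 2 - s) →
      (M.length / 2 : ℕ) + 7 / 6 * ((M.length / 2 : ℕ) * s + dev M.length) + c ≤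
        7 / 3 * ((M.length / 2 : ℕ) : ℝ) + 1000 * dev M.length) :
    (T : ℝ) ≤ 7 / 6 * M.length + 1003 * dev M.length + G := by
  obtain ⟨T', hT', hT⟩ := hT
  have hX : ((reduced (kept color S) (leftover S)).length : ℝ) ≤ (kept color S).length + 1 := by
    exact_mod_cast length_reduced_le_add_one _ _
  have hh : 2 * ((M.length / 2 : ℕ) : ℝ) ≤ M.length := by
    exact_mod_cast (by omega : 2 * (M.length / 2) ≤ M.length)
  rcases hT with hT | ⟨v, c, hv, hc, hT⟩
  · have h1 := length_kept_add_diffs (color := color) S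
    have h2 : ((kept color S).length : ℝ) ≤ (M.length / 2 : ℕ) := by
      rw [← hS.length_eq]
      exact_mod_cast (by omega : (kept color S).length ≤ S.length / 2)
    have h3 : (T : ℝ) ≤ (M.length / 2 : ℕ) + T' := by
      rw [← hS.length_eq]
      exact_mod_cast hT
    linarith
  -- `GoodShuffle` speaks only of colors of balls of `M`; the positive counter shows that the
  -- candidate's color is one of them.
  · obtain ⟨x, hx, hxv⟩ : ∃ x ∈ M, color x = color v := by
      have h1 := num_eq_kept (color := color) (color v) S
      have h2 : 0 < num color (color v) M := by
        rw [← num_perm hS]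
        omega
      obtain ⟨x, hx, hxv⟩ := List.countP_pos_iff.1 h2
      exact ⟨x, hx, by simpa using hxv⟩
    have hb := h.bounds hS hx (le_refl (M.length / 2))
    have htake : (pairs S).take (M.length / 2) = pairs S :=
      List.take_of_length_le (by rw [length_pairs, hS.length_eq])
    rw [hxv, htake] at hb
    obtain ⟨hE, hA, -, -⟩ := hb
    have hE' := abs_le.1 hE
    have hA' := abs_le.1 hA
    have hl : (num color (color v) (leftover S).toList : ℝ) ≤ 1 := by
      have h1 := num_le_length (color := color) (color v) (leftover S).toList
      have h2 := length_leftover S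
      exact_mod_cast (by omega : num color (color v) (leftover S).toList ≤ 1)
    have hv' : ((kept color S).length : ℝ) + 1 ≤
        2 * num color (color v) (kept color S) + num color (color v) (leftover S).toList := by
      exact_mod_cast hv
    -- The candidate won in the reduced list, so `|X|` is at most twice its count in `X`. The
    -- deviations of the two sides, `d` and `2 d`, give the `3 d` in the lower bound.
    have h4 := hL x hx v c hxv hc (by linarith)
    have h3 : (T : ℝ) ≤ (M.length / 2 : ℕ) + T' + 1 + c := by
      rw [← hS.length_eq]
      exact_mod_cast hT
    linarith

theorem GoodShuffle.balanced_cost_le {M S : List β} (h : GoodShuffle color M S) (hS : S.Perm M)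
    (hd : 1 ≤ dev M.length) {G : ℝ} {T : ℕ}
    (hT : PairingCost color (fun X T' => (T' : ℝ) ≤ 7 / 6 * X.length + G)
      (BalancedLoop color) S T)
    (hs : ((M.length / 2 : ℕ) : ℝ) / 2 - 410 * dev M.length ≤
      (M.length / 2 : ℕ) * freqSq color M)
    (hp : ∀ x ∈ M, (M.length / 2 : ℕ) * freq color (color x) M ≤
      ((M.length / 2 : ℕ) : ℝ) / 2 + 410 * dev M.length) :
    (T : ℝ) ≤ 7 / 6 * M.length + 1003 * dev M.length + G := by
  refine h.pairingCost_le hS hd hT fun x hx v c hxv hc hu => ?_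
  obtain ⟨-, -, hprobe, -⟩ := h.bounds hS hx (le_refl (M.length / 2))
  have htake : (pairs S).take (M.length / 2) = pairs S :=
    List.take_of_length_le (by rw [length_pairs, hS.length_eq])
  have hpx := hp x hx
  rw [hxv] at hpx
  rw [hxv, htake] at hprobe
  have hr := balanced_real (by linarith) (Nat.cast_nonneg _) (freq_nonneg (color := color) _ M)
    (freq_le_one (color := color) (color v) M) hs hpx hu
  have hc' : (c : ℝ) ≤ probeCost color (color v) (diffs color (pairs S)) := by exact_mod_cast hc
  linarith

theorem GoodShuffle.light_cost_le {M S : List β} (h : GoodShuffle color M S) (hS : S.Perm M)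
    (hd : 1 ≤ dev M.length) (hdh : 1000 * dev M.length ≤ (M.length / 2 : ℕ)) {G : ℝ} {T : ℕ}
    (hT : PairingCost color (fun X T' => (T' : ℝ) ≤ 7 / 6 * X.length + G)
      (LightLoop color) S T)
    (hp : ∀ x ∈ M, freq color (color x) M ≤ 0.46 ∨
      (M.length / 2 : ℕ) * (2 * freq color (color x) M ^ 2 - freqSq color M) ≤
        110 * dev M.length) :
    (T : ℝ) ≤ 7 / 6 * M.length + 1003 * dev M.length + G := by
  refine h.pairingCost_le hS hd hT fun x hx v c hxv hc hu => ?_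
  obtain ⟨t, ht, hcase, hr⟩ := light_real hd hdh (freq_nonneg (color := color) (color v) M)
    (freq_le_one (color := color) (color v) M) (freq_sq_le_freqSq (color := color) v M)
    (freqSq_le (color := color) v (List.ne_nil_of_mem hx)) hu (hxv ▸ hp x hx)
  obtain ⟨-, -, hprobe, hdiff⟩ := h.bounds hS hx ht
  obtain ⟨hE, hA, -, -⟩ := h.bounds hS hx (le_refl (M.length / 2))
  have htake : (pairs S).take (M.length / 2) = pairs S :=
    List.take_of_length_le (by rw [length_pairs, hS.length_eq])
  rw [hxv] at hprobe hdiff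
  rw [hxv, htake] at hA
  rw [htake] at hE
  have hc' : (c : ℝ) ≤ probeCost color (color v) (diffs color ((pairs S).take t)) := by
    rcases hcase with rfl | htr
    · rw [htake]
      exact_mod_cast hc.1
    -- The slack `7 d` is `2 d` for the candidate's count in `X`, `d` for `|X|`, `d` for the
    -- unpaired ball and `3 d` for the misses.
    · refine Nat.cast_le.2 (hc.2 t ?_)
      have hl : (num color (color v) (leftover S).toList : ℝ) ≤ 1 := by
        have h1 := num_le_length (color := color) (color v) (leftover S).toList
        have h2 := length_leftover S
        exact_mod_cast (by omega : num color (color v) (leftover S).toList ≤ 1)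
      have hE' := (abs_le.1 hE).1
      have hA' := (abs_le.1 hA).2
      have : ((2 * num color (color v) (kept color S) + num color (color v) (leftover S).toList +
          hits color (color v) (diffs color ((pairs S).take t)) : ℕ) : ℝ) ≤
          ((diffs color ((pairs S).take t)).length + (kept color S).length : ℕ) := by
        push_cast
        linarith
      exact_mod_cast this
  linarith

/-- The cost of `heavy` if the candidate is sufficiently frequent. -/
theorem heavyCost_le {M S : List β} {v : β} {T : ℕ} (hT : HeavyCost color M v S T)
    (hv : num color (color v) M * 2 ≤ M.length)
    (hN : 1000 ≤ M.length)
    (hp : 0.44 ≤ freq color (color v) M)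
    (hs : freqSq color M + tol M.length ≤ 2 * freq color (color v) M ^ 2)
    (hd : 1 ≤ dev M.length)
    (hgood : ∀ t, t = ⌈M.length * (1 - freq color (color v) M) ^ 2 / 2⌉₊ →
      |(((pairs S).take t).countP (fun q => decide (color q.1 ≠ color q.2)) : ℝ) -
        t * pairNum (fun q => decide (color q.1 ≠ color q.2))
          (M.filter (fun x => decide (color x ≠ color v))) /
          ((M.filter (fun x => decide (color x ≠ color v))).length : ℝ) ^ 2| ≤ dev M.length) :
    (T : ℝ) ≤ 7 / 6 * M.length := by
  set N : ℝ := (M.length : ℝ) with hNdef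
  set p := freq color (color v) M with hpdef
  set s := freqSq color M with hsdef
  set Y := M.filter (fun x => decide (color x ≠ color v)) with hY
  have hN0 : 1000 ≤ N := by rw [hNdef]; exact_mod_cast hN
  have hnum : (num color (color v) M : ℝ) = N * p := by
    rw [hpdef, freq, ← hNdef]; field_simp
  have hp2 : p ≤ 1 / 2 := by
    have : (num color (color v) M : ℝ) * 2 ≤ N := by rw [hNdef]; exact_mod_cast hv
    rw [hnum] at this
    nlinarith
  -- A pair of other balls has different colors with probability about `(1 - 2 p + 2 p ^ 2 - s) / (1
  -- - p) ^ 2`, and the numerator is at least `1 - 2 p + tol`. So this `t` yields the required `N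
  -- (1/2 - p)` pairs, with `N * tol / 2 = 50 dev` to spare for fluctuations.
  obtain ⟨t, ht⟩ : ∃ t, t = ⌈N * (1 - p) ^ 2 / 2⌉₊ := ⟨_, rfl⟩
  have hg := (abs_le.1 (hgood t ht)).1
  have hYlen : (Y.length : ℝ) = N * (1 - p) := by
    have := length_others (color := color) v M
    have h2 : (Y.length : ℝ) + num color (color v) M = N := by rw [hNdef]; exact_mod_cast this
    rw [hnum] at h2
    linarith
  have hSq : (sumSq color Y : ℝ) = N ^ 2 * (s - p ^ 2) := by
    have h1 := sumSq_split (color := color) v M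
    have h2 : (sumSq color M : ℝ) = num color (color v) M ^ 2 + sumSq color Y := by
      exact_mod_cast h1
    have h3 : (sumSq color M : ℝ) = N ^ 2 * s := by
      rw [hsdef, freqSq, ← hNdef]; field_simp
    rw [h3, hnum] at h2
    linarith
  have hpn : (pairNum (fun q => decide (color q.1 ≠ color q.2)) Y : ℝ) =
      N ^ 2 * (1 - 2 * p + 2 * p ^ 2 - s) := by
    have h1 := pairNum_ne (color := color) Y
    have h2 : (pairNum (fun q => decide (color q.1 ≠ color q.2)) Y : ℝ) + sumSq color Y =
      (Y.length : ℝ) ^ 2 := by exact_mod_cast h1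
    rw [hYlen, hSq] at h2
    linear_combination h2
  have hq0 : 0 < 1 - p := by linarith
  rw [hpn, hYlen] at hg
  have htl : N * (1 - p) ^ 2 / 2 ≤ t := ht ▸ Nat.le_ceil _
  have htu : (t : ℝ) < N * (1 - p) ^ 2 / 2 + 1 := ht ▸ Nat.ceil_lt_add_one (by positivity)
  have htol : 0 ≤ tol M.length := by unfold tol; positivity
  have hcoef : 0 ≤ 1 - 2 * p + 2 * p ^ 2 - s := by linarith
  have hmain : N / 2 * (1 - 2 * p + tol M.length) ≤
      t * (N ^ 2 * (1 - 2 * p + 2 * p ^ 2 - s)) / (N * (1 - p)) ^ 2 := by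
    have h1 : t * (N ^ 2 * (1 - 2 * p + 2 * p ^ 2 - s)) / (N * (1 - p)) ^ 2 =
        t / (1 - p) ^ 2 * (1 - 2 * p + 2 * p ^ 2 - s) := by
      field_simp
    rw [h1]
    refine mul_le_mul ?_ (by linarith) (by linarith) (by positivity)
    rw [le_div_iff₀ (by positivity)]
    linarith
  have hdev : dev M.length = N * tol M.length / 100 := rfl
  have hdl : (diffs color ((pairs S).take t)).length =
      ((pairs S).take t).countP (fun q => decide (color q.1 ≠ color q.2)) := by
    rw [diffs, List.countP_eq_length_filter]
  have hTt := hT.2 t ?_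
  · have hTt' : (T : ℝ) ≤ N + t := by rw [hNdef]; exact_mod_cast hTt
    -- `0.56 ^ 2 / 2 < 1/6`, and the gap times `N ≥ 1000` absorbs the rounding of `t`.
    have : (1 - p) ^ 2 ≤ 0.56 ^ 2 := pow_le_pow_left₀ hq0.le (by linarith) 2
    nlinarith
  · have h2 : (((M.length + 1) / 2 : ℕ) : ℝ) ≤ (N + 1) / 2 := by
      have : 2 * (((M.length + 1) / 2 : ℕ) : ℝ) ≤ N + 1 := by
        rw [hNdef]
        exact_mod_cast (by omega : 2 * ((M.length + 1) / 2) ≤ M.length + 1)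
      linarith
    have : (((M.length + 1) / 2 : ℕ) : ℝ) ≤
        ((num color (color v) M + (diffs color ((pairs S).take t)).length : ℕ) : ℝ) := by
      rw [Nat.cast_add, hnum, hdl]
      linarith
    exact_mod_cast this

theorem abs_sum_map_sub_le {l : List β} {f g : β → ℝ} {b : ℝ} (h : ∀ x ∈ l, |f x - g x| ≤ b) :
    |(l.map f).sum - (l.map g).sum| ≤ l.length * b := by
  induction l with
  | nil => simp
  | cons x l ih =>
    have h1 := ih fun y hy => h y (List.mem_cons_of_mem _ hy)
    have h2 := h x List.mem_cons_self
    rw [abs_le] at h1 h2 ⊢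
    simp only [List.map_cons, List.sum_cons, List.length_cons]
    push_cast
    constructor <;> linarith

/-- A good sample determines the frequencies and the sum of their squares. -/
theorem GoodSample.bounds {M S : List β} (h : GoodSample color M S) (hS : S.Perm M)
    (hM : 1 ≤ M.length) :
    let m := sampleSize M.length
    let W := S.take m
    (∀ x ∈ M, |(num color (color x) W / m : ℝ) - freq color (color x) M| ≤ tol M.length / 100) ∧
    |(sumSq color W / m ^ 2 : ℝ) - freqSq color M| ≤ tol M.length / 50 := by
  intro m W
  have hm0 : (0 : ℝ) < m := by exact_mod_cast one_le_sampleSize hM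
  have hN0 : (0 : ℝ) < M.length := by exact_mod_cast hM
  have hclose : ∀ x ∈ M, |(num color (color x) W : ℝ) - m * num color (color x) M / M.length| ≤
      m * (tol M.length / 100) := by
    intro x hx
    obtain ⟨i, rfl⟩ := List.get_of_mem hx
    exact h i (Finset.mem_univ _)
  refine ⟨fun x hx => ?_, ?_⟩
  · have : (num color (color x) W / m : ℝ) - freq color (color x) M =
        (num color (color x) W - m * num color (color x) M / M.length) / m := by
      rw [freq]; field_simp
    rw [this, abs_div, abs_of_pos hm0, div_le_iff₀ hm0,
      mul_comm (tol M.length / 100)]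
    exact hclose x hx
  · have hWM : ∀ x ∈ W, x ∈ M := fun x hx => hS.mem_iff.1 (List.mem_of_mem_take hx)
    have hWlen : (W.length : ℝ) = m := by
      have : W.length = m := by
        rw [List.length_take, hS.length_eq, min_eq_left (sampleSize_le hM)]
      rw [this]
    have h1 := abs_sum_map_sub_le fun x hx => hclose x (hWM x hx)
    have h2 := abs_sum_map_sub_le hclose
    have cast_sum : ∀ l l' : List β, (l.map (fun x => (num color (color x) l' : ℝ))).sum =
        ((l.map (fun x => num color (color x) l')).sum : ℕ) := by
      intro l l'
      rw [Nat.cast_list_sum, List.map_map]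
      rfl
    have mul_sum : ∀ l : List β,
        (l.map (fun x => (m : ℝ) * num color (color x) M / M.length)).sum =
        m / M.length * ((l.map (fun x => num color (color x) M)).sum : ℕ) := by
      intro l
      rw [← cast_sum, ← List.sum_map_mul_left]
      congr 1
      refine List.map_congr_left fun x _ => ?_
      ring
    rw [cast_sum, mul_sum, hWlen] at h1
    rw [cast_sum, mul_sum, sum_num_comm M W] at h2
    change |(sumSq color W : ℝ) - _| ≤ _ at h1
    change |_ - (m : ℝ) / M.length * (sumSq color M : ℝ)| ≤ _ at h2
    -- `Z` counts the equal pairs with one ball in the sample and one in `M`. Replacing sample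
    -- counts by counts in `M` one factor at a time, with double counting in between, costs `tol /
    -- 100` for each factor.
    set Z : ℝ := (((W.map (fun x => num color (color x) M)).sum : ℕ) : ℝ)
    have h3 : (sumSq color W / m ^ 2 : ℝ) - freqSq color M =
        (sumSq color W - m / M.length * Z) / m ^ 2 +
          (Z - m / M.length * sumSq color M) / (m * M.length) := by
      rw [freqSq]; field_simp; ring
    rw [h3]
    refine (abs_add_le _ _).trans ?_
    rw [abs_div, abs_div, abs_of_pos (by positivity : (0 : ℝ) < (m : ℝ) ^ 2),
      abs_of_pos (by positivity : (0 : ℝ) < (m : ℝ) * M.length)]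
    have h4 : |(sumSq color W : ℝ) - m / M.length * Z| / m ^ 2 ≤ tol M.length / 100 := by
      rw [div_le_iff₀ (by positivity)]
      linarith
    have h5 : |Z - m / M.length * (sumSq color M : ℝ)| / (m * M.length) ≤ tol M.length / 100 := by
      rw [div_le_iff₀ (by positivity)]
      linarith
    linarith

end Costs

/-! ### The recursion for the cost with high probability. -/

section Step

variable {β : Type} {κ : Type u} [DecidableEq κ] {color : β → κ}

theorem tol_nonneg (n : ℕ) : 0 ≤ tol n := by unfold tol; positivity

theorem dev_eq {n : ℕ} (hn : 1 ≤ n) : 100 * dev n = (n : ℝ) ^ (9 / 10 : ℝ) := by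
  have h : (0 : ℝ) < n := by exact_mod_cast hn
  rw [dev, tol, mul_div_cancel₀ _ (by norm_num : (100 : ℝ) ≠ 0),
    ← Real.rpow_one_add' h.le (by norm_num)]
  norm_num

theorem sampleSize_sq_le_dev {n : ℕ} (hn : 1 ≤ n) : (sampleSize n : ℝ) ^ 2 ≤ 400 * dev n := by
  have h : (1 : ℝ) ≤ n := by exact_mod_cast hn
  have h1 := sampleSize_sq_le hn
  have h2 : (n : ℝ) ^ (2 / 3 : ℝ) ≤ (n : ℝ) ^ (9 / 10 : ℝ) :=
    Real.rpow_le_rpow_of_exponent_le h (by norm_num)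
  have := dev_eq hn
  linarith

/-- Conditions that hold for all sufficiently long lists. -/
structure IsLarge (n : ℕ) : Prop where
  length : 1000 ≤ n
  dev : 2 ≤ dev n
  tol : tol n ≤ 1 / 40

theorem eventually_isLarge : ∀ᶠ n : ℕ in Filter.atTop, IsLarge n := by
  have h1 : Filter.Tendsto (fun n : ℕ => (n : ℝ) ^ (9 / 10 : ℝ)) Filter.atTop Filter.atTop :=
    (tendsto_rpow_atTop (by norm_num)).comp tendsto_natCast_atTop_atTop
  have h2 : Filter.Tendsto (fun n : ℕ => tol n) Filter.atTop (nhds 0) :=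
    (tendsto_rpow_neg_atTop (by norm_num : (0 : ℝ) < 1 / 10)).comp tendsto_natCast_atTop_atTop
  filter_upwards [Filter.eventually_ge_atTop 1000, h1.eventually_ge_atTop 200,
    h2.eventually_le_const (by norm_num : (0 : ℝ) < 1 / 40)] with n hn hd ht
  refine ⟨hn, ?_, ht⟩
  have := dev_eq (n := n) (by omega)
  linarith

/-- One level of the recursion, for a long list. -/
theorem failProb_majorityAux_step {fuel : ℕ} {M : List β} (hN : IsLarge M.length) {G : ℝ}
    (hG : 0 ≤ G) {δ : ℝ≥0∞}
    (hrec : ∀ X : List β, X.length ≤ (M.length + 1) / 2 → failProb color (majorityAux fuel X)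
      (fun r T => CorrectOn color X r ∧ (T : ℝ) ≤ 7 / 6 * X.length + G) ≤ δ) :
    failProb color (majorityAux (fuel + 1) M)
      (fun _ T => (T : ℝ) ≤ 7 / 6 * M.length + G + 1403 * dev M.length) ≤
      ENNReal.ofReal (5 * M.length ^ 2 * tail M.length) + δ := by
  obtain ⟨hN1, hd, ht⟩ := hN
  have hN0 : (1000 : ℝ) ≤ M.length := by exact_mod_cast hN1
  have htail := tail_nonneg M.length
  have htol := tol_nonneg M.length
  have hhN : (M.length : ℝ) ≤ 2 * ((M.length / 2 : ℕ) : ℝ) + 1 := by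
    exact_mod_cast (by omega : M.length ≤ 2 * (M.length / 2) + 1)
  have hhN' : 2 * ((M.length / 2 : ℕ) : ℝ) ≤ M.length := by
    exact_mod_cast (by omega : 2 * (M.length / 2) ≤ M.length)
  have hdev : M.length * tol M.length = 100 * dev M.length := by unfold dev; ring
  have hhtol : (M.length / 2 : ℕ) * tol M.length ≤ 50 * dev M.length := by
    have := mul_le_mul_of_nonneg_right hhN' htol
    linarith
  have hh0 : (0 : ℝ) ≤ (M.length / 2 : ℕ) := Nat.cast_nonneg _
  have hsz := sampleSize_sq_le_dev (n := M.length) (by omega)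
  have htotal : M.length * ENNReal.ofReal (tail M.length) +
      (((M.length / 2 + 1) * M.length : ℕ) * ENNReal.ofReal (4 * tail M.length) + δ) ≤
      ENNReal.ofReal (5 * M.length ^ 2 * tail M.length) + δ := by
    rw [← add_assoc, ← ENNReal.ofReal_natCast, ← ENNReal.ofReal_natCast,
      ← ENNReal.ofReal_mul (Nat.cast_nonneg _), ← ENNReal.ofReal_mul (Nat.cast_nonneg _),
      ← ENNReal.ofReal_add (by positivity) (by positivity)]
    refine add_le_add_left (ENNReal.ofReal_le_ofReal ?_) δ
    have h1 : (M.length : ℝ) + ((M.length / 2 + 1) * M.length : ℕ) * 4 ≤ 5 * M.length ^ 2 := by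
      push_cast
      nlinarith
    nlinarith
  refine le_trans ?_ htotal
  refine failProb_majorityAux_succ_le (by omega) (P := GoodSample color M)
    (failProb_goodSample_le (by omega)) ?_
  intro S hS hgood v k k₂ m ε W hk hmax hk₂ c hc
  obtain ⟨hq, hsq⟩ := hgood.bounds hS (by omega)
  have hm0 : (0 : ℝ) < m := by exact_mod_cast one_le_sampleSize (by omega : 1 ≤ M.length)
  have hc' : (c : ℝ) ≤ 400 * dev M.length := by
    refine le_trans ?_ hsz
    exact_mod_cast hc
  have hsq' := abs_le.1 hsq
  have hpq : ∀ x ∈ M, freq color (color x) M ≤ k / m + ε / 100 := by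
    intro x hx
    have h1 := (abs_le.1 (hq x hx)).1
    have h2 : (num color (color x) W : ℝ) / m ≤ k / m :=
      div_le_div_of_nonneg_right (by exact_mod_cast hmax (color x)) hm0.le
    linarith
  have hq0 : (0 : ℝ) ≤ k / m := by positivity
  have hq1 : (k : ℝ) / m ≤ 1 := by
    refine div_le_one_of_le₀ ?_ hm0.le
    have h1 : k ≤ W.length := hk ▸ num_le_length _ _
    have h2 : W.length ≤ m := List.length_take_le _ _
    exact_mod_cast h1.trans h2
  have hsquare : ∀ a b : ℝ, 0 ≤ a → 0 ≤ b → b ≤ 1 → a ≤ b + ε / 100 →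
      2 * a ^ 2 ≤ 2 * b ^ 2 + 6 / 100 * ε := by
    intro a b ha hb hb1 hab
    have h1 := pow_le_pow_left₀ ha hab 2
    have h2 : b * ε ≤ ε := mul_le_of_le_one_left htol hb1
    have h3 : ε * ε ≤ ε := mul_le_of_le_one_left htol (by linarith)
    nlinarith
  refine ⟨fun hb1 hb2 => ?_, fun hh1 hh2 => ?_, fun hl => ?_⟩
  · refine le_trans (failProb_mono ?_) (failProb_balanced_le
      (failProb_goodShuffle_le (by omega) hd) hrec)
    rintro r T ⟨-, S', hS', hg, hT⟩
    have hcost := hg.balanced_cost_le hS' (by linarith) hT ?_ ?_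
    · push_cast
      linarith
    · have h1 : (k / m : ℝ) ^ 2 + (k₂ / m : ℝ) ^ 2 ≤ sumSq color W / m ^ 2 := by
        rw [div_pow, div_pow, ← add_div]
        exact div_le_div_of_nonneg_right (by exact_mod_cast hk₂) (by positivity)
      have h0 : 0 ≤ 1 / 2 - 4 * ε := by linarith
      have h2 := pow_le_pow_left₀ h0 hb1.1 2
      have h3 := pow_le_pow_left₀ h0 hb2.1 2
      -- Two sample classes of frequency at least `1/2 - 4 ε` force a sum of squares of at least
      -- `1/2 - 8 ε`; the sample error adds `0.02 ε`. As `h * ε ≤ 50 dev`, this fits into `410 dev`.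
      have h4 : 1 / 2 - 8.02 * ε ≤ freqSq color M := by
        have := sq_nonneg ε
        linarith [hsq'.2]
      have := mul_le_mul_of_nonneg_left h4 hh0
      linarith
    · intro x hx
      have h1 : freq color (color x) M ≤ 1 / 2 + 4.01 * ε := by linarith [hpq x hx, hb1.2]
      have := mul_le_mul_of_nonneg_left h1 hh0
      linarith
  · have hv : ∃ x ∈ M, color x = color v := by
      have : 0 < num color (color v) W := by
        rw [← hk]
        refine Nat.pos_of_ne_zero fun h0 => ?_
        rw [h0, Nat.cast_zero, zero_div] at hh1
        norm_num at hh1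
      obtain ⟨x, hx, hxv⟩ := List.countP_pos_iff.1 this
      exact ⟨x, hS.mem_iff.1 (List.mem_of_mem_take hx), by simpa using hxv⟩
    obtain ⟨x, hx, hxv⟩ := hv
    have hpv := (abs_le.1 (hq x hx)).2
    rw [hxv, ← hk] at hpv
    have hp44 : 0.44 ≤ freq color (color v) M := by linarith
    -- Of the margin `2 ε` in the test, the sample errors consume only `0.08 ε`.
    have hs : freqSq color M + tol M.length ≤ 2 * freq color (color v) M ^ 2 := by
      have h1 := hsquare (k / m) (freq color (color v) M) hq0 (freq_nonneg _ _)
        (freq_le_one _ _) (by linarith)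
      linarith [hsq'.1]
    have hle : ENNReal.ofReal (tail M.length) ≤
        ((M.length / 2 + 1) * M.length : ℕ) * ENNReal.ofReal (4 * tail M.length) + δ := by
      refine le_add_right ?_
      rw [← ENNReal.ofReal_natCast, ← ENNReal.ofReal_mul (Nat.cast_nonneg _)]
      refine ENNReal.ofReal_le_ofReal ?_
      have : (1 : ℝ) ≤ ((M.length / 2 + 1) * M.length : ℕ) := by
        exact_mod_cast Nat.one_le_iff_ne_zero.2 (by
          have : 0 < M.length := by omega
          positivity)
      nlinarith
    refine le_trans (le_trans (failProb_mono ?_) (failProb_heavy_le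
      (P := fun S => ∀ t, t = ⌈M.length * (1 - freq color (color v) M) ^ 2 / 2⌉₊ →
      |(((pairs S).take t).countP (fun q => decide (color q.1 ≠ color q.2)) : ℝ) -
        t * pairNum (fun q => decide (color q.1 ≠ color q.2))
          (M.filter (fun x => decide (color x ≠ color v))) /
          ((M.filter (fun x => decide (color x ≠ color v))).length : ℝ) ^ 2| ≤ dev M.length)
      (δ₁ := ENNReal.ofReal (tail M.length)) ?_)) hle
    · rintro r T ⟨-, hT | ⟨S', hS', hv', hg, hT⟩⟩
      · have hT' : (T : ℝ) ≤ M.length := by exact_mod_cast hT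
        push_cast
        linarith
      · have hcost := heavyCost_le hT hv' hN1 hp44 hs (by linarith) hg
        push_cast
        linarith
    · intro hv'
      have hlen := length_others (color := color) v M
      simp only [forall_eq]
      refine failProb_pairs_le_tail (by omega) (by omega) hd _ ?_
      set p := freq color (color v) M with hp
      have hnum : (num color (color v) M : ℝ) = M.length * p := by
        rw [hp, freq]; field_simp
      have hp2 : p ≤ 1 / 2 := by
        have : (num color (color v) M : ℝ) * 2 ≤ M.length := by exact_mod_cast hv'
        rw [hnum] at this
        refine le_of_mul_le_mul_left (a := (M.length : ℝ)) ?_ (by linarith)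
        linarith
      have hlen' : ((M.filter (fun x => decide (color x ≠ color v))).length : ℝ) =
          M.length * (1 - p) := by
        have : ((M.filter (fun x => decide (color x ≠ color v))).length : ℝ) +
          num color (color v) M = M.length := by exact_mod_cast hlen
        rw [hnum] at this
        linarith
      have hceil := Nat.ceil_lt_add_one
        (show (0 : ℝ) ≤ M.length * (1 - p) ^ 2 / 2 by positivity)
      have : 2 * ((⌈M.length * (1 - p) ^ 2 / 2⌉₊ : ℕ) : ℝ) ≤
          (M.filter (fun x => decide (color x ≠ color v))).length := by
        rw [hlen']
        have h1 : 0.44 * (1 / 2) ≤ p * (1 - p) :=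
          mul_le_mul hp44 (by linarith) (by norm_num) (by linarith)
        have h2 := mul_le_mul hN0 h1 (by norm_num) (by linarith)
        have h3 : (M.length : ℝ) * (1 - p) ^ 2 = M.length * (1 - p) - M.length * (p * (1 - p)) := by
          ring
        linarith
      exact_mod_cast this
  · refine le_trans (failProb_mono ?_) (failProb_light_le
      (failProb_goodShuffle_le (by omega) hd) hrec)
    rintro r T ⟨-, S', hS', hg, hT⟩
    have hcost := hg.light_cost_le hS' (by linarith) (by
      have := mul_le_mul_of_nonneg_left ht (show (0 : ℝ) ≤ M.length by linarith)
      linarith) hT ?_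
    · push_cast
      linarith
    · intro x hx
      -- Either every color is rare, or the failed test for `heavy` bounds `2 p ^ 2 - s` by `2.08
      -- ε`. Multiplied by `h`, the latter is at most `104 dev`.
      rcases hl with hl | hl
      · exact Or.inl (by linarith [hpq x hx])
      · right
        have h1 := hsquare (freq color (color x) M) (k / m) (freq_nonneg _ _) hq0 hq1 (hpq x hx)
        have h2 : 2 * freq color (color x) M ^ 2 - freqSq color M ≤ 2.08 * ε := by
          linarith [hsq'.2]
        have := mul_le_mul_of_nonneg_left h2 hh0
        linarith

/-- The constant in front of the lower order term of the cost of the recursion. -/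
noncomputable def lowerOrderConst : ℝ := 14.03 / (1 - (3 / 4 : ℝ) ^ (9 / 10 : ℝ))

theorem contraction_lt_one : (3 / 4 : ℝ) ^ (9 / 10 : ℝ) < 1 :=
  Real.rpow_lt_one (by norm_num) (by norm_num) (by norm_num)

theorem lowerOrderConst_pos : 0 < lowerOrderConst :=
  div_pos (by norm_num) (sub_pos.2 contraction_lt_one)

/-- The recursion, with the trivial bound for lists shorter than `B`. -/
theorem failProb_majorityAux_le {B : ℝ} (hB : 1 ≤ B) (hlarge : ∀ n : ℕ, B ≤ n → IsLarge n)
    {R : ℕ} {x : ℝ} (hx : ∀ n : ℕ, B ≤ n → n ≤ R → 5 * n ^ 2 * tail n ≤ x) :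
    ∀ (fuel : ℕ) (M : List β), M.length ≤ fuel → M.length ≤ R →
      failProb color (majorityAux fuel M) (fun r T => CorrectOn color M r ∧
        (T : ℝ) ≤ 7 / 6 * M.length +
          (lowerOrderConst * (M.length : ℝ) ^ (9 / 10 : ℝ) + 40 * B)) ≤
      M.length * ENNReal.ofReal x := by
  intro fuel
  have hC := lowerOrderConst_pos
  have hsmall : ∀ (fuel : ℕ) (M : List β), M.length ≤ fuel → (M.length : ℝ) < B →
      failProb color (majorityAux fuel M) (fun r T => CorrectOn color M r ∧
        (T : ℝ) ≤ 7 / 6 * M.length +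
          (lowerOrderConst * (M.length : ℝ) ^ (9 / 10 : ℝ) + 40 * B)) ≤
      M.length * ENNReal.ofReal x := by
    intro fuel M hM hMB
    refine (failProb_mono ?_).trans
      ((failProb_majorityAux_eq_zero color fuel M hM).le.trans zero_le)
    rintro r T ⟨hr, hT⟩
    refine ⟨hr, ?_⟩
    have h1 : (T : ℝ) ≤ 40 * M.length := by exact_mod_cast hT
    have h2 : 0 ≤ lowerOrderConst * (M.length : ℝ) ^ (9 / 10 : ℝ) := by positivity
    have h3 : (0 : ℝ) ≤ M.length := Nat.cast_nonneg _
    linarith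
  induction fuel with
  | zero =>
    intro M hM _
    refine hsmall 0 M hM ?_
    have : M.length = 0 := by omega
    rw [this, Nat.cast_zero]
    linarith
  | succ fuel ih =>
    intro M hM hR
    by_cases hMB : (M.length : ℝ) < B
    · exact hsmall _ M hM hMB
    push Not at hMB
    have hL := hlarge _ hMB
    have hN := hL.length
    have hN0 : (1000 : ℝ) ≤ M.length := by exact_mod_cast hN
    have hx0 : 0 ≤ x := le_trans (by have := tail_nonneg M.length; positivity) (hx _ hMB hR)
    have hG : (0 : ℝ) ≤ lowerOrderConst * (3 / 4 * M.length : ℝ) ^ (9 / 10 : ℝ) + 40 * B := by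
      positivity
    -- The present level may fail with probability `x`. The recursive list is strictly shorter,
    -- which leaves `M.length - 1` times `x` for it.
    have hstep := failProb_majorityAux_step (color := color) (fuel := fuel) hL hG
      (δ := (M.length - 1 : ℕ) * ENNReal.ofReal x) ?_
    · refine (failProb_and_le _ _ _).trans ?_
      rw [← zero_add ((M.length : ℝ≥0∞) * ENNReal.ofReal x)]
      refine add_le_add ?_ ?_
      · refine le_trans (failProb_mono ?_) (failProb_majorityAux_eq_zero color _ M hM).le
        exact fun r T h => h.1
      · refine (failProb_mono ?_).trans (hstep.trans ?_)
        · intro r T hT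
          refine hT.trans ?_
          have h1 := dev_eq (n := M.length) (by omega)
          rw [Real.mul_rpow (by norm_num) (by linarith)]
          -- The constant solves `K = K * (3/4) ^ (9/10) + 14.03`, where `14.03 * N ^ (9/10)` is the
          -- error `1403 dev` of one level.
          have h2 : lowerOrderConst * (1 - (3 / 4 : ℝ) ^ (9 / 10 : ℝ)) = 14.03 :=
            div_mul_cancel₀ _ (sub_pos.2 contraction_lt_one).ne'
          have h3 : lowerOrderConst * ((3 / 4 : ℝ) ^ (9 / 10 : ℝ) *
              (M.length : ℝ) ^ (9 / 10 : ℝ)) =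
              lowerOrderConst * (M.length : ℝ) ^ (9 / 10 : ℝ) -
              14.03 * (M.length : ℝ) ^ (9 / 10 : ℝ) := by
            rw [← h2]; ring
          rw [h3, ← h1]
          linarith
        · have h1 : (M.length : ℝ≥0∞) = 1 + (M.length - 1 : ℕ) := by
            exact_mod_cast (by omega : M.length = 1 + (M.length - 1))
          conv_rhs => rw [h1]
          rw [add_mul, one_mul]
          exact add_le_add_left (ENNReal.ofReal_le_ofReal (hx _ hMB hR)) _
    · intro X hX
      refine (failProb_mono ?_).trans ((ih X (by omega) (by omega)).trans ?_)
      · rintro r T ⟨hr, hT⟩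
        refine ⟨hr, hT.trans ?_⟩
        have hXN : (X.length : ℝ) ≤ 3 / 4 * M.length := by
          have : 2 * (X.length : ℝ) ≤ M.length + 1 := by
            exact_mod_cast (by omega : 2 * X.length ≤ M.length + 1)
          linarith
        have := mul_le_mul_of_nonneg_left (Real.rpow_le_rpow (Nat.cast_nonneg _) hXN
          (by norm_num : (0 : ℝ) ≤ 9 / 10)) hC.le
        linarith
      · exact mul_le_mul_left (by exact_mod_cast (by omega : X.length ≤ M.length - 1)) _

end Step

/-! ### Asymptotic estimates for the error terms. -/

section Asymptotics

/-- The failure probability of the whole recursion is superpolynomially small. -/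
theorem eventually_failure_small : ∀ᶠ n : ℕ in Filter.atTop,
    (n : ℝ) * (10 * (n : ℝ) ^ 2 *
      Real.exp (-(((n : ℝ) ^ (9 / 10 : ℝ)) ^ (2 / 15 : ℝ) / 2000000))) ≤
      Real.exp (-(Real.log n ^ 2)) := by
  -- With `4000 * log n ≤ y = n ^ (3/50)` the exponent `y ^ 2 / 2000000` is at least `8 * log n ^
  -- 2`, which beats `log n ^ 2 + 3 * log n + 3`.
  have hlog := ((isLittleO_log_rpow_atTop (by norm_num : (0 : ℝ) < 3 / 50)).comp_tendsto
    tendsto_natCast_atTop_atTop).bound (by norm_num : (0 : ℝ) < 1 / 4000)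
  have hlog1 : ∀ᶠ n : ℕ in Filter.atTop, 3 ≤ Real.log n :=
    (Real.tendsto_log_atTop.comp tendsto_natCast_atTop_atTop).eventually_ge_atTop 3
  filter_upwards [hlog, hlog1, Filter.eventually_ge_atTop 1] with n h1 h2 hn
  have hn0 : (0 : ℝ) < n := by exact_mod_cast hn
  simp only [Function.comp_apply, Real.norm_eq_abs] at h1
  rw [abs_of_nonneg (by linarith), abs_of_nonneg (by positivity)] at h1
  have h3 : ((n : ℝ) ^ (9 / 10 : ℝ)) ^ (2 / 15 : ℝ) = ((n : ℝ) ^ (3 / 50 : ℝ)) ^ 2 := by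
    rw [← Real.rpow_mul hn0.le, ← Real.rpow_natCast, ← Real.rpow_mul hn0.le]
    norm_num
  have h10 : (10 : ℝ) ≤ Real.exp 3 := by
    have h := Real.exp_one_gt_d9
    have h4 : Real.exp 3 = Real.exp 1 ^ 3 := by rw [← Real.exp_nat_mul]; norm_num
    rw [h4]
    have := pow_le_pow_left₀ (by norm_num) h.le 3
    norm_num at this ⊢
    exact this.trans' (by norm_num)
  have hexp : (n : ℝ) = Real.exp (Real.log n) := (Real.exp_log hn0).symm
  rw [h3]
  set y := (n : ℝ) ^ (3 / 50 : ℝ)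
  set l := Real.log n
  have hly : 4000 * l ≤ y := by linarith
  have hly2 := pow_le_pow_left₀ (by linarith : 0 ≤ 4000 * l) hly 2
  calc (n : ℝ) * (10 * (n : ℝ) ^ 2 * Real.exp (-(y ^ 2 / 2000000)))
      = 10 * (Real.exp l) ^ 3 * Real.exp (-(y ^ 2 / 2000000)) := by rw [← hexp]; ring
    _ ≤ Real.exp 3 * (Real.exp l) ^ 3 * Real.exp (-(y ^ 2 / 2000000)) := by gcongr
    _ = Real.exp (3 + 3 * l - y ^ 2 / 2000000) := by
        rw [← Real.exp_nat_mul, ← Real.exp_add, ← Real.exp_add]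
        congr 1
    _ ≤ Real.exp (-(l ^ 2)) := by
        refine Real.exp_le_exp.2 ?_
        nlinarith

theorem isLittleO_mul_exp_neg_log_sq :
    (fun n : ℕ => (n : ℝ) * Real.exp (-(Real.log n ^ 2))) =o[Filter.atTop]
      (fun n : ℕ => (n : ℝ)) := by
  have h : Filter.Tendsto (fun n : ℕ => Real.exp (-(Real.log n ^ 2))) Filter.atTop (nhds 0) :=
    Real.tendsto_exp_neg_atTop_nhds_zero.comp ((Filter.tendsto_pow_atTop two_ne_zero).comp
      (Real.tendsto_log_atTop.comp tendsto_natCast_atTop_atTop))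
  simpa using (Asymptotics.isBigO_refl (fun n : ℕ => (n : ℝ)) Filter.atTop).mul_isLittleO
    ((Asymptotics.isLittleO_one_iff ℝ).2 h)

theorem isLittleO_rpow_self : (fun n : ℕ => (n : ℝ) ^ (9 / 10 : ℝ)) =o[Filter.atTop]
    (fun n : ℕ => (n : ℝ)) := by
  have h : Filter.Tendsto (fun n : ℕ => tol n) Filter.atTop (nhds 0) :=
    (tendsto_rpow_neg_atTop (by norm_num : (0 : ℝ) < 1 / 10)).comp tendsto_natCast_atTop_atTop
  have h' : (fun n : ℕ => (n : ℝ) * tol n) =o[Filter.atTop] (fun n : ℕ => (n : ℝ)) := by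
    simpa using (Asymptotics.isBigO_refl (fun n : ℕ => (n : ℝ)) Filter.atTop).mul_isLittleO
      ((Asymptotics.isLittleO_one_iff ℝ).2 h)
  refine h'.congr' ?_ Filter.EventuallyEq.rfl
  filter_upwards [Filter.eventually_ge_atTop 1] with n hn
  rw [← dev_eq hn, dev]
  ring

end Asymptotics

/-! ### Transfer to the law of `majority`: correctness, tail and expectation. -/

section Law

variable {n : ℕ} {κ : Type u} [DecidableEq κ] (color : Fin n → κ)

theorem majorityLaw_worst_case : ∀ r ∈ (majorityLaw color).support,
    CorrectOn color (List.finRange n) r.1 ∧ r.2 ≤ 40 * n := by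
  have h := failProb_majorityAux_eq_zero color (List.finRange n).length (List.finRange n) le_rfl
  rw [List.length_finRange] at h
  rw [failProb_eq_zero_iff] at h
  intro r hr
  refine h r ?_
  rwa [majorityLaw, majority, List.length_finRange] at hr

theorem isCorrect_of_correctOn {r : Option (Fin n × ℕ)}
    (h : CorrectOn color (List.finRange n) r) : IsCorrect color r := by
  have hnum : ∀ a, multiplicity color a = num color a (List.finRange n) := by
    intro a
    rw [multiplicity, num, List.countP_eq_length_filter, Fin.univ_def, Finset.card_def,
      Finset.filter_val, Multiset.filter_coe, Multiset.coe_card]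
  cases r with
  | none => intro a; rw [hnum]; simpa using h a
  | some q => exact ⟨(hnum _).trans h.1, by simpa using h.2⟩

/-- The tail bound for the cost, for a constant that does not depend on the coloring. -/
theorem exists_majorityLaw_tail : ∃ C : ℝ, 0 ≤ C ∧
    ∀ (n : ℕ) (κ : Type u) [DecidableEq κ] (color : Fin n → κ),
      (majorityLaw color).toOuterMeasure
        {r | ¬ (r.2 : ℝ) ≤ 7 / 6 * n + C * (n : ℝ) ^ (9 / 10 : ℝ)} ≤
      ENNReal.ofReal (Real.exp (-(Real.log n ^ 2))) := by
  have hC := lowerOrderConst_pos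
  obtain ⟨N₀, hN₀⟩ := Filter.eventually_atTop.1 eventually_isLarge
  have hpow : Filter.Tendsto (fun n : ℕ => (n : ℝ) ^ (9 / 10 : ℝ)) Filter.atTop Filter.atTop :=
    (tendsto_rpow_atTop (by norm_num)).comp tendsto_natCast_atTop_atTop
  obtain ⟨N₁, hN₁⟩ := Filter.eventually_atTop.1 ((hpow.eventually_ge_atTop (N₀ : ℝ)).and
    eventually_failure_small)
  -- The first two terms pay for the recursion with cutoff `n ^ (9/10)`; `40 * N₁` covers `n < N₁`
  -- through the sure bound `40 * n`.
  refine ⟨lowerOrderConst + 40 + 40 * N₁, by positivity, fun n κ _ color => ?_⟩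
  by_cases hn : n < N₁ ∨ n = 0
  · refine le_trans (le_of_eq ?_) zero_le
    rw [PMF.toOuterMeasure_apply_eq_zero_iff, Set.disjoint_left]
    intro r hr hr'
    refine hr' ?_
    have h1 : (r.2 : ℝ) ≤ 40 * n := by exact_mod_cast (majorityLaw_worst_case color r hr).2
    rcases Nat.eq_zero_or_pos n with rfl | hn0
    · simpa using h1
    have hn1 : (1 : ℝ) ≤ n := by exact_mod_cast hn0
    have h2 : (1 : ℝ) ≤ (n : ℝ) ^ (9 / 10 : ℝ) := Real.one_le_rpow hn1 (by norm_num)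
    have h3 : (n : ℝ) ≤ N₁ := by exact_mod_cast (hn.resolve_right hn0.ne').le
    nlinarith
  · push Not at hn
    obtain ⟨hn1, hn0⟩ := hn
    have hn0' : (1 : ℝ) ≤ n := by exact_mod_cast Nat.one_le_iff_ne_zero.2 hn0
    obtain ⟨hB, hsmall⟩ := hN₁ n hn1
    -- Below this cutoff the linear bound stays within the error term; above it the lists are still
    -- so long that each level fails with superpolynomially small probability.
    set B : ℝ := (n : ℝ) ^ (9 / 10 : ℝ) with hBdef
    have hB1 : 1 ≤ B := Real.one_le_rpow hn0' (by norm_num)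
    have h := failProb_majorityAux_le (color := color) hB1
      (fun m hm => hN₀ m (by exact_mod_cast hB.trans hm)) (R := n)
      (x := 10 * (n : ℝ) ^ 2 * Real.exp (-(B ^ (2 / 15 : ℝ) / 2000000)))
      (fun m hm hmn => by
        have h1 : B ^ (2 / 15 : ℝ) ≤ (m : ℝ) ^ (2 / 15 : ℝ) :=
          Real.rpow_le_rpow (by linarith) hm (by norm_num)
        have h2 : (m : ℝ) ^ 2 ≤ (n : ℝ) ^ 2 :=
          pow_le_pow_left₀ (Nat.cast_nonneg _) (by exact_mod_cast hmn) 2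
        have h3 : Real.exp (-((m : ℝ) ^ (2 / 15 : ℝ) / 2000000)) ≤
            Real.exp (-(B ^ (2 / 15 : ℝ) / 2000000)) := Real.exp_le_exp.2 (by linarith)
        have h4 := mul_le_mul h2 h3 (Real.exp_pos _).le (by positivity)
        unfold tail
        linarith)
      (List.finRange n).length (List.finRange n) le_rfl (by simp)
    rw [List.length_finRange, ← ENNReal.ofReal_natCast n,
      ← ENNReal.ofReal_mul (Nat.cast_nonneg _)] at h
    refine le_trans ?_ (h.trans (ENNReal.ofReal_le_ofReal hsmall))
    rw [majorityLaw, majority, List.length_finRange]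
    refine MeasureTheory.measure_mono fun r hr hr' => hr ?_
    refine hr'.2.trans ?_
    have : (0 : ℝ) ≤ N₁ * B := by positivity
    rw [← hBdef]
    linarith

/-- Splitting at the tail threshold `B` gives a mean of at most `B + 40 n * Pr[T > B]`, because `40
n` bounds the cost on the whole support. -/
theorem exists_expectation_le : ∃ f : ℕ → ℝ, f =o[Filter.atTop] (fun n : ℕ => (n : ℝ)) ∧
    ∀ (n : ℕ) (κ : Type u) [DecidableEq κ] (color : Fin n → κ),
      ∑' r, majorityLaw color r * (r.2 : ENNReal) ≤ ENNReal.ofReal (7 / 6 * n + f n) := by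
  obtain ⟨C, hC, htail⟩ := exists_majorityLaw_tail.{u}
  refine ⟨fun n => C * (n : ℝ) ^ (9 / 10 : ℝ) + 40 * (n * Real.exp (-(Real.log n ^ 2))),
    (isLittleO_rpow_self.const_mul_left C).add (isLittleO_mul_exp_neg_log_sq.const_mul_left 40),
    fun n κ _ color => ?_⟩
  set B : ℝ := 7 / 6 * n + C * (n : ℝ) ^ (9 / 10 : ℝ) with hB
  have hB0 : 0 ≤ B := by positivity
  have hpoint : ∀ r : Option (Fin n × ℕ) × ℕ,
      majorityLaw color r * (r.2 : ENNReal) ≤ majorityLaw color r * ENNReal.ofReal B +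
        Set.indicator {r : Option (Fin n × ℕ) × ℕ | ¬ (r.2 : ℝ) ≤ B} (majorityLaw color) r *
          ENNReal.ofReal (40 * n) := by
    intro r
    by_cases hr : (r.2 : ℝ) ≤ B
    · refine le_add_right (mul_le_mul_right ?_ _)
      rw [← ENNReal.ofReal_natCast]
      exact ENNReal.ofReal_le_ofReal hr
    · rw [Set.indicator_of_mem (show r ∈ {r : Option (Fin n × ℕ) × ℕ | ¬ (r.2 : ℝ) ≤ B} from hr)]
      by_cases h0 : majorityLaw color r = 0
      · simp [h0]
      · refine le_add_left (mul_le_mul_right ?_ _)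
        rw [← ENNReal.ofReal_natCast]
        refine ENNReal.ofReal_le_ofReal ?_
        exact_mod_cast (majorityLaw_worst_case color r ((PMF.mem_support_iff _ _).2 h0)).2
  refine (ENNReal.tsum_le_tsum hpoint).trans ?_
  rw [ENNReal.tsum_add, ENNReal.tsum_mul_right, ENNReal.tsum_mul_right, PMF.tsum_coe, one_mul,
    ← PMF.toOuterMeasure_apply]
  refine (add_le_add_right (mul_le_mul_left (htail n κ color) _) _).trans (le_of_eq ?_)
  rw [← ENNReal.ofReal_mul (Real.exp_pos _).le, ← ENNReal.ofReal_add hB0 (by positivity)]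
  congr 1
  rw [hB]
  ring

theorem exists_probability_ge : ∃ C : ℝ,
    ∀ (n : ℕ) (κ : Type u) [DecidableEq κ] (color : Fin n → κ),
      ENNReal.ofReal (1 - Real.exp (-(1 * Real.log n ^ 2))) ≤
        (majorityLaw color).toOuterMeasure
          {r | (r.2 : ℝ) ≤ 7 / 6 * n + C * (n : ℝ) ^ (9 / 10 : ℝ)} := by
  obtain ⟨C, -, htail⟩ := exists_majorityLaw_tail.{u}
  refine ⟨C, fun n κ _ color => ?_⟩
  rw [one_mul, ENNReal.ofReal_sub _ (Real.exp_pos _).le, ENNReal.ofReal_one, tsub_le_iff_right]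
  refine le_trans ?_ (add_le_add_right (htail n κ color) _)
  refine le_trans (le_of_eq ?_) (MeasureTheory.measure_union_le _ _)
  rw [eq_comm, PMF.toOuterMeasure_apply_eq_one_iff]
  intro r _
  exact em _

end Law

end ColorMajority

theorem mainTheorem1 :
    -- the answer is correct for all random choices
    (∀ (n : ℕ) (κ : Type u) [DecidableEq κ] (color : Fin n → κ),
      ∀ r ∈ (ColorMajority.majorityLaw color).support, ColorMajority.IsCorrect color r.1) ∧
    -- with very high probability at most `7n/6 + O(n^(9/10))` comparisons
    (∃ c : ℝ, 0 < c ∧ ∃ C : ℝ, ∀ (n : ℕ) (κ : Type u) [DecidableEq κ] (color : Fin n → κ),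
      ENNReal.ofReal (1 - Real.exp (-(c * Real.log n ^ 2))) ≤
        (ColorMajority.majorityLaw color).toOuterMeasure
          {r | (r.2 : ℝ) ≤ 7 / 6 * n + C * (n : ℝ) ^ (9 / 10 : ℝ)}) ∧
    -- in expectation at most `7n/6 + o(n)` comparisons
    (∃ f : ℕ → ℝ, f =o[Filter.atTop] (fun n : ℕ => (n : ℝ)) ∧
      ∀ (n : ℕ) (κ : Type u) [DecidableEq κ] (color : Fin n → κ),
        ∑' r, ColorMajority.majorityLaw color r * (r.2 : ENNReal) ≤
          ENNReal.ofReal (7 / 6 * n + f n)) := by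
  exact ⟨fun n κ _ color r hr => ColorMajority.isCorrect_of_correctOn color
      (ColorMajority.majorityLaw_worst_case color r hr).1,
    ⟨1, one_pos, ColorMajority.exists_probability_ge⟩, ColorMajority.exists_expectation_le⟩
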